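/- **Conventions.** Let $n\ge 2$ and $k\in\mathbb R$. Lorentzian metrics have signature $(+,-,\dots,-)$, and Clifford multiplication (written as juxtaposition) satisfies $vw+wv=2g(v,w)$. Let $M$ be the simply connected, geodesically complete Lorentzian space form of dimension $n$ and constant sectional curvature $k$ (with respect to this metric $g$), time-oriented: Minkowski space if $k=0$, the universal covering of the pseudosphere $\{q=1/k\}$ of $q=k^{-1}dw^2+dt^2-|dy|^2$ on $\mathbb R\times\mathbb R\times\mathbb R^{n-1}$ if $k\ne0$; thus $k<0$ is de Sitter space and $k>0$ is anti-de Sitter space. Let $\nabla$ be the spin connection on the spinor bundle of $M$ and $D_M=g^{ij}e_i\nabla_j$ the Dirac operator. Let $\Omega\subset M$ be an open set that is a normal neighbourhood of each of its points (that is, for each $x\in\Omega$ the map $\exp_x$ is a diffeomorphism of a star-shaped neighbourhood of $0\in T_xM$ onto $\Omega$), or, if $k\le 0$, let $\Omega=M$. Let $J^+_\Omega(x)$ be the causal future of $x$ in $\Omega$. For $x\in\Omega$ and $x'\in J_\Omega^+(x)$, let $\rho(x,x')$ be the Lorentzian distance, that is, the length of the future-directed causal geodesic in $\Omega$ from $x$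 to $x'$; if $\rho(x,x')>0$, let $\nu(x,x')\in T_x\Omega$ be the unit tangent vector at $x$ of this geodesic, and $\Lambda(x,x')$ the spinor parallel transport along it from the fibre at $x'$ to the fibre at $x$. For $r>0$ put $S^+_\Omega(x,r)=\{x'\in J^+_\Omega(x):\rho(x,x')=r\}$, with induced hypersurface measure $dS$. Write $s_k(r)=\sin(\sqrt k\,r)/\sqrt k$ (so $s_0(r)=r$), $m_M(r)=|\mathbb S^{n-1}|\,s_k(r)^{n-1}$, $d\mu_M(r)=m_M(r)\,dr$, and $\operatorname{diam}M=\pi/\sqrt k$ if $k>0$, $\operatorname{diam}M=\infty$ if $k\le0$. For a smooth spinor field $\psi$ with compact support in $\Omega$, $x\in\Omega$ and $0<r<\operatorname{diam}M$, let $$\mathcal M_r\psi(x)=\frac1{m_M(r)}\int_{S^+_\Omega(x,r)}\Lambda(x,x')\psi(x')\,dS(x'),\qquad \widehat{\mathcal M}_r\psi(x)=\frac1{m_M(r)}\int_{S^+_\Omega(x,r)}\nu(x,x')\Lambda(x,x')\psi(x')\,dS(x').$$ Finally, let $$T_Mf=f''+(n-1)\sqrt k\cot(\sqrt k\,r)f'-\tfrac{k(n-1)}4\Big(\sec^2\tfrac{\sqrt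 k\,r}2+n-1\Big)f,$$ $$\widehat T_Mf=f''+(n-1)\sqrt k\cot(\sqrt k\,r)f'-\tfrac{k(n-1)}4\Big(\csc^2\tfrac{\sqrt k\,r}2+n-1\Big)f,$$ where for $k=0$ the coefficients are their limits, that is, $\sqrt k\cot(\sqrt k\,r)=1/r$, $k\sec^2(\sqrt k\,r/2)=0$ and $k\csc^2(\sqrt k\,r/2)=4/r^2$. **Lemma.** Let $f,\hat f\in C_0^\infty((0,\operatorname{diam}M))$ be complex-valued and let $\psi$ be a smooth spinor field with compact support in $\Omega$. Then the integrals that define $\mathcal M_r\psi(x)$ and $\widehat{\mathcal M}_r\psi(x)$ for $x\in\Omega$, $0<r<\operatorname{diam}M$, and the radial integrals below converge absolutely, the spinor field $\int_0^\infty(f(r)\mathcal M_r\psi+\hat f(r)\widehat{\mathcal M}_r\psi)\,d\mu_M(r)$ is smooth on $\Omega$, and on $\Omega$ $$D_M^2\int_0^\infty\big(f(r)\,\mathcal M_r\psi+\hat f(r)\,\widehat{\mathcal M}_r\psi\big)\,d\mu_M(r)=\int_0^\infty\big(T_Mf(r)\,\mathcal M_r\psi+\widehat T_M\hat f(r)\,\widehat{\mathcal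 M}_r\psi\big)\,d\mu_M(r).$$ -/

import Mathlib

open scoped Topology ContDiff

namespace LorentzSpinor

noncomputable section

/-! ### The simply connected Lorentzian space forms

The metric has signature `(+, -, ..., -)`, `d ≥ 1` is the number of space dimensions, and the
dimension of the manifold is `n = d + 1`. The model of constant sectional curvature `k` is the
pseudosphere `q = 1 / k` of the quadratic form `q = k⁻¹ dw² + dt² - |dy|²` (Minkowski space
`w = 1` if `k = 0`), and the simply connected space form is its universal covering. -/

/-- Minkowski space; a point is `(t, y)`. -/
abbrev Mink (d : ℕ) : Type := ℝ × EuclideanSpace ℝ (Fin d)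

/-- The ambient space of the pseudospheres; a point is `(w, (t, y))`. -/
abbrev Amb (d : ℕ) : Type := ℝ × Mink d

variable {d : ℕ}

/-- The Minkowski inner product, of signature `(+, -, ..., -)`. -/
def eta (X Y : Mink d) : ℝ := X.1 * Y.1 - inner ℝ X.2 Y.2

/-- The ambient form `k⁻¹ dw² + dt² - |dy|²`. Its restriction to the tangent spaces of the
pseudosphere is the metric. (If `k = 0`, then `k⁻¹ = 0`, and tangent vectors have `w`-component
zero.) -/
def metric (k : ℝ) (v u : Amb d) : ℝ := k⁻¹ * (v.1 * u.1) + eta v.2 u.2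

/-- The pseudosphere: `metric k p p = 1 / k` if `k ≠ 0`, and the hyperplane `w = 1` if `k = 0`. -/
def Quadric (k : ℝ) (d : ℕ) : Set (Amb d) :=
  {p | p.1 ^ 2 + k * eta p.2 p.2 = 1 ∧ (k = 0 → 0 < p.1)}

/-- `v` is tangent to the pseudosphere at `p`. -/
def IsTangent (k : ℝ) (p v : Amb d) : Prop := p.1 * v.1 + k * eta p.2 v.2 = 0

/-- The time orientation. If `k > 0`, the number in question is the inner product of `v` with the
timelike Killing field that rotates the plane of `w` and `t`; if `k ≤ 0`, it is the inner product
with `∂/∂t`. -/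
def timeComponent (k : ℝ) (p v : Amb d) : ℝ :=
  if 0 < k then p.1 * v.2.1 - p.2.1 * v.1 else v.2.1

/-- Nonzero non-spacelike tangent vectors that point to the future. -/
def IsFutureCausal (k : ℝ) (p v : Amb d) : Prop :=
  IsTangent k p v ∧ 0 ≤ metric k v v ∧ 0 < timeComponent k p v

/-- `cos (√k t)`, for every sign of `k`. -/
def cs (k t : ℝ) : ℝ := if 0 ≤ k then Real.cos (√k * t) else Real.cosh (√(-k) * t)

/-- `sin (√k t) / √k`, for every sign of `k`, with the limit `t` at `k = 0`. -/
def sn (k t : ℝ) : ℝ :=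
  if 0 < k then Real.sin (√k * t) / √k
  else if k < 0 then Real.sinh (√(-k) * t) / √(-k) else t

/-- The geodesic of the pseudosphere with initial point `p` and initial velocity `v`; see
`geod_mem`, `geod_hasDerivAt` and `geodVel_hasDerivAt`. -/
def geod (k : ℝ) (p v : Amb d) (t : ℝ) : Amb d :=
  cs (k * metric k v v) t • p + sn (k * metric k v v) t • v

/-- The velocity of `geod`. -/
def geodVel (k : ℝ) (p v : Amb d) (t : ℝ) : Amb d :=
  (-(k * metric k v v) * sn (k * metric k v v) t) • p + cs (k * metric k v v) t • v

lemma cs_zero (a : ℝ) : cs a 0 = 1 := by simp [cs]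

lemma sn_zero (a : ℝ) : sn a 0 = 0 := by simp [sn]

lemma cs_hasDerivAt (a t : ℝ) : HasDerivAt (cs a) (-a * sn a t) t := by
  have hl : ∀ b : ℝ, HasDerivAt (fun s : ℝ => b * s) b t := fun b => by
    simpa using (hasDerivAt_id t).const_mul b
  rcases lt_trichotomy a 0 with h | h | h
  · have h1 : cs a = fun s => Real.cosh (√(-a) * s) := by
      funext s; simp [cs, not_le.2 h]
    have h0 : 0 < √(-a) := Real.sqrt_pos.2 (by linarith)
    have h2 : √(-a) ^ 2 = -a := Real.sq_sqrt (by linarith)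
    rw [h1]
    convert (hl √(-a)).cosh using 1
    simp only [sn, not_lt.2 h.le, h, if_true, if_false]
    generalize √(-a) = s at *
    rw [← h2]; field_simp
  · subst h
    have h1 : cs 0 = fun _ => (1 : ℝ) := by funext s; simp [cs]
    rw [h1]; simpa using hasDerivAt_const t (1 : ℝ)
  · have h1 : cs a = fun s => Real.cos (√a * s) := by funext s; simp [cs, h.le]
    have h0 : 0 < √a := Real.sqrt_pos.2 h
    have h2 : √a ^ 2 = a := Real.sq_sqrt h.le
    rw [h1]
    convert (hl √a).cos using 1
    simp only [sn, h, if_true]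
    generalize √a = s at *
    rw [← h2]; field_simp

lemma sn_hasDerivAt (a t : ℝ) : HasDerivAt (sn a) (cs a t) t := by
  have hl : ∀ b : ℝ, HasDerivAt (fun s : ℝ => b * s) b t := fun b => by
    simpa using (hasDerivAt_id t).const_mul b
  rcases lt_trichotomy a 0 with h | h | h
  · have h1 : sn a = fun s => Real.sinh (√(-a) * s) / √(-a) := by
      funext s; simp [sn, not_lt.2 h.le, h]
    have h0 : 0 < √(-a) := Real.sqrt_pos.2 (by linarith)
    rw [h1]
    refine (((hl √(-a)).sinh).div_const √(-a)).congr_deriv ?_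
    rw [mul_div_assoc, div_self h0.ne', mul_one]; simp [cs, not_le.2 h]
  · subst h
    have h1 : sn 0 = fun s => s := by funext s; simp [sn]
    rw [h1, show cs 0 t = 1 by simp [cs]]; exact hasDerivAt_id t
  · have h1 : sn a = fun s => Real.sin (√a * s) / √a := by funext s; simp [sn, h]
    have h0 : 0 < √a := Real.sqrt_pos.2 h
    rw [h1]
    refine (((hl √a).sin).div_const √a).congr_deriv ?_
    rw [mul_div_assoc, div_self h0.ne', mul_one]; simp [cs, h.le]

lemma cs_sq_add (a t : ℝ) : cs a t ^ 2 + a * sn a t ^ 2 = 1 := by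
  rcases lt_trichotomy a 0 with h | h | h
  · have h0 : 0 < √(-a) := Real.sqrt_pos.2 (by linarith)
    have h2 : √(-a) ^ 2 = -a := Real.sq_sqrt (by linarith)
    simp only [cs, sn, not_le.2 h, not_lt.2 h.le, h, if_true, if_false, div_pow, h2]
    have := Real.cosh_sq (√(-a) * t)
    have ha : a ≠ 0 := h.ne
    rw [div_neg, mul_neg, mul_div_cancel₀ _ ha, this]; ring
  · subst h; simp [cs]
  · have h2 : √a ^ 2 = a := Real.sq_sqrt h.le
    simp only [cs, sn, h, h.le, if_true, div_pow, h2]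
    rw [mul_div_cancel₀ _ h.ne']; exact Real.cos_sq_add_sin_sq _

lemma eta_add_smul (a b : ℝ) (X Y : Mink d) :
    eta (a • X + b • Y) (a • X + b • Y)
      = a ^ 2 * eta X X + 2 * (a * b) * eta X Y + b ^ 2 * eta Y Y := by
  simp only [eta, Prod.fst_add, Prod.snd_add, Prod.smul_fst, Prod.smul_snd, smul_eq_mul,
    inner_add_left, inner_add_right, real_inner_smul_left, real_inner_smul_right]
  rw [real_inner_comm X.2 Y.2]; ring

/-- A geodesic stays in the pseudosphere. -/
theorem geod_mem {k : ℝ} {p v : Amb d} (hp : p ∈ Quadric k d) (hv : IsTangent k p v) (t : ℝ) :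
    geod k p v t ∈ Quadric k d := by
  obtain ⟨h1, h2⟩ := hp
  have h3 : p.1 * v.1 + k * eta p.2 v.2 = 0 := hv
  have key := cs_sq_add (k * metric k v v) t
  by_cases hk : k = 0
  · subst hk
    have hw : v.1 = 0 := by
      have := h2 rfl
      simpa [this.ne'] using h3
    refine ⟨?_, fun _ => ?_⟩
    · simp [geod, cs, hw] at h1 ⊢; simpa using h1
    · simpa [geod, cs, hw] using h2 rfl
  · refine ⟨?_, fun h => absurd h hk⟩
    have h4 : v.1 ^ 2 + k * eta v.2 v.2 = k * metric k v v := by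
      simp only [metric]; field_simp
    simp only [geod, Prod.fst_add, Prod.snd_add, Prod.smul_fst, Prod.smul_snd, smul_eq_mul,
      eta_add_smul]
    generalize cs (k * metric k v v) t = c at *
    generalize sn (k * metric k v v) t = s at *
    linear_combination c ^ 2 * h1 + 2 * c * s * h3 + s ^ 2 * h4 + key

theorem geod_hasDerivAt (k : ℝ) (p v : Amb d) (t : ℝ) :
    HasDerivAt (geod k p v) (geodVel k p v t) t :=
  ((cs_hasDerivAt _ t).smul_const p).add ((sn_hasDerivAt _ t).smul_const v)

/-- The geodesic equation: the acceleration is normal to the pseudosphere, that is, a multiple of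
the position vector. -/
theorem geodVel_hasDerivAt (k : ℝ) (p v : Amb d) (t : ℝ) :
    HasDerivAt (geodVel k p v) (-(k * metric k v v) • geod k p v t) t := by
  have h := (((sn_hasDerivAt (k * metric k v v) t).const_mul (-(k * metric k v v))).smul_const
    p).add ((cs_hasDerivAt (k * metric k v v) t).smul_const v)
  have e : -(k * metric k v v) • geod k p v t =
      (-(k * metric k v v) * cs (k * metric k v v) t) • p
        + (-(k * metric k v v) * sn (k * metric k v v) t) • v := by
    rw [geod, smul_add, smul_smul, smul_smul]
  rw [e]; exact h

/-! ### Frames -/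

/-- `e 0, ..., e d` is an orthonormal basis of the tangent space at `p`, with `e 0` future-directed
timelike. -/
def IsFrame (k : ℝ) (p : Amb d) (e : Fin (d + 1) → Amb d) : Prop :=
  (∀ a, IsTangent k p (e a)) ∧
  (∀ a b, metric k (e a) (e b) = if a = b then (if a = 0 then 1 else -1) else 0) ∧
  0 < timeComponent k p (e 0)

/-- Some orthonormal basis of the tangent space at `p`; nothing below depends on which one. -/
def frame (k : ℝ) (p : Amb d) : Fin (d + 1) → Amb d := Classical.epsilon (IsFrame k p)

/-- The standard basis of Minkowski space. -/
def minkBasis (a : Fin (d + 1)) : Mink d :=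
  Fin.cases ((1, 0) : Mink d) (fun i => ((0, EuclideanSpace.single i 1) : Mink d)) a

lemma eta_minkBasis (a b : Fin (d + 1)) :
    eta (minkBasis a) (minkBasis b) = if a = b then (if a = 0 then 1 else -1) else 0 := by
  refine Fin.cases ?_ (fun i => ?_) a <;> refine Fin.cases ?_ (fun j => ?_) b
  · simp [minkBasis, eta]
  · simp [minkBasis, eta, (Fin.succ_ne_zero j).symm]
  · simp [minkBasis, eta, Fin.succ_ne_zero]
  · by_cases h : i = j
    · subst h; simp [minkBasis, eta, Fin.succ_ne_zero]
    · simp [minkBasis, eta, h, EuclideanSpace.inner_single_left]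

lemma eta_sub_smul_left (X Y Z : Mink d) (c : ℝ) :
    eta (X - c • Z) Y = eta X Y - c * eta Z Y := by
  simp only [eta, Prod.fst_sub, Prod.snd_sub, Prod.smul_fst, Prod.smul_snd, smul_eq_mul,
    inner_sub_left, real_inner_smul_left]; ring

lemma eta_comm (X Y : Mink d) : eta X Y = eta Y X := by
  simp only [eta]; rw [real_inner_comm]; ring

/-- Orthonormal bases exist. -/
theorem exists_isFrame {k : ℝ} {p : Amb d} (hp : p ∈ Quadric k d) : ∃ e, IsFrame k p e := by
  obtain ⟨hp1, hp2⟩ := hp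
  obtain ⟨s, hs, hw⟩ : ∃ s : ℝ, s * s = 1 ∧ 0 ≤ s * p.1 := by
    rcases le_total 0 p.1 with h | h
    · exact ⟨1, by norm_num, by simpa using h⟩
    · exact ⟨-1, by norm_num, by simpa using h⟩
  obtain ⟨c, hc1, hc2⟩ : ∃ c : ℝ, c * (1 + s * p.1) = 1 ∧ 0 < c :=
    ⟨(1 + s * p.1)⁻¹, inv_mul_cancel₀ (by positivity), by positivity⟩
  have hA : k * eta p.2 p.2 = 1 - p.1 ^ 2 := by linarith
  let b : Fin (d + 1) → Amb d := fun a =>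
    (-(k * eta (minkBasis a) p.2 * s),
      minkBasis a - (k * eta (minkBasis a) p.2 * c) • p.2)
  have tan : ∀ a, IsTangent k p (b a) := fun a => by
    simp only [IsTangent, b]
    rw [eta_comm p.2, eta_sub_smul_left]
    have hp : p.1 ^ 2 = (s * p.1) ^ 2 := by linear_combination -p.1 ^ 2 * hs
    have h1 : c * (1 - p.1 ^ 2) = 1 - s * p.1 := by
      rw [hp]; linear_combination (1 - s * p.1) * hc1
    linear_combination
      (-(k * eta (minkBasis a) p.2 * c)) * hA - (k * eta (minkBasis a) p.2) * h1
  have met : ∀ a a', metric k (b a) (b a') = eta (minkBasis a) (minkBasis a') := fun a a' => by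
    simp only [metric, b]
    rw [eta_sub_smul_left, eta_comm (minkBasis a) (_ - _), eta_comm p.2 (_ - _),
      eta_sub_smul_left, eta_sub_smul_left, eta_comm (minkBasis a') (minkBasis a),
      eta_comm p.2 (minkBasis a)]
    by_cases hk : k = 0
    · subst hk; simp
    · have hp : p.1 ^ 2 = (s * p.1) ^ 2 := by linear_combination -p.1 ^ 2 * hs
      have h1 : c * (1 - p.1 ^ 2) = 1 - s * p.1 := by
        rw [hp]; linear_combination (1 - s * p.1) * hc1
      have h2 : k⁻¹ * k = 1 := inv_mul_cancel₀ hk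
      set x := eta (minkBasis a) p.2
      set y := eta (minkBasis a') p.2
      have hcc : c * (1 - s * p.1) = 2 * c - 1 := by linear_combination -hc1
      linear_combination (k * x * y * s * s) * h2 + (k * x * y) * hs + (k * x * y * c * c) * hA
        + (k * x * y * c) * h1 + (k * x * y) * hcc
  have tm : timeComponent k p (b 0) ≠ 0 := by
    have e0 : eta (minkBasis (0 : Fin (d + 1))) p.2 = p.2.1 := by simp [eta, minkBasis]
    by_cases hk : 0 < k
    · have h3 : timeComponent k p (b 0) = s * (s * p.1 + k * p.2.1 ^ 2 * c) := by
        simp only [timeComponent, hk, if_true, b, e0]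
        simp only [minkBasis, Fin.cases_zero, Prod.fst_sub, Prod.smul_fst, smul_eq_mul]
        linear_combination (-p.1) * hs - (k * p.2.1 ^ 2 * s) * hc1
          + (k * p.2.1 ^ 2 * c * p.1) * hs
      rw [h3]
      have hs0 : s ≠ 0 := fun h => by simp [h] at hs
      refine mul_ne_zero hs0 (ne_of_gt ?_)
      rcases hw.lt_or_eq with h | h
      · have : 0 ≤ k * p.2.1 ^ 2 * c := by positivity
        linarith
      · rw [← h, zero_add]
        have hp0 : p.1 = 0 := by
          rcases mul_eq_zero.1 h.symm with h' | h'
          · exact absurd h' hs0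
          · exact h'
        have : p.2.1 ≠ 0 := fun h5 => by
          have h6 : (0 : ℝ) ≤ inner ℝ p.2.2 p.2.2 := real_inner_self_nonneg
          simp only [hp0, eta, h5] at hp1
          nlinarith
        positivity
    · have h3 : timeComponent k p (b 0) = 1 + (-k) * p.2.1 ^ 2 * c := by
        simp only [timeComponent, hk, if_false, b, e0]
        simp only [minkBasis, Fin.cases_zero, Prod.fst_sub, Prod.smul_fst, smul_eq_mul]
        ring
      have : 0 ≤ (-k) * p.2.1 ^ 2 * c :=
        mul_nonneg (mul_nonneg (by linarith) (sq_nonneg _)) hc2.le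
      rw [h3]
      exact ne_of_gt (by linarith)
  obtain ⟨u, hu, hu2⟩ : ∃ u : ℝ, u * u = 1 ∧ 0 < u * timeComponent k p (b 0) := by
    rcases lt_or_gt_of_ne tm with h | h
    · exact ⟨-1, by norm_num, by linarith⟩
    · exact ⟨1, by norm_num, by linarith⟩
  refine ⟨fun a => u • b a, fun a => ?_, fun a a' => ?_, ?_⟩
  · have := tan a
    simp only [IsTangent, eta, Prod.smul_fst, Prod.smul_snd, smul_eq_mul,
      real_inner_smul_right] at this ⊢
    linear_combination u * this
  · rw [← eta_minkBasis, ← met]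
    simp only [metric, eta, Prod.smul_fst, Prod.smul_snd, smul_eq_mul, real_inner_smul_left,
      real_inner_smul_right]
    linear_combination (k⁻¹ * ((b a).1 * (b a').1) + ((b a).2.1 * (b a').2.1
      - inner ℝ (b a).2.2 (b a').2.2)) * hu
  · convert hu2 using 1
    simp only [timeComponent, Prod.smul_fst, Prod.smul_snd, smul_eq_mul]
    split_ifs <;> ring

/-! ### Spinors

The fibre of the spinor bundle is a complex Clifford module `S` of Minkowski space. The spinor
bundle of the pseudosphere is trivialised by the restrictions of the constant ambient spinors
(Killing spinors). In this trivialisation, Clifford multiplication by the tangent vector `v` at `p`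
is `cliff k p v` (at `p = (1, 0)` it is `gamma v`), and the spin connection is
`∂_v + spinConn k p v`. -/

/-- A complex module of the Clifford algebra of Minkowski space: `γ(X) γ(Y) + γ(Y) γ(X) = 2 η(X, Y)`.
It need not be irreducible. -/
structure CliffordModule (d : ℕ) (S : Type*) [NormedAddCommGroup S] [NormedSpace ℂ S] where
  gamma : Mink d →L[ℝ] (S →L[ℂ] S)
  gamma_sq : ∀ X, gamma X * gamma X = (eta X X : ℂ) • (1 : S →L[ℂ] S)

variable {S : Type*} [NormedAddCommGroup S] [NormedSpace ℂ S]

lemma alg_sq {R : Type*} [Ring R] [Algebra ℂ R] (a b : R) (w v A B h κ k q : ℂ)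
    (ha : a * a = A • (1:R)) (hb : b * b = B • (1:R)) (hab : a * b = (2*h) • (1:R) - b * a)
    (hκ : κ * κ = k) (hw : w^2 + k * A = 1) (ht : w * v + k * h = 0)
    (hq : k * q = v^2 + k * B) (h0 : k = 0 → v = 0 ∧ q = B) :
    (w • b - v • a + (Complex.I * κ / 2) • (b * a - a * b)) * (w • b - v • a + (Complex.I * κ / 2) • (b * a - a * b))
      = q • (1:R) := by
  have e1 : b * a - a * b = (2:ℂ) • (b * a) - (2*h) • (1:R) := by rw [hab]; module
  have e2 : a * (b * a) = (2*h) • a - A • b := by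
    rw [← mul_assoc, hab, sub_mul, mul_assoc, ha]; simp
  have e3 : b * (b * a) = B • a := by rw [← mul_assoc, hb]; simp
  have e4 : b * (a * b) = (2*h) • b - B • a := by
    rw [hab, mul_sub, ← mul_assoc, hb]; simp
  have e5 : b * (a * (b * a)) = (2*h) • (b*a) - (A*B) • (1:R) := by
    rw [e2, mul_sub, mul_smul_comm, mul_smul_comm, hb, smul_smul]
  have hI : Complex.I * Complex.I = -1 := Complex.I_mul_I
  have e6 : (w • b - v • a + (Complex.I * κ / 2) • (b * a - a * b)) * (w • b - v • a + (Complex.I * κ / 2) • (b * a - a * b))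
     = (w^2*B + v^2*A - 2*w*v*h - k*(h^2-A*B)) • (1:R) := by
    rw [e1]
    simp only [mul_add, add_mul, mul_sub, sub_mul, smul_mul_assoc, mul_smul_comm, mul_assoc, smul_sub, mul_one, one_mul, ha, hb, hab, e2, e3, smul_smul, smul_add]
    rw [← hκ]
    match_scalars <;> (ring_nf; try simp [Complex.I_sq]; try ring)
  rw [e6]
  congr 1
  by_cases hk : k = 0
  · obtain ⟨rfl, rfl⟩ := h0 hk
    subst hk
    linear_combination q * hw
  · apply mul_left_cancel₀ hk
    linear_combination (k*B + v^2) * hw - (2*k*h) * ht - hq + (k*h - w*v)*ht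

lemma alg_comm {R : Type*} [Ring R] [Algebra ℂ R] (a b c : R) (w v u A h g κ k : ℂ)
    (ha : a * a = A • (1:R)) (hab : a * b = (2*h) • (1:R) - b * a)
    (hac : a * c = (2*g) • (1:R) - c * a)
    (hκ : κ * κ = k) (hw : w^2 + k * A = 1) (ht : w * v + k * h = 0) (hu : w * u + k * g = 0)
    (h0 : k = 0 → v = 0 ∧ u = 0) :
    (v • c - u • b + (Complex.I * κ / 2) • (c * b - b * c)) =
      -(((Complex.I * κ / 2) • (w • b - v • a + (Complex.I * κ / 2) • (b * a - a * b))) *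
          (w • c - u • a + (Complex.I * κ / 2) • (c * a - a * c)) -
        (w • c - u • a + (Complex.I * κ / 2) • (c * a - a * c)) *
          ((Complex.I * κ / 2) • (w • b - v • a + (Complex.I * κ / 2) • (b * a - a * b)))) := by
  have e1 : b * a - a * b = (2:ℂ) • (b * a) - (2*h) • (1:R) := by rw [hab]; module
  have e1' : c * a - a * c = (2:ℂ) • (c * a) - (2*g) • (1:R) := by rw [hac]; module
  have e2 : a * (b * a) = (2*h) • a - A • b := by
    rw [← mul_assoc, hab, sub_mul, mul_assoc, ha]; simp
  have e2' : a * (c * a) = (2*g) • a - A • c := by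
    rw [← mul_assoc, hac, sub_mul, mul_assoc, ha]; simp
  have e3 : ∀ x : R, a * (b * x) = (2*h) • x - b * (a * x) := fun x => by
    rw [← mul_assoc, hab, sub_mul, mul_assoc]; simp
  have e3' : ∀ x : R, a * (c * x) = (2*g) • x - c * (a * x) := fun x => by
    rw [← mul_assoc, hac, sub_mul, mul_assoc]; simp
  have hE : ((Complex.I * κ / 2) • (w • b - v • a + (Complex.I * κ / 2) • (b * a - a * b))) *
          (w • c - u • a + (Complex.I * κ / 2) • (c * a - a * c)) -
        (w • c - u • a + (Complex.I * κ / 2) • (c * a - a * c)) *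
          ((Complex.I * κ / 2) • (w • b - v • a + (Complex.I * κ / 2) • (b * a - a * b)))
      = (Complex.I * κ / 2) • ((w^2+k*A) • (b * c - c * b) - (2 * (w*u+k*g)) • (b * a) + (2 * (w*v+k*h)) • (c*a) + (2*(w*u*h - w*v*g)) • (1:R)) 
       - (k/2) • ((2*(w*g-u*A)) • b - (2*(w*h-v*A)) • c + (2*(u*h-v*g)) • a) := by
    rw [e1, e1', ← hκ]
    simp only [mul_add, add_mul, mul_sub, sub_mul, smul_mul_assoc, mul_smul_comm, mul_assoc, smul_sub, mul_one, one_mul, ha, hab, hac, e3, e3', smul_smul, smul_add]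
    match_scalars <;> ring_nf <;> simp [Complex.I_sq] <;> ring_nf
  rw [hE]
  by_cases hk : k = 0
  · obtain ⟨rfl, rfl⟩ := h0 hk
    have : κ = 0 := by simpa [hk] using hκ
    subst this; subst hk; simp
  · have q1 : w*u*h - w*v*g = 0 := by linear_combination h * hu - g * ht
    have q2 : u*h - v*g = 0 := by
      apply mul_left_cancel₀ hk; linear_combination u * ht - v * hu
    have q3 : k*(w*g-u*A) = -u := by linear_combination w * hu - u * hw
    have q4 : k*(w*h-v*A) = -v := by linear_combination w * ht - v * hw
    rw [hw, ht, hu, q1, q2]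
    have r3 : (k/2) • ((2*(w*g-u*A)) • b) = (-u) • b := by rw [smul_smul]; congr 1; linear_combination q3
    have r4 : (k/2) • ((2*(w*h-v*A)) • c) = (-v) • c := by rw [smul_smul]; congr 1; linear_combination q4
    rw [smul_add (k/2), smul_sub (k/2), r3, r4]
    module

/-- The square root of the real number `k` in `[0, ∞)` or `i (0, ∞)`. -/
def sqrtC (k : ℝ) : ℂ := if 0 ≤ k then ((√k : ℝ) : ℂ) else Complex.I * ((√(-k) : ℝ) : ℂ)

/-- Clifford multiplication by the tangent vector `v` at the point `p` of the pseudosphere. -/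
def cliff (C : CliffordModule d S) (k : ℝ) (p v : Amb d) : S →L[ℂ] S :=
  (p.1 : ℂ) • C.gamma v.2 - (v.1 : ℂ) • C.gamma p.2
    + (Complex.I * sqrtC k / 2) • (C.gamma v.2 * C.gamma p.2 - C.gamma p.2 * C.gamma v.2)

/-- The connection form of the spin connection. -/
def spinConn (C : CliffordModule d S) (k : ℝ) (p v : Amb d) : S →L[ℂ] S :=
  (Complex.I * sqrtC k / 2) • cliff C k p v

lemma sqrtC_mul_self (k : ℝ) : sqrtC k * sqrtC k = (k : ℂ) := by
  unfold sqrtC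
  split_ifs with h
  · rw [← Complex.ofReal_mul, Real.mul_self_sqrt h]
  · have h1 : √(-k) * √(-k) = -k := Real.mul_self_sqrt (by linarith)
    have h2 : ((√(-k) : ℝ) : ℂ) * ((√(-k) : ℝ) : ℂ) = -(k : ℂ) := by
      rw [← Complex.ofReal_mul, h1]; push_cast; ring
    linear_combination (Complex.I * Complex.I) * h2 - (k : ℂ) * Complex.I_mul_I

lemma gamma_anticomm (C : CliffordModule d S) (X Y : Mink d) :
    C.gamma X * C.gamma Y = (2 * (eta X Y : ℂ)) • (1 : S →L[ℂ] S) - C.gamma Y * C.gamma X := by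
  have h := C.gamma_sq (X + Y)
  have e : eta (X + Y) (X + Y) = eta X X + 2 * eta X Y + eta Y Y := by
    have := eta_add_smul 1 1 X Y
    simpa using this
  rw [map_add, mul_add, add_mul, add_mul, C.gamma_sq, C.gamma_sq, e] at h
  push_cast at h
  rw [add_smul, add_smul] at h
  rw [eq_sub_iff_add_eq]
  have h' := congrArg
    (fun z : S →L[ℂ] S => z - (eta X X : ℂ) • (1 : S →L[ℂ] S) - (eta Y Y : ℂ) • (1 : S →L[ℂ] S)) h
  have e1 : ∀ a b c e : S →L[ℂ] S, (a + b + (c + e)) - a - e = c + b := fun a b c e => by abel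
  have e2 : ∀ a b c : S →L[ℂ] S, (a + b + c) - a - c = b := fun a b c => by abel
  rwa [e1, e2] at h'

/-- The Clifford relation `v v = g(v, v)` in the tangent spaces of the pseudosphere. -/
theorem cliff_sq (C : CliffordModule d S) {k : ℝ} {p v : Amb d} (hp : p ∈ Quadric k d)
    (hv : IsTangent k p v) :
    cliff C k p v * cliff C k p v = (metric k v v : ℂ) • (1 : S →L[ℂ] S) := by
  obtain ⟨h1, h2⟩ := hp
  have h3 : p.1 * v.1 + k * eta p.2 v.2 = 0 := hv
  refine alg_sq _ _ p.1 v.1 (eta p.2 p.2) (eta v.2 v.2) (eta p.2 v.2) (sqrtC k) k _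
    (C.gamma_sq _) (C.gamma_sq _) (gamma_anticomm C _ _) (sqrtC_mul_self k)
    (by exact_mod_cast h1) (by exact_mod_cast h3) ?_ ?_
  · norm_cast
    by_cases hk : k = 0
    · subst hk
      have := (h2 rfl).ne'
      simp [this] at h3; simp [h3]
    · simp only [metric]; field_simp
  · intro hk
    have hk' : k = 0 := by exact_mod_cast hk
    subst hk'
    have := (h2 rfl).ne'
    simp [this] at h3; simp [h3, metric]

/-- The spin connection is compatible with the Levi-Civita connection. (`cliff C k p u` is bilinear
in `(p, u)`, and `cliff C k p p = 0`. Hence, along a curve `p` in the pseudosphere with velocity `v`,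
the derivative of `cliff C k p u`, for a tangent field `u` along `p`, is
`cliff C k v u + cliff C k p (∇_v u)`, where `∇_v u` is the tangential part of the derivative of
`u`.) -/
theorem cliff_parallel (C : CliffordModule d S) {k : ℝ} {p v u : Amb d} (hp : p ∈ Quadric k d)
    (hv : IsTangent k p v) (hu : IsTangent k p u) :
    cliff C k v u + (spinConn C k p v * cliff C k p u - cliff C k p u * spinConn C k p v) = 0 := by
  obtain ⟨h1, h2⟩ := hp
  have h3 : p.1 * v.1 + k * eta p.2 v.2 = 0 := hv
  have h4 : p.1 * u.1 + k * eta p.2 u.2 = 0 := hu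
  rw [← eq_neg_iff_add_eq_zero]
  refine alg_comm _ _ _ p.1 v.1 u.1 (eta p.2 p.2) (eta p.2 v.2) (eta p.2 u.2) (sqrtC k) k
    (C.gamma_sq _) (gamma_anticomm C _ _) (gamma_anticomm C _ _) (sqrtC_mul_self k)
    (by exact_mod_cast h1) (by exact_mod_cast h3) (by exact_mod_cast h4) ?_
  intro hk
  have hk' : k = 0 := by exact_mod_cast hk
  subst hk'
  have := (h2 rfl).ne'
  simp [this] at h3 h4; simp [h3, h4]

/-- The curvature of the spin connection is the curvature `(k / 4) [v, u]` of the spinor bundle of a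
space of constant curvature `k`: there is no twisting. -/
theorem spinConn_curvature (C : CliffordModule d S) {k : ℝ} {p v u : Amb d}
    (hp : p ∈ Quadric k d) (hv : IsTangent k p v) (hu : IsTangent k p u) :
    spinConn C k v u - spinConn C k u v
        + (spinConn C k p v * spinConn C k p u - spinConn C k p u * spinConn C k p v)
      = ((k : ℂ) / 4) • (cliff C k p v * cliff C k p u - cliff C k p u * cliff C k p v) := by
  have h1 := eq_neg_of_add_eq_zero_left (cliff_parallel C hp hv hu)
  have h2 := eq_neg_of_add_eq_zero_left (cliff_parallel C hp hu hv)
  rw [spinConn, spinConn, h1, h2, ← sqrtC_mul_self k]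
  simp only [spinConn, smul_mul_assoc, mul_smul_comm, smul_smul]
  match_scalars <;> ring_nf <;> simp [Complex.I_sq] <;> ring

/-! ### Fields, geodesics and causality on the space form

`M` is the space form and `proj : M → Quadric k d` its covering map. Points, tangent vectors, the
metric, the time orientation and the spinor bundle of `M` are those of the pseudosphere, pulled back
by `proj`: the tangent space at `x` consists of the vectors tangent to the pseudosphere at `proj x`,
and a spinor field is a function `M → S`. -/

variable {k : ℝ} {M : Type*} [TopologicalSpace M]

/-- A function on `M` is smooth at `x` if near `x` it is the restriction of a smooth function of the
ambient coordinates. -/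
def SmoothAt {W : Type*} [NormedAddCommGroup W] [NormedSpace ℝ W] (proj : M → Quadric k d)
    (ψ : M → W) (x : M) : Prop :=
  ∃ F : Amb d → W, ContDiffAt ℝ ∞ F (proj x) ∧ ∀ᶠ z in 𝓝 x, ψ z = F (proj z)

open Classical in
/-- The derivative of `ψ` at `x` in the direction of the tangent vector `v`: the derivative of any
local extension of `ψ` to the ambient space. -/
def fieldDeriv (proj : M → Quadric k d) (ψ : M → S) (x : M) (v : Amb d) : S :=
  if h : ∃ F : Amb d → S, DifferentiableAt ℝ F (proj x) ∧ ∀ᶠ z in 𝓝 x, ψ z = F (proj z)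
  then fderiv ℝ h.choose (proj x : Amb d) v else 0

/-- The spinor covariant derivative. -/
def covDeriv (C : CliffordModule d S) (proj : M → Quadric k d) (ψ : M → S) (x : M) (v : Amb d) :
    S :=
  fieldDeriv proj ψ x v + spinConn C k (proj x) v (ψ x)

/-- The Dirac operator `g^{ij} e_i ∇_j`, written in an orthonormal basis. -/
def dirac (C : CliffordModule d S) (proj : M → Quadric k d) (ψ : M → S) (x : M) : S :=
  ∑ a : Fin (d + 1), (if a = 0 then (1 : ℝ) else -1) •
    cliff C k (proj x) (frame k (proj x : Amb d) a)
      (covDeriv C proj ψ x (frame k (proj x : Amb d) a))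

/-- `v` is the initial velocity of a geodesic `[0, 1] → Ω` from `x` to `x'`. -/
def GeodSeg (proj : M → Quadric k d) (Ω : Set M) (x : M) (v : Amb d) (x' : M) : Prop :=
  IsTangent k (proj x : Amb d) v ∧ ∃ c : ℝ → M, ContinuousOn c (Set.Icc 0 1) ∧ c 0 = x ∧ c 1 = x' ∧
    ∀ t ∈ Set.Icc (0 : ℝ) 1, c t ∈ Ω ∧ (proj (c t) : Amb d) = geod k (proj x) v t

/-- `Ω` is a normal neighbourhood of `x`: the exponential map `e` at `x` is a diffeomorphism of a
star-shaped open neighbourhood `U` of `0` in the tangent space at `x` onto `Ω`. -/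
def IsNormalNhd (proj : M → Quadric k d) (Ω : Set M) (x : M) : Prop :=
  ∃ (U : Set (Amb d)) (e : Amb d → M) (L : M → Amb d),
    (∃ O : Set (Amb d), IsOpen O ∧ U = {v ∈ O | IsTangent k (proj x : Amb d) v}) ∧
    0 ∈ U ∧ (∀ v ∈ U, ∀ t ∈ Set.Icc (0 : ℝ) 1, t • v ∈ U) ∧
    ContinuousOn e U ∧ e 0 = x ∧ (∀ v ∈ U, (proj (e v) : Amb d) = geod k (proj x) v 1) ∧
    Set.BijOn e U Ω ∧ (∀ v ∈ U, L (e v) = v) ∧ ∀ x' ∈ Ω, SmoothAt proj L x'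

/-- The domains considered: open sets that are a normal neighbourhood of each of their points, and,
in Minkowski space (`k = 0`) and in de Sitter space (`k < 0`), also the whole space. -/
def IsAdmissible (proj : M → Quadric k d) (Ω : Set M) : Prop :=
  IsOpen Ω ∧ ((∀ x ∈ Ω, IsNormalNhd proj Ω x) ∨ (k ≤ 0 ∧ Ω = Set.univ))

/-- There is a future-directed non-spacelike `C¹` curve in `Ω` from `x` to `x'`. -/
def CausalCurve (proj : M → Quadric k d) (Ω : Set M) (x x' : M) : Prop :=
  ∃ c : ℝ → M, ContinuousOn c (Set.Icc 0 1) ∧ c 0 = x ∧ c 1 = x' ∧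
    (∀ t ∈ Set.Icc (0 : ℝ) 1, c t ∈ Ω) ∧
    ContDiffOn ℝ 1 (fun t => (proj (c t) : Amb d)) (Set.Icc 0 1) ∧
    ∀ t ∈ Set.Icc (0 : ℝ) 1, IsFutureCausal k (proj (c t) : Amb d)
      (derivWithin (fun t => (proj (c t) : Amb d)) (Set.Icc 0 1) t)

/-- The causal future of `x` in `Ω` (reached by piecewise `C¹` curves, including the trivial one). -/
def JPlus (proj : M → Quadric k d) (Ω : Set M) (x : M) : Set M :=
  {x' | x' ∈ Ω ∧ Relation.ReflTransGen (CausalCurve proj Ω) x x'}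

open Classical in
/-- The initial velocity `exp_x⁻¹ (x')` of the future-directed causal geodesic `[0, 1] → Ω` from `x`
to `x'` (zero if there is none, in particular if `x = x'`). -/
def logVec (proj : M → Quadric k d) (Ω : Set M) (x x' : M) : Amb d :=
  if h : ∃ v, IsFutureCausal k (proj x : Amb d) v ∧ GeodSeg proj Ω x v x' then h.choose else 0

/-- The Lorentzian distance: the length of the future-directed causal geodesic from `x` to `x'`. -/
def rho (proj : M → Quadric k d) (Ω : Set M) (x x' : M) : ℝ :=
  √(metric k (logVec proj Ω x x') (logVec proj Ω x x'))

/-- The unit tangent vector at `x` of the geodesic from `x` to `x'`. -/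
def nu (proj : M → Quadric k d) (Ω : Set M) (x x' : M) : Amb d :=
  (rho proj Ω x x')⁻¹ • logVec proj Ω x x'

/-- The spinor parallel transport from `geod k p v 1` to `p` along `geod k p v`: the value at time
`0` of the solution `Ψ` of the parallel transport equation with `Ψ 1 = s`. -/
def transport (C : CliffordModule d S) (k : ℝ) (p v : Amb d) (s : S) : S :=
  Classical.epsilon fun s₀ => ∃ Ψ : ℝ → S,
    (∀ t, HasDerivAt Ψ (-(spinConn C k (geod k p v t) (geodVel k p v t) (Ψ t))) t) ∧
    Ψ 1 = s ∧ Ψ 0 = s₀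

/-- The parallel transport operator `Λ(x, x')` from the fibre at `x'` to the fibre at `x`. -/
def Lam (C : CliffordModule d S) (proj : M → Quadric k d) (Ω : Set M) (x x' : M) (s : S) : S :=
  transport C k (proj x) (logVec proj Ω x x') s

/-- The future hyperboloid `S⁺_Ω(x, r)`. -/
def SPlus (proj : M → Quadric k d) (Ω : Set M) (x : M) (r : ℝ) : Set M :=
  {x' ∈ JPlus proj Ω x | rho proj Ω x x' = r}

/-! ### Integration over the future hyperboloids -/

/-- The unit future timelike tangent vector `√(1 + |y|²) e₀ + ∑ yᵢ eᵢ` at `p`. -/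
def unitFuture (k : ℝ) (p : Amb d) (y : EuclideanSpace ℝ (Fin d)) : Amb d :=
  √(1 + ‖y‖ ^ 2) • frame k p 0 + ∑ i : Fin d, y i • frame k p i.succ

/-- The density with respect to Lebesgue measure of the hypersurface measure induced by the metric,
in the parametrisation `Φ`: `√|det g(∂ᵢΦ, ∂ⱼΦ)|`. -/
def areaDensity (k : ℝ) (Φ : EuclideanSpace ℝ (Fin d) → Amb d) (y : EuclideanSpace ℝ (Fin d)) : ℝ :=
  √|Matrix.det (Matrix.of fun i j : Fin d =>
    metric k (fderiv ℝ Φ y (EuclideanSpace.single i 1)) (fderiv ℝ Φ y (EuclideanSpace.single j 1)))|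

open Classical in
/-- The end point of the geodesic `[0, 1] → Ω` that starts at `x` with velocity `v` (`x` itself if
the geodesic leaves `Ω`). -/
def endPt (proj : M → Quadric k d) (Ω : Set M) (x : M) (v : Amb d) : M :=
  if h : ∃ x', GeodSeg proj Ω x v x' then h.choose else x

/-- The set of parameters `y` for which `exp_x (r u(y))` is a point of `S⁺_Ω(x, r)`, where
`u = unitFuture`. -/
def hypDomain (proj : M → Quadric k d) (Ω : Set M) (x : M) (r : ℝ) :
    Set (EuclideanSpace ℝ (Fin d)) :=
  {y | ∃ x' ∈ SPlus proj Ω x r, GeodSeg proj Ω x (r • unitFuture k (proj x : Amb d) y) x'}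

/-- The function `G` on `S⁺_Ω(x, r)`, times the density of the induced hypersurface measure, in the
parametrisation `y ↦ exp_x (r u(y))` of `S⁺_Ω(x, r)`. -/
def hypIntegrand (proj : M → Quadric k d) (Ω : Set M) (x : M) (r : ℝ) (G : M → S)
    (y : EuclideanSpace ℝ (Fin d)) : S :=
  areaDensity k (fun z => geod k (proj x) (r • unitFuture k (proj x : Amb d) z) 1) y •
    G (endPt proj Ω x (r • unitFuture k (proj x : Amb d) y))

/-- The integral of `G` over `S⁺_Ω(x, r)` with respect to the induced hypersurface measure. -/
def hypIntegral (proj : M → Quadric k d) (Ω : Set M) (x : M) (r : ℝ) (G : M → S) : S :=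
  ∫ y in hypDomain proj Ω x r, hypIntegrand proj Ω x r G y

/-- Integrability over `S⁺_Ω(x, r)` with respect to the induced hypersurface measure. -/
def HypIntegrable (proj : M → Quadric k d) (Ω : Set M) (x : M) (r : ℝ) (G : M → S) : Prop :=
  MeasureTheory.IntegrableOn (hypIntegrand proj Ω x r G) (hypDomain proj Ω x r)

/-- The density `|S^{n-1}| (sin (√k r) / √k)^{n-1}` of the radial measure, `n = d + 1`. -/
def radialDensity (k : ℝ) (d : ℕ) (r : ℝ) : ℝ :=
  2 * Real.pi ^ (((d : ℝ) + 1) / 2) / Real.Gamma (((d : ℝ) + 1) / 2) * sn k r ^ d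

/-- `x' ↦ Λ(x, x') ψ(x')` -/
def kern (C : CliffordModule d S) (proj : M → Quadric k d) (Ω : Set M) (ψ : M → S) (x x' : M) : S :=
  Lam C proj Ω x x' (ψ x')

/-- `x' ↦ ν(x, x') Λ(x, x') ψ(x')` -/
def kernHat (C : CliffordModule d S) (proj : M → Quadric k d) (Ω : Set M) (ψ : M → S) (x x' : M) :
    S :=
  cliff C k (proj x) (nu proj Ω x x') (Lam C proj Ω x x' (ψ x'))

/-- The spherical mean `M_r ψ (x)`. -/
def sphMean (C : CliffordModule d S) (proj : M → Quadric k d) (Ω : Set M) (r : ℝ) (ψ : M → S)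
    (x : M) : S :=
  (radialDensity k d r)⁻¹ • hypIntegral proj Ω x r (kern C proj Ω ψ x)

/-- The spherical mean with Clifford multiplication by `ν`. -/
def sphMeanHat (C : CliffordModule d S) (proj : M → Quadric k d) (Ω : Set M) (r : ℝ) (ψ : M → S)
    (x : M) : S :=
  (radialDensity k d r)⁻¹ • hypIntegral proj Ω x r (kernHat C proj Ω ψ x)

/-! ### Radial functions and operators -/

/-- The interval `(0, diam M)`, where `diam M = π / √k` if `k > 0` and `diam M = ∞` otherwise. -/
def radii (k : ℝ) : Set ℝ := {r | 0 < r ∧ (0 < k → r < Real.pi / √k)}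

/-- Smooth functions with compact support in `(0, diam M)`. -/
def IsRadialTest (k : ℝ) (f : ℝ → ℂ) : Prop :=
  ContDiff ℝ ∞ f ∧ HasCompactSupport f ∧ tsupport f ⊆ radii k

/-- `f'' + (n-1) √k cot(√k r) f' - (k (n-1) / 4) (sec² (√k r / 2) + n - 1) f`, with `n = d + 1`;
here `√k cot(√k r) = cs k r / sn k r`, which is `1 / r` for `k = 0`. -/
def radialT (k : ℝ) (d : ℕ) (f : ℝ → ℂ) (r : ℝ) : ℂ :=
  deriv (deriv f) r + ((d * (cs k r / sn k r) : ℝ) : ℂ) * deriv f r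
    - ((k * d / 4 * (1 / cs k (r / 2) ^ 2 + d) : ℝ) : ℂ) * f r

/-- `f'' + (n-1) √k cot(√k r) f' - (k (n-1) / 4) (csc² (√k r / 2) + n - 1) f`, with `n = d + 1`;
here `k csc² (√k r / 2) = 1 / (sn k (r / 2))²`, which is `4 / r²` for `k = 0`. -/
def radialTHat (k : ℝ) (d : ℕ) (f : ℝ → ℂ) (r : ℝ) : ℂ :=
  deriv (deriv f) r + ((d * (cs k r / sn k r) : ℝ) : ℂ) * deriv f r
    - ((d / 4 * (1 / sn k (r / 2) ^ 2 + k * d) : ℝ) : ℂ) * f r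

/-- The integrand `(f(r) M_r ψ + f̂(r) M̂_r ψ) m(r)` of a radial superposition at `x`. -/
def superIntegrand (C : CliffordModule d S) (proj : M → Quadric k d) (Ω : Set M) (f fhat : ℝ → ℂ)
    (ψ : M → S) (x : M) (r : ℝ) : S :=
  radialDensity k d r •
    (f r • sphMean C proj Ω r ψ x + fhat r • sphMeanHat C proj Ω r ψ x)

/-- The radial superposition `∫₀^∞ (f(r) M_r ψ + f̂(r) M̂_r ψ) dμ(r)`. -/
def superposition (C : CliffordModule d S) (proj : M → Quadric k d) (Ω : Set M) (f fhat : ℝ → ℂ)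
    (ψ : M → S) (x : M) : S :=
  ∫ r in Set.Ioi (0 : ℝ), superIntegrand C proj Ω f fhat ψ x r

end

end LorentzSpinor

open scoped Topology ContDiff

namespace LorentzSpinor

noncomputable section

variable {d : ℕ}

/-! ### Trigonometry of the space forms: radius and squared chord. -/

section

/-! ### The functions `cs` and `sn` -/

/-! In the trivialisation by Killing spinors, Clifford multiplication by `v` at `p` depends only on
the bivector `p ∧ v` of the ambient space. This bivector is constant along the geodesic with initial
velocity `v`, so the connection form is constant there, and parallel transport along a geodesic of
length r with unit timelike initial velocity `u` is an exponential: Λ = cs(r/2) + iκ sn(r/2) U,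
where κ = `sqrtC k` and U = `cliff C k p u` satisfies U² = 1 (`transport_eq`). The end point q =
exp_p(r u) satisfies p ∧ q = sn(r) U in the same sense. Hence the kernel (f(r) + f̂(r) ν) Λ equals
A(σ) + B(σ) (p ∧ q), where σ = 4 sn(r/2)² is the squared chord (`kernelOp_coef`). This is an
explicit smooth function of the ambient points p and q.

The Dirac operator in p maps such a kernel to a kernel of the same form. This uses only the gradient
of σ, the derivative of p ∧ q and the Clifford contractions over an orthonormal frame
(`sum_dirac_kernel`). In terms of the radius, the pair (f, f̂) becomes (`diracOdd` f̂, `diracEven`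
f), by `diracScalar_coef` and `diracBivector_coef`. The Dirac operator thus exchanges the two kinds
of means through first-order operators, and the two composites of these operators are T_M and T̂_M
(`diracOdd_diracEven`, `diracEven_diracOdd`). No integration by parts is needed, and ψ satisfies no
equation.

It remains to differentiate under the integral. The polar volume element sn(r)^d dr dy / √(1 + |y|²)
becomes, after an auxiliary radial variable s in (1, 2) is added, Lebesgue measure on an open shell
of the ambient space that does not depend on p (`integral_shell`). The only dependence on x outside
the kernel is then the choice of the points that lie in the future of x. Being joined to x by a
future timelike geodesic shorter than the diameter is a locally constant relation as long as the
chord stays in `chordRange`, and the kernel is supported there. So near a given point the field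
under the integral may be frozen (`eventually_kernel_futureField`). Compactness of the supports
gives convergence, smoothness and the interchange of derivative and integral
(`contDiff_shellIntegral`, `dirac_shellIntegral`).

The domain Ω enters only through its convexity for timelike geodesics and their uniqueness: the set
S⁺_Ω(x, r) is the part of the hyperboloid exp_x(r u(y)) that lies in Ω
(`IsAdmissible.mem_hypDomain_iff`). As ψ vanishes outside Ω, the integrals may be taken over all y.
-/

lemma cs_sq_mul (a c t : ℝ) : cs (c ^ 2 * a) t = cs a (c * t) := by
  rcases eq_or_ne c 0 with rfl | hc
  · simp [cs]
  have hc2 : 0 < c ^ 2 := by positivity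
  have habs : ∀ b, √(c ^ 2 * b) = |c| * √b := fun b => by
    rw [Real.sqrt_mul hc2.le, Real.sqrt_sq_eq_abs]
  by_cases ha : 0 ≤ a
  · have h1 : 0 ≤ c ^ 2 * a := by positivity
    simp only [cs, ha, h1, if_true, habs]
    rw [← Real.cos_abs, ← Real.cos_abs (√a * _)]
    congr 1; simp only [abs_mul, abs_abs]; ring
  · have h1 : ¬ 0 ≤ c ^ 2 * a := fun h => ha ((mul_nonneg_iff_of_pos_left hc2).1 h)
    simp only [cs, ha, h1, if_false]
    rw [← mul_neg, habs, ← Real.cosh_abs, ← Real.cosh_abs (√(-a) * _)]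
    congr 1; simp only [abs_mul, abs_abs]; ring

/-- With `cs_sq_mul`, this is the homogeneity of geodesics: multiplying the velocity by `c`
multiplies `k g(v, v)` by `c²`. The square root produces `|c|`, which is harmless because cosine is
even and sine is odd. -/
lemma sn_sq_mul (a c t : ℝ) : c * sn (c ^ 2 * a) t = sn a (c * t) := by
  rcases eq_or_ne c 0 with rfl | hc
  · simp [sn]
  have hc2 : 0 < c ^ 2 := by positivity
  have habs : ∀ b, √(c ^ 2 * b) = |c| * √b := fun b => by
    rw [Real.sqrt_mul hc2.le, Real.sqrt_sq_eq_abs]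
  rcases lt_trichotomy a 0 with ha | rfl | ha
  · have h1 : c ^ 2 * a < 0 := mul_neg_of_pos_of_neg hc2 ha
    have hs : √(-a) ≠ 0 := (Real.sqrt_pos.2 (by linarith)).ne'
    simp only [sn, h1, ha, not_lt.2 h1.le, not_lt.2 ha.le, if_true, if_false]
    rw [← mul_neg, habs]
    rcases abs_choice c with h | h <;> rw [h]
    · rw [show c * √(-a) * t = √(-a) * (c * t) by ring]; field_simp
    · rw [show -c * √(-a) * t = -(√(-a) * (c * t)) by ring, Real.sinh_neg]; field_simp
  · simp [sn]
  · have h1 : 0 < c ^ 2 * a := mul_pos hc2 ha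
    have hs : √a ≠ 0 := (Real.sqrt_pos.2 ha).ne'
    simp only [sn, h1, ha, if_true]
    rw [habs]
    rcases abs_choice c with h | h <;> rw [h]
    · rw [show c * √a * t = √a * (c * t) by ring]; field_simp
    · rw [show -c * √a * t = -(√a * (c * t)) by ring, Real.sin_neg]; field_simp

lemma cs_eq_half (k r : ℝ) : cs k r = cs k (r / 2) ^ 2 - k * sn k (r / 2) ^ 2 := by
  rcases lt_trichotomy k 0 with h | rfl | h
  · have hs : √(-k) ^ 2 = -k := Real.sq_sqrt (by linarith)
    have hk : k ≠ 0 := h.ne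
    simp only [cs, sn, not_le.2 h, not_lt.2 h.le, h, if_true, if_false, div_pow, hs]
    rw [show √(-k) * r = 2 * (√(-k) * (r / 2)) by ring, Real.cosh_two_mul]
    field_simp; ring
  · simp [cs]
  · have hs : √k ^ 2 = k := Real.sq_sqrt h.le
    simp only [cs, sn, h, h.le, if_true, div_pow, hs]
    rw [show √k * r = 2 * (√k * (r / 2)) by ring, Real.cos_two_mul']
    field_simp

lemma sn_eq_half (k r : ℝ) : sn k r = 2 * sn k (r / 2) * cs k (r / 2) := by
  rcases lt_trichotomy k 0 with h | rfl | h
  · simp only [cs, sn, not_le.2 h, not_lt.2 h.le, h, if_true, if_false]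
    rw [show √(-k) * r = 2 * (√(-k) * (r / 2)) by ring, Real.sinh_two_mul]
    ring
  · simp [cs, sn]; ring
  · simp only [cs, sn, h, h.le, if_true]
    rw [show √k * r = 2 * (√k * (r / 2)) by ring, Real.sin_two_mul]
    ring

/-- Here and in `sn_sq_eq`, functions of the radius become polynomials in the squared chord `4
sn(r/2)²`; the Dirac operator on kernels produces its coefficients in the latter form. -/
lemma cs_eq_one_sub (k r : ℝ) : cs k r = 1 - k / 2 * (4 * sn k (r / 2) ^ 2) := by
  linear_combination cs_eq_half k r + cs_sq_add k (r / 2)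

lemma sn_sq_eq (k r : ℝ) :
    sn k r ^ 2 = 4 * sn k (r / 2) ^ 2 * (1 - k / 4 * (4 * sn k (r / 2) ^ 2)) := by
  linear_combination (sn k r + 2 * sn k (r / 2) * cs k (r / 2)) * sn_eq_half k r
    + 4 * sn k (r / 2) ^ 2 * cs_sq_add k (r / 2)

lemma contDiff_cs (k : ℝ) : ContDiff ℝ ∞ (cs k) := by
  by_cases h : 0 ≤ k
  · have : cs k = fun t => Real.cos (√k * t) := by funext t; simp [cs, h]
    rw [this]; fun_prop
  · have : cs k = fun t => Real.cosh (√(-k) * t) := by funext t; simp [cs, h]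
    rw [this]; fun_prop

lemma contDiff_sn (k : ℝ) : ContDiff ℝ ∞ (sn k) := by
  rcases lt_trichotomy k 0 with h | rfl | h
  · have : sn k = fun t => Real.sinh (√(-k) * t) / √(-k) := by
      funext t; simp [sn, h, not_lt.2 h.le]
    rw [this]; fun_prop
  · have : sn 0 = fun t => t := by funext t; simp [sn]
    rw [this]; fun_prop
  · have : sn k = fun t => Real.sin (√k * t) / √k := by funext t; simp [sn, h]
    rw [this]; fun_prop

lemma continuous_cs (k : ℝ) : Continuous (cs k) := (contDiff_cs k).continuous

lemma continuous_sn (k : ℝ) : Continuous (sn k) := (contDiff_sn k).continuous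

lemma radii_pos {k r : ℝ} (hr : r ∈ radii k) : 0 < r := hr.1

lemma sqrt_mul_half_lt {k r : ℝ} (hr : r ∈ radii k) (hk : 0 < k) :
    √k * (r / 2) < Real.pi / 2 := by
  have h0 : 0 < √k := Real.sqrt_pos.2 hk
  have h1 := (lt_div_iff₀ h0).1 (hr.2 hk)
  nlinarith

lemma cs_half_pos {k r : ℝ} (hr : r ∈ radii k) : 0 < cs k (r / 2) := by
  have hr0 := hr.1
  by_cases h : 0 ≤ k
  · simp only [cs, h, if_true]
    rcases h.eq_or_lt with rfl | hk
    · simp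
    · refine Real.cos_pos_of_mem_Ioo ⟨?_, sqrt_mul_half_lt hr hk⟩
      have : 0 ≤ √k * (r / 2) := by positivity
      linarith [Real.pi_pos]
  · simp only [cs, h, if_false]; exact Real.cosh_pos _

lemma sn_half_pos {k r : ℝ} (hr : r ∈ radii k) : 0 < sn k (r / 2) := by
  have hr0 := hr.1
  rcases lt_trichotomy k 0 with h | rfl | h
  · have : 0 < √(-k) := Real.sqrt_pos.2 (by linarith)
    simp only [sn, h, not_lt.2 h.le, if_true, if_false]
    exact div_pos (Real.sinh_pos_iff.2 (by positivity)) this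
  · simpa [sn] using hr0
  · have : 0 < √k := Real.sqrt_pos.2 h
    simp only [sn, h, if_true]
    refine div_pos (Real.sin_pos_of_pos_of_lt_pi (by positivity) ?_) this
    linarith [sqrt_mul_half_lt hr h, Real.pi_pos]

lemma sn_pos {k r : ℝ} (hr : r ∈ radii k) : 0 < sn k r := by
  rw [sn_eq_half]
  have := cs_half_pos hr
  have := sn_half_pos hr
  positivity

lemma isOpen_radii (k : ℝ) : IsOpen (radii k) := by
  by_cases hk : 0 < k
  · have : radii k = Set.Ioo 0 (Real.pi / √k) := by ext r; simp [radii, hk]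
    rw [this]; exact isOpen_Ioo
  · have : radii k = Set.Ioi 0 := by ext r; simp [radii, hk]
    rw [this]; exact isOpen_Ioi

/-- The inverse function of `sn k`. -/
def arcsn (k t : ℝ) : ℝ :=
  if 0 < k then Real.arcsin (√k * t) / √k
  else if k < 0 then Real.arsinh (√(-k) * t) / √(-k) else t

/-- The inverse function of `r ↦ 4 sn(r / 2)²`. -/
def rad (k s : ℝ) : ℝ := 2 * arcsn k (√s / 2)

/-- The image of `radii k` under `r ↦ 4 sn(r / 2)²`. -/
def chordRange (k : ℝ) : Set ℝ := {s | 0 < s ∧ k * s < 4}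

lemma isOpen_chordRange (k : ℝ) : IsOpen (chordRange k) :=
  (isOpen_lt continuous_const continuous_id).inter
    (isOpen_lt (continuous_const.mul continuous_id) continuous_const)

lemma chord_mem {k r : ℝ} (hr : r ∈ radii k) : 4 * sn k (r / 2) ^ 2 ∈ chordRange k := by
  have h1 := sn_half_pos hr
  have h2 := cs_half_pos hr
  refine ⟨by positivity, ?_⟩
  nlinarith [cs_sq_add k (r / 2)]

lemma arcsn_sn {k r : ℝ} (hr : r ∈ radii k) : arcsn k (sn k (r / 2)) = r / 2 := by
  rcases lt_trichotomy k 0 with h | rfl | h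
  · have : √(-k) ≠ 0 := (Real.sqrt_pos.2 (by linarith)).ne'
    simp only [sn, arcsn, h, not_lt.2 h.le, if_true, if_false]
    rw [mul_div_cancel₀ _ this, Real.arsinh_sinh, mul_div_cancel_left₀ _ this]
  · simp [sn, arcsn]
  · have h0 : 0 < √k := Real.sqrt_pos.2 h
    have hr0 := hr.1
    simp only [sn, arcsn, h, if_true]
    have : 0 ≤ √k * (r / 2) := by positivity
    rw [mul_div_cancel₀ _ h0.ne', Real.arcsin_sin (by linarith [Real.pi_pos])
      (sqrt_mul_half_lt hr h).le, mul_div_cancel_left₀ _ h0.ne']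

lemma rad_chord {k r : ℝ} (hr : r ∈ radii k) : rad k (4 * sn k (r / 2) ^ 2) = r := by
  have h : √(4 * sn k (r / 2) ^ 2) = 2 * sn k (r / 2) := by
    rw [show 4 * sn k (r / 2) ^ 2 = (2 * sn k (r / 2)) ^ 2 by ring]
    exact Real.sqrt_sq (by linarith [sn_half_pos hr])
  rw [rad, h, mul_div_cancel_left₀ _ two_ne_zero, arcsn_sn hr]; ring

lemma sqrt_chord_lt {k s : ℝ} (hs : s ∈ chordRange k) (hk : 0 < k) : √k * (√s / 2) < 1 := by
  have h2 : √k * √s < 2 := by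
    rw [← Real.sqrt_mul hk.le, Real.sqrt_lt' (by norm_num)]
    linarith [hs.2]
  linarith

lemma rad_mem {k s : ℝ} (hs : s ∈ chordRange k) : rad k s ∈ radii k := by
  have h0 : 0 < √s := Real.sqrt_pos.2 hs.1
  rcases lt_trichotomy k 0 with h | rfl | h
  · have h1 : 0 < √(-k) := Real.sqrt_pos.2 (by linarith)
    refine ⟨?_, fun h' => absurd h' (not_lt.2 h.le)⟩
    simp only [rad, arcsn, h, not_lt.2 h.le, if_true, if_false]
    have := Real.arsinh_pos_iff.2 (show 0 < √(-k) * (√s / 2) by positivity)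
    positivity
  · refine ⟨?_, fun h' => absurd h' (lt_irrefl _)⟩
    simpa [rad, arcsn] using hs.1
  · have h1 : 0 < √k := Real.sqrt_pos.2 h
    have h2 := sqrt_chord_lt hs h
    have h3 := Real.arcsin_pos.2 (show 0 < √k * (√s / 2) by positivity)
    have h4 := (Real.arcsin_lt_pi_div_two.2 h2)
    simp only [rad, arcsn, h, if_true, radii, Set.mem_ofPred_eq, forall_const]
    refine ⟨by positivity, ?_⟩
    rw [← mul_div_assoc]
    exact (div_lt_div_iff_of_pos_right h1).2 (by linarith)

lemma chord_rad {k s : ℝ} (hs : s ∈ chordRange k) : 4 * sn k (rad k s / 2) ^ 2 = s := by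
  have h0 : 0 < √s := Real.sqrt_pos.2 hs.1
  have hss : √s ^ 2 = s := Real.sq_sqrt hs.1.le
  have key : sn k (arcsn k (√s / 2)) = √s / 2 := by
    rcases lt_trichotomy k 0 with h | rfl | h
    · have h1 : √(-k) ≠ 0 := (Real.sqrt_pos.2 (by linarith)).ne'
      simp only [sn, arcsn, h, not_lt.2 h.le, if_true, if_false]
      rw [mul_div_cancel₀ _ h1, Real.sinh_arsinh, mul_div_cancel_left₀ _ h1]
    · simp [sn, arcsn]
    · have h1 : 0 < √k := Real.sqrt_pos.2 h
      have h2 := sqrt_chord_lt hs h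
      have h3 : 0 < √k * (√s / 2) := by positivity
      simp only [sn, arcsn, h, if_true]
      rw [mul_div_cancel₀ _ h1.ne', Real.sin_arcsin (by linarith) h2.le,
        mul_div_cancel_left₀ _ h1.ne']
  rw [rad, mul_div_cancel_left₀ _ two_ne_zero, key]
  linear_combination hss

lemma contDiffAt_rad {k s : ℝ} (hs : s ∈ chordRange k) : ContDiffAt ℝ ∞ (rad k) s := by
  have h0 : ContDiffAt ℝ ∞ (fun s => √s / 2) s :=
    (Real.contDiffAt_sqrt hs.1.ne').div_const 2
  have h0' : 0 < √s := Real.sqrt_pos.2 hs.1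
  rcases lt_trichotomy k 0 with h | rfl | h
  · have e : rad k = fun s => 2 * (Real.arsinh (√(-k) * (√s / 2)) / √(-k)) := by
      funext s; simp [rad, arcsn, h, not_lt.2 h.le]
    rw [e]
    exact contDiffAt_const.mul (((contDiffAt_const.mul h0).arsinh).div_const _)
  · have e : rad 0 = fun s => 2 * (√s / 2) := by funext s; simp [rad, arcsn]
    rw [e]; exact contDiffAt_const.mul h0
  · have e : rad k = fun s => 2 * (Real.arcsin (√k * (√s / 2)) / √k) := by
      funext s; simp [rad, arcsn, h]
    have h1 : 0 < √k := Real.sqrt_pos.2 h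
    have h3 : 0 < √k * (√s / 2) := by positivity
    rw [e]
    exact contDiffAt_const.mul (((Real.contDiffAt_arcsin (by linarith)
      (sqrt_chord_lt hs h).ne).comp s (contDiffAt_const.mul h0)).div_const _)

lemma continuous_rad (k : ℝ) : Continuous (rad k) := by
  have h0 : Continuous (fun s => √s / 2) := Real.continuous_sqrt.div_const 2
  rcases lt_trichotomy k 0 with h | rfl | h
  · have e : rad k = fun s => 2 * (Real.arsinh (√(-k) * (√s / 2)) / √(-k)) := by
      funext s; simp [rad, arcsn, h, not_lt.2 h.le]
    rw [e]
    exact continuous_const.mul ((Real.continuous_arsinh.comp (continuous_const.mul h0)).div_const _)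
  · have e : rad 0 = fun s => 2 * (√s / 2) := by funext s; simp [rad, arcsn]
    rw [e]; exact continuous_const.mul h0
  · have e : rad k = fun s => 2 * (Real.arcsin (√k * (√s / 2)) / √k) := by
      funext s; simp [rad, arcsn, h]
    rw [e]
    exact continuous_const.mul ((Real.continuous_arcsin.comp (continuous_const.mul h0)).div_const _)

/-- Outside `chordRange` the total functions `√` and `arcsin` saturate, so `rad` takes one of the
end values `0` and `π / √k`, which `radii` excludes. Consequently `f ∘ rad` is supported in
`chordRange` without any cut-off. -/
lemma chordRange_of_rad_mem {k s : ℝ} (h : rad k s ∈ radii k) : s ∈ chordRange k := by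
  have hs : 0 < s := by
    by_contra hs
    have : rad k s = 0 := by
      simp [rad, arcsn, Real.sqrt_eq_zero_of_nonpos (not_lt.1 hs)]
    exact (radii_pos h).ne' this
  refine ⟨hs, ?_⟩
  by_contra h4
  have hk : 0 < k := by
    by_contra hk
    nlinarith
  have h1 : 0 < √k := Real.sqrt_pos.2 hk
  have h2 : 1 ≤ √k * (√s / 2) := by
    have : (2 : ℝ) ≤ √k * √s := by
      rw [← Real.sqrt_mul hk.le]
      exact Real.le_sqrt_of_sq_le (by linarith)
    linarith
  have h3 := h.2 hk
  simp only [rad, arcsn, hk, if_true, Real.arcsin_of_one_le h2] at h3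
  refine absurd h3 (not_lt.2 (le_of_eq ?_))
  ring

lemma hasDerivAt_chord (k r : ℝ) :
    HasDerivAt (fun r => 4 * sn k (r / 2) ^ 2) (2 * sn k r) r := by
  have h := (((sn_hasDerivAt k (r / 2)).comp r ((hasDerivAt_id r).div_const 2)).pow 2).const_mul 4
  refine h.congr_deriv ?_
  rw [sn_eq_half]; simp; ring

/-- The inverse function rule, obtained by differentiating the identity `chord_rad`: the derivative
of the squared chord in the radius is `2 sn r`. -/
lemma hasDerivAt_rad {k s : ℝ} (hs : s ∈ chordRange k) :
    HasDerivAt (rad k) (2 * sn k (rad k s))⁻¹ s := by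
  have h0 := (contDiffAt_rad hs).differentiableAt (by simp)
  have hp := sn_pos (rad_mem hs)
  have h1 : HasDerivAt (fun s => 4 * sn k (rad k s / 2) ^ 2)
      (2 * sn k (rad k s) * deriv (rad k) s) s :=
    (hasDerivAt_chord k (rad k s)).comp s h0.hasDerivAt
  have h2 : HasDerivAt (fun s => 4 * sn k (rad k s / 2) ^ 2) 1 s :=
    (hasDerivAt_id s).congr_of_eventuallyEq
      (Filter.eventually_of_mem ((isOpen_chordRange k).mem_nhds hs) fun t ht => chord_rad ht)
  have h3 := h1.unique h2
  rw [← eq_inv_of_mul_eq_one_right h3]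
  exact h0.hasDerivAt

end

/-! ### Geometry of the pseudosphere: chords, geodesics, time orientation. -/

section

/-! ### The ambient bilinear forms -/

/-- `eta` as a bilinear form. -/
def etaForm (d : ℕ) : LinearMap.BilinForm ℝ (Mink d) :=
  LinearMap.mk₂ ℝ eta
    (fun X Y Z => by simp only [eta, Prod.fst_add, Prod.snd_add, inner_add_left]; ring)
    (fun c X Y => by
      simp only [eta, Prod.smul_fst, Prod.smul_snd, smul_eq_mul, real_inner_smul_left]; ring)
    (fun X Y Z => by simp only [eta, Prod.fst_add, Prod.snd_add, inner_add_right]; ring)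
    (fun c X Y => by
      simp only [eta, Prod.smul_fst, Prod.smul_snd, smul_eq_mul, real_inner_smul_right]; ring)

lemma etaForm_apply (X Y : Mink d) : etaForm d X Y = eta X Y := rfl

/-- The form `a dw² + b (dt² - |dy|²)`. -/
def scaledForm (d : ℕ) (a b : ℝ) : LinearMap.BilinForm ℝ (Amb d) :=
  LinearMap.mk₂ ℝ (fun v u => a * (v.1 * u.1) + b * etaForm d v.2 u.2)
    (fun X Y Z => by
      simp only [Prod.fst_add, Prod.snd_add, map_add, LinearMap.add_apply]; ring)
    (fun c X Y => by
      simp only [Prod.smul_fst, Prod.smul_snd, smul_eq_mul, map_smul, LinearMap.smul_apply]; ring)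
    (fun X Y Z => by simp only [Prod.fst_add, Prod.snd_add, map_add]; ring)
    (fun c X Y => by simp only [Prod.smul_fst, Prod.smul_snd, smul_eq_mul, map_smul]; ring)

/-- The form `dw² + k (dt² - |dy|²)`, of which the pseudosphere is the unit sphere. -/
abbrev ambForm (d : ℕ) (k : ℝ) : LinearMap.BilinForm ℝ (Amb d) := scaledForm d 1 k

/-- `metric` as a bilinear form. -/
abbrev metricForm (d : ℕ) (k : ℝ) : LinearMap.BilinForm ℝ (Amb d) := scaledForm d k⁻¹ 1

lemma ambForm_apply (k : ℝ) (v u : Amb d) : ambForm d k v u = v.1 * u.1 + k * eta v.2 u.2 := by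
  simp only [scaledForm, LinearMap.mk₂_apply, etaForm_apply, one_mul]

lemma metricForm_apply (k : ℝ) (v u : Amb d) : metricForm d k v u = metric k v u := by
  simp only [scaledForm, LinearMap.mk₂_apply, etaForm_apply, one_mul, metric]

lemma metric_comm (k : ℝ) (v u : Amb d) : metric k v u = metric k u v := by
  simp only [metric]; rw [eta_comm, mul_comm v.1]

lemma metric_smul_smul (k a b : ℝ) (v u : Amb d) :
    metric k (a • v) (b • u) = a * b * metric k v u := by
  simp only [← metricForm_apply, map_smul, LinearMap.smul_apply, smul_eq_mul]; ring

lemma metric_smul_self (k a : ℝ) (v : Amb d) :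
    metric k (a • v) (a • v) = a ^ 2 * metric k v v := by
  rw [metric_smul_smul]; ring

lemma ambForm_comm (k : ℝ) (v u : Amb d) : ambForm d k v u = ambForm d k u v := by
  rw [ambForm_apply, ambForm_apply, eta_comm]; ring

lemma isTangent_iff {k : ℝ} {p v : Amb d} : IsTangent k p v ↔ ambForm d k p v = 0 := by
  rw [ambForm_apply]; rfl

lemma ambForm_self {k : ℝ} {p : Amb d} (hp : p ∈ Quadric k d) : ambForm d k p p = 1 := by
  rw [ambForm_apply, ← hp.1]; ring

/-- For `k = 0` the two forms separate: `ambForm` retains only `dw²` and `metric` only the Minkowski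
part. This is why several proofs treat flat space apart. -/
lemma ambForm_eq_mul_metric {k : ℝ} (hk : k ≠ 0) (v u : Amb d) :
    ambForm d k v u = k * metric k v u := by
  rw [ambForm_apply, metric]; field_simp

lemma fst_eq_one {p : Amb d} (hp : p ∈ Quadric 0 d) : p.1 = 1 := by
  have h1 := hp.1
  have h2 := hp.2 rfl
  nlinarith

lemma fst_eq_zero {p v : Amb d} (hp : p ∈ Quadric 0 d) (hv : IsTangent 0 p v) : v.1 = 0 := by
  simpa [IsTangent, fst_eq_one hp] using hv

lemma IsTangent.smul {k : ℝ} {p v : Amb d} (hv : IsTangent k p v) (c : ℝ) :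
    IsTangent k p (c • v) := by
  rw [isTangent_iff] at *; rw [map_smul, hv, smul_zero]

lemma IsTangent.add {k : ℝ} {p v u : Amb d} (hv : IsTangent k p v) (hu : IsTangent k p u) :
    IsTangent k p (v + u) := by
  rw [isTangent_iff] at *; rw [map_add, hv, hu, add_zero]

lemma IsTangent.sum {k : ℝ} {p : Amb d} {ι : Type*} (s : Finset ι) {v : ι → Amb d}
    (hv : ∀ i ∈ s, IsTangent k p (v i)) : IsTangent k p (∑ i ∈ s, v i) := by
  simp only [isTangent_iff] at *
  rw [map_sum]; exact Finset.sum_eq_zero hv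

/-- The factor `k` keeps the orthogonality of position and tangent vector valid for every `k`; when
`k = 0`, the number `metric k p v` itself need not vanish. The factors in the next lemma have the
same purpose. -/
lemma mul_metric_tangent {k : ℝ} {p v : Amb d} (hv : IsTangent k p v) :
    k * metric k p v = 0 := by
  by_cases hk : k = 0
  · rw [hk, zero_mul]
  · rw [← ambForm_eq_mul_metric hk]; exact isTangent_iff.1 hv

lemma mul_mul_metric_self {k : ℝ} {p : Amb d} (hp : p ∈ Quadric k d) :
    k * (k * metric k p p) = k := by
  by_cases hk : k = 0
  · rw [hk, zero_mul]
  · rw [← ambForm_eq_mul_metric hk, ambForm_self hp, mul_one]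

/-- A multiple of `p` plus a tangent vector at `p` determines both. -/
lemma eq_of_smul_add_tangent {k : ℝ} {p v u : Amb d} (hp : p ∈ Quadric k d)
    (hv : IsTangent k p v) (hu : IsTangent k p u) {a b : ℝ} (h : a • p + v = b • p + u) :
    a = b ∧ v = u := by
  have h1 := congrArg (ambForm d k p) h
  simp only [map_add, map_smul, ambForm_self hp, isTangent_iff.1 hv, isTangent_iff.1 hu,
    smul_eq_mul, mul_one, add_zero] at h1
  refine ⟨h1, ?_⟩
  rw [h1] at h; exact add_left_cancel h

/-! ### Geodesics -/

lemma geod_zero (k : ℝ) (p v : Amb d) : geod k p v 0 = p := by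
  simp [geod, cs_zero, sn_zero]

lemma geod_smul (k : ℝ) (p v : Amb d) (c t : ℝ) : geod k p (c • v) t = geod k p v (c * t) := by
  simp only [geod, metric_smul_self]
  rw [show k * (c ^ 2 * metric k v v) = c ^ 2 * (k * metric k v v) by ring, cs_sq_mul, smul_smul,
    mul_comm _ c, sn_sq_mul]

lemma geod_unit {k : ℝ} (p : Amb d) {u : Amb d} (hu : metric k u u = 1) (r : ℝ) :
    geod k p (r • u) 1 = cs k r • p + sn k r • u := by
  rw [geod_smul, geod, hu, mul_one, mul_one]

lemma geod_timelike {k : ℝ} (p : Amb d) {v : Amb d} {r : ℝ} (hr : 0 < r)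
    (hv : metric k v v = r ^ 2) (t : ℝ) :
    geod k p v t = cs k (r * t) • p + (sn k (r * t) / r) • v := by
  rw [geod, hv, mul_comm k, cs_sq_mul, ← sn_sq_mul, mul_div_cancel_left₀ _ hr.ne']

/-- The squared chord between two points of the pseudosphere. -/
def chord (k : ℝ) (p q : Amb d) : ℝ := metric k (q - p) (q - p)

lemma chord_geod {k : ℝ} {p u : Amb d} (hp : p ∈ Quadric k d) (hu : IsTangent k p u)
    (hu1 : metric k u u = 1) (r : ℝ) :
    chord k p (cs k r • p + sn k r • u) = 4 * sn k (r / 2) ^ 2 := by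
  have e : cs k r • p + sn k r • u - p = (cs k r - 1) • p + sn k r • u := by module
  have h1 := mul_metric_tangent hu
  have h2 := mul_mul_metric_self hp
  rw [chord, e, cs_eq_one_sub]
  simp only [← metricForm_apply, map_add, map_smul, LinearMap.add_apply, LinearMap.smul_apply,
    smul_eq_mul] at *
  have h3 : metricForm d k u p = metricForm d k p u := by
    rw [metricForm_apply, metricForm_apply, metric_comm]
  rw [h3, hu1]
  linear_combination (-4 * sn k (r / 2) ^ 2 * sn k r) * h1 + 4 * sn k (r / 2) ^ 4 * h2
    + sn_sq_eq k r

/-- Polarisation: for `k ≠ 0` the squared chord times `k` is the `ambForm` square of `q - p`, and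
both points are unit vectors for that form. -/
lemma ambForm_eq_chord {k : ℝ} {p q : Amb d} (hp : p ∈ Quadric k d) (hq : q ∈ Quadric k d) :
    ambForm d k p q = 1 - k / 2 * chord k p q := by
  by_cases hk : k = 0
  · subst hk
    rw [ambForm_apply, fst_eq_one hp, fst_eq_one hq]; ring
  · have h : k * chord k p q = 2 - 2 * ambForm d k p q := by
      rw [chord, ← ambForm_eq_mul_metric hk]
      simp only [map_sub, LinearMap.sub_apply]
      rw [ambForm_self hp, ambForm_self hq, ambForm_comm k q p]; ring
    linarith

/-- The component of `q` tangent to the pseudosphere at `p`. -/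
def tanPart (k : ℝ) (p q : Amb d) : Amb d := q - (1 - k / 2 * chord k p q) • p

lemma tanPart_isTangent {k : ℝ} {p q : Amb d} (hp : p ∈ Quadric k d) (hq : q ∈ Quadric k d) :
    IsTangent k p (tanPart k p q) := by
  rw [isTangent_iff, tanPart, map_sub, map_smul, ambForm_self hp, ambForm_eq_chord hp hq]
  simp

lemma metric_tanPart {k : ℝ} {p q : Amb d} (hp : p ∈ Quadric k d) (hq : q ∈ Quadric k d) :
    metric k (tanPart k p q) (tanPart k p q) = chord k p q * (1 - k / 4 * chord k p q) := by
  by_cases hk : k = 0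
  · subst hk; simp [tanPart, chord]
  · have h := ambForm_eq_chord hp hq
    apply mul_left_cancel₀ hk
    rw [← ambForm_eq_mul_metric hk, tanPart]
    simp only [map_sub, map_smul, LinearMap.sub_apply, LinearMap.smul_apply, smul_eq_mul]
    rw [ambForm_self hp, ambForm_self hq, ambForm_comm k q p, h]; ring

/-- The inverse of the exponential map at `p`, on timelike separated points. -/
def expInv (k : ℝ) (p q : Amb d) : Amb d :=
  (rad k (chord k p q) / sn k (rad k (chord k p q))) • tanPart k p q

lemma expInv_isTangent {k : ℝ} {p q : Amb d} (hp : p ∈ Quadric k d) (hq : q ∈ Quadric k d) :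
    IsTangent k p (expInv k p q) := (tanPart_isTangent hp hq).smul _

lemma metric_expInv {k : ℝ} {p q : Amb d} (hp : p ∈ Quadric k d) (hq : q ∈ Quadric k d)
    (h : chord k p q ∈ chordRange k) :
    metric k (expInv k p q) (expInv k p q) = rad k (chord k p q) ^ 2 := by
  have h1 := sn_pos (rad_mem h)
  have h2 := sn_sq_eq k (rad k (chord k p q))
  rw [chord_rad h] at h2
  rw [expInv, metric_smul_self, metric_tanPart hp hq, ← h2]
  field_simp

/-- The decomposition `q = cs r • p + sn r • u` is the splitting of `q` into a multiple of `p` and a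
tangent vector, and `cs r = 1 - k σ / 2`. So `tanPart` is `sn r • u`, and the factor `r / sn r` in
`expInv` turns it into `r • u`. -/
lemma geod_expInv {k : ℝ} {p q : Amb d} (hp : p ∈ Quadric k d) (hq : q ∈ Quadric k d)
    (h : chord k p q ∈ chordRange k) : geod k p (expInv k p q) 1 = q := by
  have h0 := radii_pos (rad_mem h)
  have h1 := sn_pos (rad_mem h)
  rw [geod_timelike p h0 (metric_expInv hp hq h), mul_one, expInv, smul_smul,
    div_mul_div_cancel₀ h0.ne', div_self h1.ne', cs_eq_one_sub, chord_rad h, tanPart]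
  module

lemma chord_geod_timelike {k : ℝ} {p v : Amb d} (hp : p ∈ Quadric k d) (hv : IsTangent k p v)
    {r : ℝ} (hr : 0 < r) (hv1 : metric k v v = r ^ 2) :
    chord k p (geod k p v 1) = 4 * sn k (r / 2) ^ 2 := by
  have e : v = r • (r⁻¹ • v) := by rw [smul_smul, mul_inv_cancel₀ hr.ne', one_smul]
  have hu : metric k (r⁻¹ • v) (r⁻¹ • v) = 1 := by
    rw [metric_smul_self, hv1]; field_simp
  rw [e, geod_unit p hu, chord_geod hp (hv.smul _) hu]

lemma expInv_geod {k : ℝ} {p v : Amb d} (hp : p ∈ Quadric k d) (hv : IsTangent k p v)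
    {r : ℝ} (hr : r ∈ radii k) (hv1 : metric k v v = r ^ 2) :
    expInv k p (geod k p v 1) = v := by
  have h0 := radii_pos hr
  have h1 := sn_pos hr
  have hc := chord_geod_timelike hp hv h0 hv1
  rw [expInv, tanPart, hc, rad_chord hr, geod_timelike p h0 hv1, mul_one, ← cs_eq_one_sub,
    add_sub_cancel_left, smul_smul, div_mul_div_cancel₀ h1.ne', div_self h0.ne', one_smul]

lemma geodVel_isTangent {k : ℝ} {p v : Amb d} (hp : p ∈ Quadric k d) (hv : IsTangent k p v)
    (t : ℝ) : IsTangent k (geod k p v t) (geodVel k p v t) := by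
  rw [isTangent_iff, geod, geodVel]
  simp only [map_add, map_smul, LinearMap.add_apply, LinearMap.smul_apply, smul_eq_mul]
  rw [ambForm_self hp, ambForm_comm k v p, isTangent_iff.1 hv]
  have : ambForm d k v v = k * metric k v v := by
    by_cases hk : k = 0
    · subst hk; simp [ambForm_apply, fst_eq_zero hp hv]
    · exact ambForm_eq_mul_metric hk v v
  rw [this]; ring

lemma metric_geodVel {k : ℝ} {p v : Amb d} (hp : p ∈ Quadric k d) (hv : IsTangent k p v)
    (t : ℝ) : metric k (geodVel k p v t) (geodVel k p v t) = metric k v v := by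
  have h1 := mul_metric_tangent hv
  have h2 := mul_mul_metric_self hp
  have h3 := cs_sq_add (k * metric k v v) t
  have h4 : metricForm d k v p = metricForm d k p v := by
    rw [metricForm_apply, metricForm_apply, metric_comm]
  rw [geodVel]
  simp only [← metricForm_apply, map_add, map_smul, LinearMap.add_apply, LinearMap.smul_apply,
    smul_eq_mul] at *
  rw [h4]
  set m := metricForm d k v v
  set c := cs (k * m) t
  set s := sn (k * m) t
  linear_combination (m ^ 2 * s ^ 2) * h2 - (2 * m * s * c) * h1 + m * h3

/-! ### The time orientation -/

lemma timeComponent_smul (k : ℝ) (p v : Amb d) (c : ℝ) :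
    timeComponent k p (c • v) = c * timeComponent k p v := by
  simp only [timeComponent, Prod.smul_fst, Prod.smul_snd, smul_eq_mul]
  split_ifs <;> ring

lemma continuous_timeComponent (k : ℝ) :
    Continuous fun z : Amb d × Amb d => timeComponent k z.1 z.2 := by
  unfold timeComponent
  split_ifs <;> fun_prop

/-- A reversed Cauchy–Schwarz inequality against the field that defines the time orientation. It
makes the time component nonzero on timelike vectors, so that its sign can change neither along a
timelike geodesic nor along the hyperboloid. -/
lemma metric_le_timeComponent_sq {k : ℝ} {p v : Amb d} (hp : p ∈ Quadric k d)
    (hv : IsTangent k p v) : metric k v v ≤ timeComponent k p v ^ 2 := by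
  have hy : 0 ≤ inner ℝ v.2.2 v.2.2 := real_inner_self_nonneg
  by_cases hk : 0 < k
  · have h1 := hp.1
    have h2 : p.1 * v.1 + k * eta p.2 v.2 = 0 := hv
    have hcs := real_inner_mul_inner_self_le p.2.2 v.2.2
    have hpy : 0 ≤ inner ℝ p.2.2 p.2.2 := real_inner_self_nonneg
    rw [timeComponent, if_pos hk]
    simp only [metric, eta] at *
    set w := p.1
    set t := p.2.1
    set a := v.1
    set b := v.2.1
    set P := inner ℝ p.2.2 p.2.2
    set V := inner ℝ v.2.2 v.2.2
    set I := inner ℝ p.2.2 v.2.2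
    -- Lagrange's identity in the plane of `w` and `t`, with `w² + k t² = 1 + k P` on the
    -- pseudosphere and `w a + k t b = k I` by tangency.
    have key : (w * b - t * a) ^ 2 =
        (1 + k * P) * (k⁻¹ * (a * a) + b * b) - k * I ^ 2 := by
      have h3 : w * a + k * (t * b) = k * I := by linarith
      have h4 : 1 + k * P = w ^ 2 + k * t ^ 2 := by linarith
      have h5 : k * I ^ 2 = k⁻¹ * (w * a + k * (t * b)) ^ 2 := by rw [h3]; field_simp
      rw [h4, h5]; field_simp; ring
    have h6 : 0 ≤ k * (P * V - I * I) := mul_nonneg hk.le (by linarith)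
    have h7 : 0 ≤ k * P := by positivity
    rcases le_total (k⁻¹ * (a * a) + (b * b - V)) 0 with h8 | h8
    · linarith [sq_nonneg (w * b - t * a)]
    · nlinarith [mul_nonneg h7 h8]
  · simp only [timeComponent, hk, if_false, metric, eta]
    have : k⁻¹ * (v.1 * v.1) ≤ 0 :=
      mul_nonpos_of_nonpos_of_nonneg (inv_nonpos.2 (not_lt.1 hk)) (mul_self_nonneg _)
    nlinarith

lemma timeComponent_ne_zero {k : ℝ} {p v : Amb d} (hp : p ∈ Quadric k d) (hv : IsTangent k p v)
    (h : 0 < metric k v v) : timeComponent k p v ≠ 0 := fun h0 => by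
  have := metric_le_timeComponent_sq hp hv
  rw [h0] at this; norm_num at this; linarith

lemma pos_of_ne_zero_of_continuous {f : ℝ → ℝ} (hf : Continuous f) (h0 : ∀ t, f t ≠ 0)
    (h : 0 < f 0) (t : ℝ) : 0 < f t := by
  by_contra hn
  obtain ⟨s, hs⟩ := mem_range_of_exists_le_of_exists_ge hf ⟨t, not_lt.1 hn⟩ ⟨0, h.le⟩
  exact h0 s hs

/-- The velocity stays timelike, so its time component never vanishes; being continuous, it keeps
its sign. -/
lemma timeComponent_geodVel_pos {k : ℝ} {p v : Amb d} (hp : p ∈ Quadric k d)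
    (hv : IsTangent k p v) (h : 0 < metric k v v) (ht : 0 < timeComponent k p v) (t : ℝ) :
    0 < timeComponent k (geod k p v t) (geodVel k p v t) := by
  have hc1 : Continuous (geod k p v) :=
    continuous_iff_continuousAt.2 fun t => (geod_hasDerivAt k p v t).continuousAt
  have hc2 : Continuous (geodVel k p v) :=
    continuous_iff_continuousAt.2 fun t => (geodVel_hasDerivAt k p v t).continuousAt
  refine pos_of_ne_zero_of_continuous
    (f := fun t => timeComponent k (geod k p v t) (geodVel k p v t))
    ((continuous_timeComponent k).comp (hc1.prodMk hc2)) (fun t => ?_) ?_ t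
  · refine timeComponent_ne_zero (geod_mem hp hv t) (geodVel_isTangent hp hv t) ?_
    rw [metric_geodVel hp hv]; exact h
  · simpa [geod, geodVel, cs_zero, sn_zero] using ht

/-! ### Frames -/

lemma frame_spec {k : ℝ} {p : Amb d} (hp : p ∈ Quadric k d) : IsFrame k p (frame k p) :=
  Classical.epsilon_spec (exists_isFrame hp)

/-- The sign of the `a`-th vector of an orthonormal basis. -/
def frameSign (a : Fin (d + 1)) : ℝ := if a = 0 then 1 else -1

lemma frameSign_sq (a : Fin (d + 1)) : frameSign a * frameSign a = 1 := by
  unfold frameSign; split_ifs <;> norm_num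

lemma metric_sum_frame {k : ℝ} {p : Amb d} {e : Fin (d + 1) → Amb d} (he : IsFrame k p e)
    (x y : Fin (d + 1) → ℝ) :
    metric k (∑ a, x a • e a) (∑ a, y a • e a) = ∑ a, frameSign a * (x a * y a) := by
  simp only [← metricForm_apply, map_sum, map_smul, LinearMap.sum_apply, LinearMap.smul_apply,
    smul_eq_mul]
  refine Finset.sum_congr rfl fun a _ => ?_
  rw [Finset.sum_eq_single a]
  · rw [metricForm_apply, he.2.1 a a]; simp only [frameSign, if_true]; ring
  · intro b _ hb
    rw [metricForm_apply, he.2.1 _ _, if_neg hb]; ring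
  · simp

end

/-! ### Determinants, frame coordinates and unit future vectors. -/

section

/-! ### Determinants -/

lemma det_sq_eq_one_of_preserves {V : Type*} [AddCommGroup V] [Module ℝ V] [FiniteDimensional ℝ V]
    {B : LinearMap.BilinForm ℝ V} (hB : B.Nondegenerate) {f : V →ₗ[ℝ] V}
    (hf : ∀ x y, B (f x) (f y) = B x y) : LinearMap.det f ^ 2 = 1 := by
  classical
  let b := Module.finBasis ℝ V
  have h1 : B.comp f f = B := by ext x y; exact hf x y
  have h2 := LinearMap.BilinForm.toMatrix_comp b b B f f
  rw [h1] at h2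
  have h3 := congrArg Matrix.det h2
  rw [Matrix.det_mul, Matrix.det_mul, Matrix.det_transpose, LinearMap.det_toMatrix] at h3
  have h4 := (LinearMap.BilinForm.nondegenerate_iff_det_ne_zero b).1 hB
  apply mul_right_cancel₀ h4
  linear_combination -h3

lemma det_upper_triangular {V W : Type*} [AddCommGroup V] [Module ℝ V] [FiniteDimensional ℝ V]
    [AddCommGroup W] [Module ℝ W] [FiniteDimensional ℝ W] {L : V × W →ₗ[ℝ] V × W}
    (f : V →ₗ[ℝ] V) (g : W →ₗ[ℝ] V) (h : W →ₗ[ℝ] W) (hL : ∀ z, L z = (f z.1 + g z.2, h z.2)) :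
    LinearMap.det L = LinearMap.det f * LinearMap.det h := by
  classical
  let b := Module.finBasis ℝ V
  let c := Module.finBasis ℝ W
  have h1 : LinearMap.toMatrix (b.prod c) (b.prod c) L =
      Matrix.fromBlocks (LinearMap.toMatrix b b f) (LinearMap.toMatrix c b g) 0
        (LinearMap.toMatrix c c h) := by
    ext i j
    rcases i with i | i <;> rcases j with j | j <;>
      simp [LinearMap.toMatrix_apply, hL]
  rw [← LinearMap.det_toMatrix (b.prod c), h1, Matrix.det_fromBlocks_zero₂₁, LinearMap.det_toMatrix,
    LinearMap.det_toMatrix]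

lemma det_lower_triangular {V W : Type*} [AddCommGroup V] [Module ℝ V] [FiniteDimensional ℝ V]
    [AddCommGroup W] [Module ℝ W] [FiniteDimensional ℝ W] {L : V × W →ₗ[ℝ] V × W}
    (f : V →ₗ[ℝ] V) (g : V →ₗ[ℝ] W) (h : W →ₗ[ℝ] W) (hL : ∀ z, L z = (f z.1, g z.1 + h z.2)) :
    LinearMap.det L = LinearMap.det f * LinearMap.det h := by
  classical
  let b := Module.finBasis ℝ V
  let c := Module.finBasis ℝ W
  have h1 : LinearMap.toMatrix (b.prod c) (b.prod c) L =
      Matrix.fromBlocks (LinearMap.toMatrix b b f) 0 (LinearMap.toMatrix b c g)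
        (LinearMap.toMatrix c c h) := by
    ext i j
    rcases i with i | i <;> rcases j with j | j <;>
      simp [LinearMap.toMatrix_apply, hL]
  rw [← LinearMap.det_toMatrix (b.prod c), h1, Matrix.det_fromBlocks_zero₁₂, LinearMap.det_toMatrix,
    LinearMap.det_toMatrix]

/-! ### Coordinates with respect to a frame -/

lemma etaForm_nondegenerate (d : ℕ) : (etaForm d).Nondegenerate := by
  have hs : (etaForm d).IsSymm := ⟨fun x y => eta_comm x y⟩
  refine hs.isRefl.nondegenerate_iff_separatingLeft.2 fun X hX => ?_
  have h1 := hX (X.1, -X.2)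
  rw [etaForm_apply, eta] at h1
  simp only [inner_neg_right, sub_neg_eq_add] at h1
  have h2 : 0 ≤ inner ℝ X.2 X.2 := real_inner_self_nonneg
  have h3 : X.1 = 0 := by nlinarith
  have h4 : X.2 = 0 := inner_self_eq_zero (𝕜 := ℝ).1 (by nlinarith)
  exact Prod.ext h3 h4

lemma ambForm_nondegenerate (d : ℕ) {k : ℝ} (hk : k ≠ 0) : (ambForm d k).Nondegenerate := by
  have hs : (ambForm d k).IsSymm := ⟨fun x y => ambForm_comm k x y⟩
  refine hs.isRefl.nondegenerate_iff_separatingLeft.2 fun z hz => ?_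
  have h1 : z.1 = 0 := by simpa [ambForm_apply, eta] using hz (1, 0)
  have h2 : z.2 = 0 := (etaForm_nondegenerate d).1 z.2 fun Y => by
    simpa [ambForm_apply, hk, etaForm_apply] using hz (0, Y)
  exact Prod.ext h1 h2

/-- The tangent vector at `p` with given coordinates with respect to `frame k p`. -/
def frameVec (k : ℝ) (p : Amb d) : Mink d →ₗ[ℝ] Amb d where
  toFun X := X.1 • frame k p 0 + ∑ i : Fin d, X.2 i • frame k p i.succ
  map_add' X Y := by
    simp only [Prod.fst_add, Prod.snd_add, PiLp.add_apply, add_smul, Finset.sum_add_distrib]; abel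
  map_smul' c X := by
    simp only [Prod.smul_fst, Prod.smul_snd, PiLp.smul_apply, smul_eq_mul, mul_smul, smul_add,
      Finset.smul_sum, RingHom.id_apply]

lemma frameVec_apply (k : ℝ) (p : Amb d) (X : Mink d) :
    frameVec k p X = X.1 • frame k p 0 + ∑ i : Fin d, X.2 i • frame k p i.succ := rfl

lemma unitFuture_eq (k : ℝ) (p : Amb d) (y : EuclideanSpace ℝ (Fin d)) :
    unitFuture k p y = frameVec k p (√(1 + ‖y‖ ^ 2), y) := rfl

lemma frameVec_eq_sum (k : ℝ) (p : Amb d) (X : Mink d) :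
    frameVec k p X = ∑ a : Fin (d + 1),
      (Fin.cons X.1 (fun i => X.2 i) : Fin (d + 1) → ℝ) a • frame k p a := by
  rw [frameVec_apply, Fin.sum_univ_succ]; simp

lemma frameVec_isTangent {k : ℝ} {p : Amb d} (hp : p ∈ Quadric k d) (X : Mink d) :
    IsTangent k p (frameVec k p X) := by
  rw [frameVec_eq_sum]
  exact IsTangent.sum _ fun a _ => ((frame_spec hp).1 a).smul _

lemma metric_frameVec {k : ℝ} {p : Amb d} (hp : p ∈ Quadric k d) (X Y : Mink d) :
    metric k (frameVec k p X) (frameVec k p Y) = eta X Y := by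
  rw [frameVec_eq_sum, frameVec_eq_sum, metric_sum_frame (frame_spec hp), Fin.sum_univ_succ, eta,
    PiLp.inner_apply]
  simp [frameSign, Fin.succ_ne_zero, sub_eq_add_neg, mul_comm]

/-- The linear map of the ambient space that takes the standard basis to `p, e₀, ..., e_d`. -/
def frameMap (k : ℝ) (p : Amb d) : Amb d →ₗ[ℝ] Amb d :=
  (LinearMap.toSpanSingleton ℝ (Amb d) p).coprod (frameVec k p)

lemma frameMap_apply (k : ℝ) (p : Amb d) (z : Amb d) :
    frameMap k p z = z.1 • p + frameVec k p z.2 := by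
  simp [frameMap]

/-- For `k ≠ 0` the map is an isometry of the nondegenerate form `ambForm`. For `k = 0` that form
degenerates; the map is then block triangular, with first entry `p.1 = 1` and an isometry of `eta`
as second diagonal block. -/
lemma det_frameMap_sq {k : ℝ} {p : Amb d} (hp : p ∈ Quadric k d) :
    LinearMap.det (frameMap k p) ^ 2 = 1 := by
  by_cases hk : k = 0
  · subst hk
    have h1 : ∀ X, (frameVec 0 p X).1 = 0 := fun X => fst_eq_zero hp (frameVec_isTangent hp X)
    have h2 := det_lower_triangular (L := frameMap 0 p) LinearMap.id
      (LinearMap.toSpanSingleton ℝ (Mink d) p.2) (LinearMap.snd ℝ _ _ ∘ₗ frameVec 0 p) (fun z => by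
        rw [frameMap_apply]
        refine Prod.ext ?_ ?_
        · simp [fst_eq_one hp, h1]
        · simp)
    rw [h2, LinearMap.det_id, one_mul]
    refine det_sq_eq_one_of_preserves (etaForm_nondegenerate d) fun X Y => ?_
    have := metric_frameVec hp X Y
    rw [metric, h1, h1] at this
    simpa [etaForm_apply] using this
  · refine det_sq_eq_one_of_preserves (ambForm_nondegenerate d hk) fun z w => ?_
    rw [frameMap_apply, frameMap_apply]
    simp only [map_add, map_smul, LinearMap.add_apply, LinearMap.smul_apply, smul_eq_mul]
    rw [ambForm_self hp, isTangent_iff.1 (frameVec_isTangent hp w.2), ambForm_comm k _ p,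
      isTangent_iff.1 (frameVec_isTangent hp z.2), ambForm_eq_mul_metric hk, metric_frameVec hp,
      ambForm_apply]
    ring

/-- Every tangent vector is a combination of the frame. -/
lemma exists_frameVec {k : ℝ} {p v : Amb d} (hp : p ∈ Quadric k d) (hv : IsTangent k p v) :
    ∃ X, v = frameVec k p X := by
  have h : IsUnit (LinearMap.det (frameMap k p)) := by
    rw [isUnit_iff_ne_zero]
    intro h0
    have := det_frameMap_sq hp
    rw [h0] at this; norm_num at this
  obtain ⟨z, hz⟩ := (LinearMap.equivOfIsUnitDet h).surjective v
  have hz' : frameMap k p z = v := by simpa using hz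
  rw [frameMap_apply] at hz'
  have h0 : z.1 • p + frameVec k p z.2 = (0 : ℝ) • p + v := by rw [hz', zero_smul, zero_add]
  exact ⟨z.2, (eq_of_smul_add_tangent hp (frameVec_isTangent hp _) hv h0).2.symm⟩

lemma sum_frame {k : ℝ} {p v : Amb d} (hp : p ∈ Quadric k d) (hv : IsTangent k p v) :
    ∑ a, (frameSign a * metric k v (frame k p a)) • frame k p a = v := by
  obtain ⟨X, rfl⟩ := exists_frameVec hp hv
  rw [frameVec_eq_sum]
  refine Finset.sum_congr rfl fun a _ => ?_
  congr 1
  have h : metric k (frame k p a) (frame k p a) = frameSign a := by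
    rw [(frame_spec hp).2.1 a a]; simp [frameSign]
  rw [← metricForm_apply, map_sum, LinearMap.sum_apply, Finset.sum_eq_single a]
  · rw [map_smul, LinearMap.smul_apply, metricForm_apply, h, smul_eq_mul]
    linear_combination ((Fin.cons X.1 (fun i => X.2 i) : Fin (d + 1) → ℝ) a) * frameSign_sq a
  · intro b _ hb
    rw [map_smul, LinearMap.smul_apply, metricForm_apply, (frame_spec hp).2.1, if_neg hb, smul_zero]
  · simp

lemma metric_unitFuture {k : ℝ} {p : Amb d} (hp : p ∈ Quadric k d)
    (y : EuclideanSpace ℝ (Fin d)) : metric k (unitFuture k p y) (unitFuture k p y) = 1 := by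
  rw [unitFuture_eq, metric_frameVec hp, eta]
  simp only [real_inner_self_eq_norm_sq]
  rw [Real.mul_self_sqrt (by positivity)]; ring

lemma unitFuture_isTangent {k : ℝ} {p : Amb d} (hp : p ∈ Quadric k d)
    (y : EuclideanSpace ℝ (Fin d)) : IsTangent k p (unitFuture k p y) := by
  rw [unitFuture_eq]; exact frameVec_isTangent hp _

lemma contDiff_unitFuture (k : ℝ) (p : Amb d) : ContDiff ℝ ∞ (unitFuture k p) := by
  have h : ContDiff ℝ ∞ fun y : EuclideanSpace ℝ (Fin d) => √(1 + ‖y‖ ^ 2) :=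
    (contDiff_const.add (contDiff_norm_sq ℝ)).sqrt fun y => by positivity
  exact (frameVec k p).toContinuousLinearMap.contDiff.comp (h.prodMk contDiff_id)

/-- Deform `y` to `0` along `t • y`: the vector stays unit timelike, so the sign is that of the
frame vector `frame k p 0`. -/
lemma timeComponent_unitFuture_pos {k : ℝ} {p : Amb d} (hp : p ∈ Quadric k d)
    (y : EuclideanSpace ℝ (Fin d)) : 0 < timeComponent k p (unitFuture k p y) := by
  have h := pos_of_ne_zero_of_continuous
    (f := fun t : ℝ => timeComponent k p (unitFuture k p (t • y)))
    ((continuous_timeComponent k).comp (continuous_const.prodMk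
      ((contDiff_unitFuture k p).continuous.comp (continuous_id.smul continuous_const))))
    (fun t => timeComponent_ne_zero hp (unitFuture_isTangent hp _)
      (by rw [metric_unitFuture hp]; norm_num)) (by
      simpa [unitFuture] using (frame_spec hp).2.2) 1
  simpa using h

/-- The norm condition fixes the frame coordinate `X.1` up to sign. The negative sign would make the
vector `-r` times a unit future vector, against the time orientation. -/
lemma exists_unitFuture {k : ℝ} {p v : Amb d} (hp : p ∈ Quadric k d) (hv : IsTangent k p v)
    {r : ℝ} (hr : 0 < r) (hm : metric k v v = r ^ 2) (ht : 0 < timeComponent k p v) :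
    ∃ y, v = r • unitFuture k p y := by
  obtain ⟨X, rfl⟩ := exists_frameVec hp hv
  rw [metric_frameVec hp, eta, real_inner_self_eq_norm_sq] at hm
  have hsq : |X.1| = r * √(1 + ‖r⁻¹ • X.2‖ ^ 2) := by
    rw [norm_smul, norm_inv, Real.norm_of_nonneg hr.le, ← abs_of_pos hr,
      ← Real.sqrt_sq_eq_abs, ← Real.sqrt_sq_eq_abs, ← Real.sqrt_mul (sq_nonneg _)]
    congr 1
    rw [Real.sqrt_sq hr.le]; field_simp; linarith
  rcases abs_choice X.1 with h | h
  · refine ⟨r⁻¹ • X.2, ?_⟩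
    rw [unitFuture_eq, ← map_smul, Prod.smul_mk, smul_eq_mul, ← hsq, h, smul_smul,
      mul_inv_cancel₀ hr.ne', one_smul]
  · exfalso
    have e : frameVec k p X = (-r) • unitFuture k p (-(r⁻¹ • X.2)) := by
      rw [unitFuture_eq, ← map_smul, Prod.smul_mk, smul_eq_mul, norm_neg, neg_mul, ← hsq, h,
        smul_neg, neg_smul, smul_smul, mul_inv_cancel₀ hr.ne', one_smul, neg_neg, neg_neg]
    rw [e, timeComponent_smul] at ht
    nlinarith [timeComponent_unitFuture_pos hp (-(r⁻¹ • X.2))]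

end

/-! ### Spinor algebra: parallel transport and the Dirac operator on kernels. -/

section

variable {S : Type*} [NormedAddCommGroup S] [NormedSpace ℂ S]

/-! ### Clifford multiplication -/

lemma cliff_add_right (C : CliffordModule d S) (k : ℝ) (p v u : Amb d) :
    cliff C k p (v + u) = cliff C k p v + cliff C k p u := by
  simp only [cliff, Prod.fst_add, Prod.snd_add, map_add, Complex.ofReal_add, add_mul, mul_add]
  module

lemma cliff_smul_right (C : CliffordModule d S) (k : ℝ) (p v : Amb d) (c : ℝ) :
    cliff C k p (c • v) = c • cliff C k p v := by
  simp only [cliff, Prod.smul_fst, Prod.smul_snd, map_smul, smul_eq_mul, Complex.ofReal_mul,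
    smul_mul_assoc, mul_smul_comm, ← Complex.coe_smul]
  module

/-- Clifford multiplication depends only on the bivector `p ∧ v`. Hence the second argument may be
changed by multiples of `p`, and `cliff C k p q` makes sense for a second point `q` of the
pseudosphere. -/
lemma cliff_swap (C : CliffordModule d S) (k : ℝ) (p v : Amb d) :
    cliff C k v p = -cliff C k p v := by
  simp only [cliff]; module

lemma cliff_self (C : CliffordModule d S) (k : ℝ) (p : Amb d) : cliff C k p p = 0 := by
  simp only [cliff]; module

/-- Clifford multiplication as a bilinear map. -/
def cliffBilin (C : CliffordModule d S) (k : ℝ) : Amb d →ₗ[ℝ] Amb d →ₗ[ℝ] (S →L[ℂ] S) :=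
  LinearMap.mk₂ ℝ (cliff C k)
    (fun p q v => by
      rw [cliff_swap C k v, cliff_add_right, cliff_swap C k v p, cliff_swap C k v q]; abel)
    (fun c p v => by rw [cliff_swap C k v, cliff_smul_right, cliff_swap C k v p, smul_neg])
    (fun p v u => cliff_add_right C k p v u) (fun c p v => cliff_smul_right C k p v c)

lemma cliffBilin_apply (C : CliffordModule d S) (k : ℝ) (p v : Amb d) :
    cliffBilin C k p v = cliff C k p v := rfl

lemma cliff_anticomm (C : CliffordModule d S) {k : ℝ} {p v u : Amb d} (hp : p ∈ Quadric k d)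
    (hv : IsTangent k p v) (hu : IsTangent k p u) :
    cliff C k p v * cliff C k p u
      = (2 * (metric k v u : ℂ)) • (1 : S →L[ℂ] S) - cliff C k p u * cliff C k p v := by
  have h := cliff_sq C hp (hv.add hu)
  have e : metric k (v + u) (v + u) = metric k v v + 2 * metric k v u + metric k u u := by
    simp only [← metricForm_apply, map_add, LinearMap.add_apply]
    rw [metricForm_apply k u v, metric_comm, ← metricForm_apply]; ring
  rw [cliff_add_right, mul_add, add_mul, add_mul, cliff_sq C hp hv, cliff_sq C hp hu, e] at h
  push_cast at h
  rw [eq_sub_iff_add_eq]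
  have h2 : cliff C k p v * cliff C k p u + cliff C k p u * cliff C k p v =
      ((metric k v v + 2 * metric k v u + metric k u u : ℂ)) • (1 : S →L[ℂ] S)
        - (metric k v v : ℂ) • (1 : S →L[ℂ] S) - (metric k u u : ℂ) • (1 : S →L[ℂ] S) := by
    rw [← h]; abel
  rw [h2]; module

/-- The passage from `(p, v)` to position and velocity at time `t` is a linear change in the plane
they span, of determinant `cs² + a sn² = 1` with `a = k g(v, v)`, so the bivector is unchanged. The
connection form is therefore constant along the geodesic. -/
lemma cliff_geod (C : CliffordModule d S) (k : ℝ) (p v : Amb d) (t : ℝ) :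
    cliff C k (geod k p v t) (geodVel k p v t) = cliff C k p v := by
  have h := cs_sq_add (k * metric k v v) t
  simp only [geod, geodVel, ← cliffBilin_apply, map_add, map_smul, LinearMap.add_apply,
    LinearMap.smul_apply]
  simp only [cliffBilin_apply, cliff_self, cliff_swap C k p v, smul_zero, zero_add, add_zero,
    smul_neg, smul_smul, ← neg_smul, ← add_smul]
  conv_rhs => rw [← one_smul ℝ (cliff C k p v), ← h]
  congr 1; ring

/-! ### Parallel transport -/

/-- The parallel transport from `exp_p (r u)` to `p`, for a unit timelike vector `u`. -/
def lamOp (C : CliffordModule d S) (k : ℝ) (p u : Amb d) (r : ℝ) : S →L[ℂ] S :=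
  (cs k (r / 2) : ℂ) • (1 : S →L[ℂ] S) + (Complex.I * sqrtC k * (sn k (r / 2) : ℂ)) • cliff C k p u

lemma lamOp_zero (C : CliffordModule d S) (k : ℝ) (p u : Amb d) : lamOp C k p u 0 = 1 := by
  simp [lamOp, cs_zero, sn_zero]

lemma hasDerivAt_ofReal_comp_mul {f : ℝ → ℝ} {f' c t : ℝ} (h : HasDerivAt f f' (c * t)) :
    HasDerivAt (fun t => (f (c * t) : ℂ)) (f' * c : ℝ) t :=
  (h.comp t (by simpa using (hasDerivAt_id t).const_mul c)).ofReal_comp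

lemma I_sqrtC_sq (k : ℝ) : Complex.I * sqrtC k * (Complex.I * sqrtC k) = -(k : ℂ) := by
  linear_combination (Complex.I * Complex.I) * sqrtC_mul_self k + (k : ℂ) * Complex.I_mul_I

/-- Since `U = cliff C k p u` satisfies `U² = 1`, the operator `lamOp C k p u r` is the exponential
of `(iκ r / 2) U` with `κ = sqrtC k`, written with half angles. So `t ↦ lamOp C k p u (r * t)`
solves the linear equation whose coefficient is the constant connection form; the second term is the
product rule for a moving spinor. -/
lemma hasDerivAt_lamOp_apply (C : CliffordModule d S) {k : ℝ} {p u : Amb d}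
    (hp : p ∈ Quadric k d) (hu : IsTangent k p u) (hu1 : metric k u u = 1) (r : ℝ) {Ψ : ℝ → S}
    {Ψ' : S} {t : ℝ} (hΨ : HasDerivAt Ψ Ψ' t) :
    HasDerivAt (fun t => lamOp C k p u (r * t) (Ψ t))
      (spinConn C k p (r • u) (lamOp C k p u (r * t) (Ψ t)) + lamOp C k p u (r * t) Ψ') t := by
  have hU : ∀ s, cliff C k p u (cliff C k p u s) = s := fun s => by
    have := congrArg (fun T : S →L[ℂ] S => T s) (cliff_sq C hp hu)
    simpa [hu1] using this
  have e : ∀ (t : ℝ) (s : S), lamOp C k p u (r * t) s = (cs k (r / 2 * t) : ℂ) • s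
      + (Complex.I * sqrtC k * (sn k (r / 2 * t) : ℂ)) • cliff C k p u s := fun t s => by
    simp [lamOp, show r * t / 2 = r / 2 * t by ring]
  have hc := hasDerivAt_ofReal_comp_mul (c := r / 2) (cs_hasDerivAt k (r / 2 * t))
  have hs := (hasDerivAt_ofReal_comp_mul (c := r / 2) (sn_hasDerivAt k (r / 2 * t))).const_mul
    (Complex.I * sqrtC k)
  have hUΨ : HasDerivAt (fun t => cliff C k p u (Ψ t)) (cliff C k p u Ψ') t :=
    ((cliff C k p u).restrictScalars ℝ).hasFDerivAt.comp_hasDerivAt t hΨ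
  have h := (hc.smul hΨ).add (hs.smul hUΨ)
  simp only [e]
  refine h.congr_deriv ?_
  rw [spinConn, cliff_smul_right, ← Complex.coe_smul]
  simp only [smul_apply, map_add, map_smul, hU]
  push_cast
  match_scalars <;>
    first | ring1 | linear_combination (-(sn k (r / 2 * t) * r / 2) : ℂ) * I_sqrtC_sq k

lemma transport_eq (C : CliffordModule d S) {k : ℝ} {p u : Amb d} (hp : p ∈ Quadric k d)
    (hu : IsTangent k p u) (hu1 : metric k u u = 1) (r : ℝ) (s : S) :
    transport C k p (r • u) s = lamOp C k p u r s := by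
  have hconn : ∀ t, spinConn C k (geod k p (r • u) t) (geodVel k p (r • u) t)
      = spinConn C k p (r • u) := fun t => by rw [spinConn, cliff_geod, ← spinConn]
  have hcomm : ∀ t s, spinConn C k p (r • u) (lamOp C k p u t s)
      = lamOp C k p u t (spinConn C k p (r • u) s) := fun t s => by
    simp only [spinConn, cliff_smul_right, lamOp, ← Complex.coe_smul,
      smul_apply, add_apply, map_add, map_smul,
      one_apply_eq_self]
    module
  have hex : ∃ s₀, ∃ Ψ : ℝ → S,
      (∀ t, HasDerivAt Ψ
        (-(spinConn C k (geod k p (r • u) t) (geodVel k p (r • u) t) (Ψ t))) t) ∧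
      Ψ 1 = s ∧ Ψ 0 = s₀ := by
    -- A solution must be exhibited before anything can be said about the value that
    -- `Classical.epsilon` selects.
    refine ⟨_, fun t => lamOp C k p u (r * (1 - t)) s, fun t => ?_, ?_, rfl⟩
    · have h := hasDerivAt_lamOp_apply C hp hu hu1 r (hasDerivAt_const (1 - t) s)
      have h2 := h.scomp t ((hasDerivAt_id t).const_sub 1)
      rw [hconn]
      refine h2.congr_deriv ?_
      simp
    · simp [lamOp_zero]
  obtain ⟨Ψ, h1, h2, h3⟩ := Classical.epsilon_spec hex
  -- Uniqueness: the exponential is an integrating factor for every solution. Comparing times `0`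
  -- and `1` identifies the selected value.
  have h4 : ∀ t, HasDerivAt (fun t => lamOp C k p u (r * t) (Ψ t)) 0 t := fun t => by
    refine (hasDerivAt_lamOp_apply C hp hu hu1 r (h1 t)).congr_deriv ?_
    rw [hconn, map_neg, hcomm]; simp
  have h5 := is_const_of_deriv_eq_zero (fun t => (h4 t).differentiableAt) (fun t => (h4 t).deriv)
    0 1
  simp only [mul_zero, mul_one, lamOp_zero, one_apply_eq_self, h2, h3] at h5
  exact h5

/-! ### The Dirac operator on radial kernels -/

/-- The operator `A(σ) + B(σ) (p ∧ q)` from the fibre at `q` to the fibre at `p`, where `σ` is the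
squared chord between `p` and `q`. -/
def kernelOp (C : CliffordModule d S) (k : ℝ) (A B : ℝ → ℂ) (p q : Amb d) : S →L[ℂ] S :=
  A (chord k p q) • (1 : S →L[ℂ] S) + B (chord k p q) • cliff C k p q

lemma cliff_tanPart (C : CliffordModule d S) (k : ℝ) (p q : Amb d) :
    cliff C k p (tanPart k p q) = cliff C k p q := by
  rw [tanPart, ← cliffBilin_apply, map_sub, map_smul, cliffBilin_apply, cliffBilin_apply,
    cliff_self, smul_zero, sub_zero]

lemma metric_tanPart_left {k : ℝ} {p v : Amb d} (q : Amb d) (hv : IsTangent k p v) :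
    metric k (tanPart k p q) v = metric k (q - p) v := by
  have h := mul_metric_tangent hv
  have e : tanPart k p q = (q - p) + (k / 2 * chord k p q) • p := by rw [tanPart]; module
  rw [e]
  simp only [← metricForm_apply, map_add, map_smul, LinearMap.add_apply, LinearMap.smul_apply,
    smul_eq_mul] at *
  linear_combination (chord k p q / 2) * h

lemma sum_frameSign_smul_cliff (C : CliffordModule d S) {k : ℝ} {p v : Amb d}
    (hp : p ∈ Quadric k d) (hv : IsTangent k p v) :
    ∑ a, ((frameSign a : ℂ) * (metric k v (frame k p a) : ℂ)) • cliff C k p (frame k p a)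
      = cliff C k p v := by
  conv_rhs => rw [← sum_frame hp hv, ← cliffBilin_apply, map_sum]
  refine Finset.sum_congr rfl fun a _ => ?_
  rw [map_smul, cliffBilin_apply, ← Complex.coe_smul]; push_cast; rfl

lemma sum_frameSign_cliff_sq (C : CliffordModule d S) {k : ℝ} {p : Amb d}
    (hp : p ∈ Quadric k d) :
    ∑ a, (frameSign a : ℂ) • (cliff C k p (frame k p a) * cliff C k p (frame k p a))
      = ((d : ℂ) + 1) • (1 : S →L[ℂ] S) := by
  have : ∀ a, (frameSign a : ℂ) • (cliff C k p (frame k p a) * cliff C k p (frame k p a))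
      = (1 : S →L[ℂ] S) := fun a => by
    rw [cliff_sq C hp ((frame_spec hp).1 a), smul_smul, (frame_spec hp).2.1 a a, if_pos rfl,
      ← Complex.ofReal_mul]
    change ((frameSign a * frameSign a : ℝ) : ℂ) • _ = _
    rw [frameSign_sq]; simp
  rw [Finset.sum_congr rfl fun a _ => this a, Finset.sum_const, Finset.card_univ, Fintype.card_fin]
  rw [← Nat.cast_smul_eq_nsmul ℂ]; push_cast; rfl

/-- The contraction of a vector between two frame vectors has the factor `2 - n` with `n = d + 1`:
moving one frame vector past `v` gives `2 v` from the anticommutator and `-n v` from the squares. -/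
lemma sum_frameSign_conj (C : CliffordModule d S) {k : ℝ} {p v : Amb d}
    (hp : p ∈ Quadric k d) (hv : IsTangent k p v) :
    ∑ a, (frameSign a : ℂ) •
        (cliff C k p (frame k p a) * (cliff C k p v * cliff C k p (frame k p a)))
      = (1 - (d : ℂ)) • cliff C k p v := by
  have : ∀ a, (frameSign a : ℂ) •
        (cliff C k p (frame k p a) * (cliff C k p v * cliff C k p (frame k p a)))
      = (2 : ℂ) • (((frameSign a : ℂ) * (metric k v (frame k p a) : ℂ)) •
          cliff C k p (frame k p a))
        - ((frameSign a : ℂ) • (cliff C k p (frame k p a) * cliff C k p (frame k p a)))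
          * cliff C k p v := fun a => by
    rw [cliff_anticomm C hp hv ((frame_spec hp).1 a), mul_sub, mul_smul_comm, mul_one,
      ← mul_assoc, smul_sub, smul_mul_assoc]
    module
  rw [Finset.sum_congr rfl fun a _ => this a, Finset.sum_sub_distrib, ← Finset.smul_sum,
    ← Finset.sum_mul, sum_frameSign_smul_cliff C hp hv, sum_frameSign_cliff_sq C hp,
    smul_mul_assoc, one_mul]
  module

/-- This is the contribution of differentiating `p ∧ q` in `p`. Split `q` into `(1 - k σ / 2) p` and
its tangential part: the first piece gives the squares of the frame vectors, and for the second
`cliff_parallel` replaces the derivative by a commutator with the connection form. -/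
lemma sum_frameSign_cliff_left (C : CliffordModule d S) {k : ℝ} {p q : Amb d}
    (hp : p ∈ Quadric k d) (hq : q ∈ Quadric k d) :
    ∑ a, (frameSign a : ℂ) • (cliff C k p (frame k p a) * cliff C k (frame k p a) q)
      = (-((d : ℂ) + 1) * (1 - k / 2 * chord k p q)) • (1 : S →L[ℂ] S)
        - (Complex.I * sqrtC k * d) • cliff C k p q := by
  have hτ := tanPart_isTangent hp hq
  have hX := cliff_tanPart C k p q
  have : ∀ a, (frameSign a : ℂ) • (cliff C k p (frame k p a) * cliff C k (frame k p a) q)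
      = (-(1 - k / 2 * chord k p q) : ℂ) •
          ((frameSign a : ℂ) • (cliff C k p (frame k p a) * cliff C k p (frame k p a)))
        - (Complex.I * sqrtC k / 2) •
          (((frameSign a : ℂ) • (cliff C k p (frame k p a) * cliff C k p (frame k p a)))
              * cliff C k p q)
        + (Complex.I * sqrtC k / 2) • ((frameSign a : ℂ) •
          (cliff C k p (frame k p a) * (cliff C k p q * cliff C k p (frame k p a)))) := fun a => by
    have h1 := cliff_parallel C hp ((frame_spec hp).1 a) hτ
    have e : q = (1 - k / 2 * chord k p q) • p + tanPart k p q := by rw [tanPart]; abel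
    have h2 : cliff C k (frame k p a) q = (-(1 - k / 2 * chord k p q) : ℝ) •
        cliff C k p (frame k p a) + cliff C k (frame k p a) (tanPart k p q) := by
      conv_lhs => rw [e]
      rw [cliff_add_right, cliff_smul_right, cliff_swap C k p (frame k p a), smul_neg, neg_smul]
    rw [h2, eq_neg_of_add_eq_zero_left h1, hX, spinConn, ← Complex.coe_smul]
    simp only [mul_add, mul_neg, mul_sub, smul_mul_assoc, mul_smul_comm, mul_assoc]
    push_cast
    module
  rw [Finset.sum_congr rfl fun a _ => this a, Finset.sum_add_distrib, Finset.sum_sub_distrib,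
    ← Finset.smul_sum, ← Finset.smul_sum, ← Finset.smul_sum, ← Finset.sum_mul,
    sum_frameSign_cliff_sq C hp, ← hX, sum_frameSign_conj C hp hτ, smul_mul_assoc, one_mul]
  module

/-- The Dirac operator maps the radial kernel `A + B (p ∧ q)` to a radial kernel. -/
lemma sum_dirac_kernel (C : CliffordModule d S) {k : ℝ} {p q : Amb d}
    (hp : p ∈ Quadric k d) (hq : q ∈ Quadric k d) (a b a' b' : ℂ) :
    ∑ i, (frameSign i : ℂ) • (cliff C k p (frame k p i) *
        ((a' * (-2 * metric k (q - p) (frame k p i) : ℝ)) • (1 : S →L[ℂ] S)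
          + ((b' * (-2 * metric k (q - p) (frame k p i) : ℝ)) • cliff C k p q
            + b • cliff C k (frame k p i) q)
          + spinConn C k p (frame k p i) * (a • (1 : S →L[ℂ] S) + b • cliff C k p q)))
      = (Complex.I * sqrtC k * (d + 1) / 2 * a
          - 2 * (chord k p q * (1 - k / 4 * chord k p q)) * b'
          - (d + 1) * (1 - k / 2 * chord k p q) * b) • (1 : S →L[ℂ] S)
        + (-2 * a' + Complex.I * sqrtC k * (1 - d) / 2 * b) • cliff C k p q := by
  have hτ := tanPart_isTangent hp hq
  have hX := cliff_tanPart C k p q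
  have hXX : cliff C k p q * cliff C k p q
      = ((chord k p q * (1 - k / 4 * chord k p q) : ℝ) : ℂ) • (1 : S →L[ℂ] S) := by
    rw [← hX, cliff_sq C hp hτ, metric_tanPart hp hq]
  have h1 := sum_frameSign_smul_cliff C hp hτ
  rw [Finset.sum_congr rfl fun i _ => by
    rw [metric_tanPart_left q ((frame_spec hp).1 i)], hX] at h1
  -- Three contributions: the gradient of the squared chord, which sums to a multiple of `p ∧ q`;
  -- the derivative of `p ∧ q`; and the connection form, in which the frame vectors square away.
  have : ∀ i, (frameSign i : ℂ) • (cliff C k p (frame k p i) *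
        ((a' * (-2 * metric k (q - p) (frame k p i) : ℝ)) • (1 : S →L[ℂ] S)
          + ((b' * (-2 * metric k (q - p) (frame k p i) : ℝ)) • cliff C k p q
            + b • cliff C k (frame k p i) q)
          + spinConn C k p (frame k p i) * (a • (1 : S →L[ℂ] S) + b • cliff C k p q)))
      = (((frameSign i : ℂ) * (metric k (q - p) (frame k p i) : ℂ)) • cliff C k p (frame k p i))
          * ((-2 * a') • (1 : S →L[ℂ] S) + (-2 * b') • cliff C k p q)
        + b • ((frameSign i : ℂ) • (cliff C k p (frame k p i) * cliff C k (frame k p i) q))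
        + ((frameSign i : ℂ) • (cliff C k p (frame k p i) * cliff C k p (frame k p i)))
          * ((Complex.I * sqrtC k / 2) • (a • (1 : S →L[ℂ] S) + b • cliff C k p q)) := fun i => by
    simp only [spinConn, mul_add, smul_mul_assoc, mul_smul_comm, mul_one, mul_assoc]
    push_cast
    module
  rw [Finset.sum_congr rfl fun i _ => this i, Finset.sum_add_distrib, Finset.sum_add_distrib,
    ← Finset.sum_mul, ← Finset.sum_mul, ← Finset.smul_sum, h1, sum_frameSign_cliff_left C hp hq,
    sum_frameSign_cliff_sq C hp, mul_add, mul_smul_comm, mul_smul_comm, hXX, smul_mul_assoc]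
  push_cast
  simp only [one_mul, mul_one]
  module

end

/-! ### Timelike geodesics: uniqueness, lifts and normal neighbourhoods. -/

section

variable {k : ℝ} {M : Type*} [TopologicalSpace M]

/-! ### Uniqueness of geodesics between timelike separated points -/

/-- The components along `p` and tangent to the pseudosphere are compared separately. For `k ≠ 0`
the first forces `w` to be timelike of the same length as `v`, because the chord is injective on
`radii`; the second then gives `w = v`, as `sn` does not vanish there. For `k = 0` the second
suffices. -/
lemma geod_one_inj {p v w : Amb d} (hp : p ∈ Quadric k d) (hv : IsTangent k p v)
    (hw : IsTangent k p w) {r : ℝ} (hr : r ∈ radii k) (hvr : metric k v v = r ^ 2)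
    (hlen : 0 < k → 0 < metric k w w → √(metric k w w) < Real.pi / √k)
    (h : geod k p w 1 = geod k p v 1) : w = v := by
  obtain ⟨h1, h2⟩ := eq_of_smul_add_tangent hp (hw.smul _) (hv.smul _) h
  have hr0 := radii_pos hr
  have hs := sn_half_pos hr
  have key : cs (k * metric k v v) 1 = 1 - k / 2 * (4 * sn k (r / 2) ^ 2) := by
    rw [hvr, mul_comm k, cs_sq_mul, mul_one, cs_eq_one_sub]
  by_cases hk : k = 0
  · subst hk; simpa [sn] using h2
  -- If `w` is not timelike, its coefficient `cs` is at most `1` for `k < 0` and at least `1` for `k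
  -- > 0`, whereas the timelike `v` gives a value strictly on the other side of `1`.
  have hm : 0 < metric k w w := by
    by_contra hm
    rw [not_lt] at hm
    rw [key] at h1
    rcases lt_or_gt_of_ne hk with hk | hk
    · have h3 : 0 ≤ k * metric k w w := mul_nonneg_of_nonpos_of_nonpos hk.le hm
      simp only [cs, h3, if_true] at h1
      have h4 := Real.cos_le_one (√(k * metric k w w) * 1)
      have : 0 < -k * sn k (r / 2) ^ 2 := mul_pos (by linarith) (by positivity)
      linarith
    · have h3 : k * metric k w w ≤ 0 := mul_nonpos_of_nonneg_of_nonpos hk.le hm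
      have h4 : 1 ≤ cs (k * metric k w w) 1 := by
        rcases h3.eq_or_lt with h5 | h5
        · rw [h5]; simp [cs]
        · simp only [cs, not_le.2 h5, if_false]; exact Real.one_le_cosh _
      have : 0 < k * sn k (r / 2) ^ 2 := by positivity
      linarith
  have hq : √(metric k w w) ∈ radii k := ⟨Real.sqrt_pos.2 hm, fun h' => hlen h' hm⟩
  have hsq : metric k w w = √(metric k w w) ^ 2 := (Real.sq_sqrt hm.le).symm
  set r' := √(metric k w w)
  have hrr : r' = r := by
    rw [key, hsq, mul_comm k, cs_sq_mul, mul_one, cs_eq_one_sub] at h1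
    have h3 : 4 * sn k (r' / 2) ^ 2 = 4 * sn k (r / 2) ^ 2 := by
      have h4 : k / 2 ≠ 0 := by simpa using hk
      exact mul_left_cancel₀ h4 (by linarith)
    rw [← rad_chord hq, h3, rad_chord hr]
  rw [hsq, hrr, hvr] at h2
  refine smul_right_injective _ ?_ h2
  have h5 : r * sn (k * r ^ 2) 1 = sn k r := by rw [mul_comm k, sn_sq_mul, mul_one]
  intro h6
  rw [h6, mul_zero] at h5
  exact (sn_pos hr).ne h5

lemma geod_antipode (hk : 0 < k) (p : Amb d) {v : Amb d}
    (hv : metric k v v = (Real.pi / √k) ^ 2) : geod k p v 1 = -p := by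
  have h0 : 0 < √k := Real.sqrt_pos.2 hk
  have h1 : √k * (Real.pi / √k * 1) = Real.pi := by field_simp
  rw [geod_timelike p (by positivity) hv]
  simp only [cs, sn, hk, hk.le, if_true, h1]
  simp

/-! ### Lifts of timelike geodesics to the covering -/

/-- The timelike tangent vectors of `M`. -/
abbrev TimelikeVec (proj : M → Quadric k d) : Type _ :=
  {a : M × Amb d // IsTangent k (proj a.1 : Amb d) a.2 ∧ 0 < metric k a.2 a.2}

lemma continuous_metric (k : ℝ) : Continuous fun z : Amb d × Amb d => metric k z.1 z.2 := by
  unfold metric eta; fun_prop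

/-- The functions `cs` and `sn` are defined by cases in their parameter `k g(v, v)`. For timelike
`v`, homogeneity moves the variable length into the time argument, and only the continuity of `cs k`
and `sn k` is needed. -/
lemma continuous_geod_timelike {X : Type*} [TopologicalSpace X] {p v : X → Amb d} {t : X → ℝ}
    (hp : Continuous p) (hv : Continuous v) (ht : Continuous t)
    (h : ∀ x, 0 < metric k (v x) (v x)) : Continuous fun x => geod k (p x) (v x) (t x) := by
  have hm : Continuous fun x => √(metric k (v x) (v x)) :=
    Real.continuous_sqrt.comp ((continuous_metric k).comp (hv.prodMk hv))
  have e : (fun x => geod k (p x) (v x) (t x)) = fun x =>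
      cs k (√(metric k (v x) (v x)) * t x) • p x
        + (sn k (√(metric k (v x) (v x)) * t x) / √(metric k (v x) (v x))) • v x := by
    funext x
    exact geod_timelike _ (Real.sqrt_pos.2 (h x)) (Real.sq_sqrt (h x).le).symm _
  rw [e]
  refine (((continuous_cs k).comp (hm.mul ht)).smul hp).add
    ((((continuous_sn k).comp (hm.mul ht)).div hm fun x => ?_).smul hv)
  exact (Real.sqrt_pos.2 (h x)).ne'

variable {proj : M → Quadric k d}

/-- The geodesics with timelike initial velocity, on the time interval `[0, 1]`. -/
def geodHomotopy (hproj : IsCoveringMap proj) :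
    C(unitInterval × TimelikeVec proj, Quadric k d) where
  toFun z := ⟨geod k (proj z.2.1.1) z.2.1.2 z.1, geod_mem (proj z.2.1.1).2 z.2.2.1 z.1⟩
  continuous_toFun := by
    have h1 : Continuous fun z : unitInterval × TimelikeVec proj => z.2.1 :=
      continuous_subtype_val.comp continuous_snd
    refine Continuous.subtype_mk (continuous_geod_timelike
      (continuous_subtype_val.comp (hproj.continuous.comp (continuous_fst.comp h1)))
      (continuous_snd.comp h1) (continuous_subtype_val.comp continuous_fst) fun z => z.2.2.2) _

/-- The lifts of the geodesics with timelike initial velocity. -/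
def geodLift (hproj : IsCoveringMap proj) : C(unitInterval × TimelikeVec proj, M) :=
  hproj.liftHomotopy (geodHomotopy hproj)
    ⟨fun a => a.1.1, continuous_fst.comp continuous_subtype_val⟩
    (fun _ => Subtype.ext (geod_zero k _ _))

lemma geodLift_zero (hproj : IsCoveringMap proj) (a : TimelikeVec proj) :
    geodLift hproj (0, a) = a.1.1 :=
  hproj.liftHomotopy_zero _ _ _ a

lemma proj_geodLift (hproj : IsCoveringMap proj) (t : unitInterval) (a : TimelikeVec proj) :
    (proj (geodLift hproj (t, a)) : Amb d) = geod k (proj a.1.1) a.1.2 t :=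
  congrArg Subtype.val (congrFun (hproj.liftHomotopy_lifts (geodHomotopy hproj) _ _) (t, a))

open Classical in
/-- The end point of the geodesic `[0, 1] → M` from `x` with timelike initial velocity `v`. -/
def geodEnd (hproj : IsCoveringMap proj) (x : M) (v : Amb d) : M :=
  if h : IsTangent k (proj x : Amb d) v ∧ 0 < metric k v v then geodLift hproj (1, ⟨(x, v), h⟩)
  else x

lemma geodEnd_eq (hproj : IsCoveringMap proj) {x : M} {v : Amb d}
    (h : IsTangent k (proj x : Amb d) v ∧ 0 < metric k v v) :
    geodEnd hproj x v = geodLift hproj (1, ⟨(x, v), h⟩) := dif_pos h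

lemma proj_geodEnd (hproj : IsCoveringMap proj) {x : M} {v : Amb d}
    (h : IsTangent k (proj x : Amb d) v ∧ 0 < metric k v v) :
    (proj (geodEnd hproj x v) : Amb d) = geod k (proj x) v 1 := by
  rw [geodEnd_eq hproj h, proj_geodLift]; rfl

lemma continuous_geodEnd (hproj : IsCoveringMap proj) {X : Type*} [TopologicalSpace X]
    {x : X → M} {v : X → Amb d} (hx : Continuous x) (hv : Continuous v)
    (h : ∀ z, IsTangent k (proj (x z) : Amb d) (v z) ∧ 0 < metric k (v z) (v z)) :
    Continuous fun z => geodEnd hproj (x z) (v z) := by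
  have e : (fun z => geodEnd hproj (x z) (v z)) =
      fun z => geodLift hproj (1, (⟨(x z, v z), h z⟩ : TimelikeVec proj)) :=
    funext fun z => geodEnd_eq hproj (h z)
  rw [e]
  exact (geodLift hproj).continuous.comp
    (continuous_const.prodMk (Continuous.subtype_mk (hx.prodMk hv) _))

/-- The segment and `geodLift` are lifts of the same curve with the same initial point, so
uniqueness of lifts applies. The end point therefore does not depend on Ω. -/
lemma GeodSeg.geodLift_eq (hproj : IsCoveringMap proj) {Ω : Set M} {x x' : M} {v : Amb d}
    (hm : 0 < metric k v v) (h : GeodSeg proj Ω x v x') :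
    geodEnd hproj x v = x' := by
  obtain ⟨hv, c, hc, h0, h1, hg⟩ := h
  rw [geodEnd_eq hproj ⟨hv, hm⟩]
  have hc' : Continuous fun t : unitInterval => c t :=
    continuousOn_iff_continuous_domRestrict.1 hc
  have := hproj.eq_of_comp_eq (g₁ := fun t : unitInterval => geodLift hproj (t, ⟨(x, v), hv, hm⟩))
    (g₂ := fun t : unitInterval => c t)
    ((geodLift hproj).continuous.comp (continuous_id.prodMk continuous_const)) hc'
    (funext fun t => Subtype.ext ((proj_geodLift hproj t _).trans (hg t t.2).2.symm)) 0
    ((geodLift_zero hproj _).trans h0.symm)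
  exact (congrFun this 1).trans h1

lemma geodSeg_univ (hproj : IsCoveringMap proj) {x : M} {v : Amb d}
    (hv : IsTangent k (proj x : Amb d) v) (hm : 0 < metric k v v) :
    GeodSeg proj Set.univ x v (geodEnd hproj x v) := by
  refine ⟨hv, fun t => geodLift hproj (Set.projIcc 0 1 zero_le_one t, ⟨(x, v), hv, hm⟩), ?_, ?_, ?_,
    fun t ht => ⟨trivial, ?_⟩⟩
  · exact ((geodLift hproj).continuous.comp
      (continuous_projIcc.prodMk continuous_const)).continuousOn
  · simp only [Set.projIcc_left]; exact geodLift_zero hproj _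
  · simp only [Set.projIcc_right, geodEnd_eq hproj ⟨hv, hm⟩]; rfl
  · rw [proj_geodLift, Set.projIcc_of_mem zero_le_one ht]

/-! ### Normal neighbourhoods -/

lemma SmoothAt.continuousAt {W : Type*} [NormedAddCommGroup W] [NormedSpace ℝ W]
    (hproj : Continuous proj) {ψ : M → W} {x : M} (h : SmoothAt proj ψ x) : ContinuousAt ψ x := by
  obtain ⟨F, hF, hψ⟩ := h
  exact (ContinuousAt.comp (f := fun z => (proj z : Amb d)) hF.continuousAt
    (continuous_subtype_val.comp hproj).continuousAt).congr
    (hψ.mono fun z hz => hz.symm)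

/-- Two maps that are continuous at a point, agree there and have the same projection agree
near the point. -/
lemma eventually_eq_of_proj_eq (hproj : IsCoveringMap proj) {X : Type*} [TopologicalSpace X]
    {l : Filter X} {f g : X → M} {y : M} (hf : Filter.Tendsto f l (𝓝 y))
    (hg : Filter.Tendsto g l (𝓝 y)) (h : ∀ᶠ z in l, proj (f z) = proj (g z)) :
    ∀ᶠ z in l, f z = g z := by
  obtain ⟨U, hU, hy, hinj⟩ := hproj.isLocalHomeomorph.isLocallyInjective y
  filter_upwards [hf (hU.mem_nhds hy), hg (hU.mem_nhds hy), h] with z h1 h2 h3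
  exact hinj h1 h2 h3

/-- In a normal neighbourhood of `x`, the geodesics from `x` are those of the exponential map. -/
lemma mem_of_geodSeg (hproj : IsCoveringMap proj) {Ω : Set M} {x : M} {U : Set (Amb d)}
    {e : Amb d → M} {L : M → Amb d}
    (hU : ∃ O : Set (Amb d), IsOpen O ∧ U = {v ∈ O | IsTangent k (proj x : Amb d) v})
    (h0 : 0 ∈ U) (hec : ContinuousOn e U) (he0 : e 0 = x)
    (hpe : ∀ v ∈ U, (proj (e v) : Amb d) = geod k (proj x) v 1) (hbij : Set.BijOn e U Ω)
    (hLe : ∀ v ∈ U, L (e v) = v) (hL : ∀ x' ∈ Ω, SmoothAt proj L x') {v : Amb d} {x' : M}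
    (h : GeodSeg proj Ω x v x') : v ∈ U ∧ e v = x' := by
  obtain ⟨hv, c, hc, hc0, hc1, hg⟩ := h
  obtain ⟨O, hO, hUO⟩ := hU
  have hc' : Continuous fun t : unitInterval => c t := continuousOn_iff_continuous_domRestrict.1 hc
  have hLc : Continuous fun t : unitInterval => L (c t) := continuous_iff_continuousAt.2 fun t =>
    ContinuousAt.comp (f := fun t : unitInterval => c t)
      ((hL _ (hg t t.2).1).continuousAt hproj.continuous) hc'.continuousAt
  have hmem : ∀ t : unitInterval, L (c t) ∈ U ∧ e (L (c t)) = c t := fun t => by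
    obtain ⟨w, hw, hwc⟩ := hbij.surjOn (hg t t.2).1
    rw [← hwc, hLe w hw]; exact ⟨hw, rfl⟩
  -- The times at which the segment is still given by the exponential map. The set is closed by
  -- continuity; it is open because `c` and `t ↦ e (t • v)` have the same projection near such a
  -- time and meet there. It contains `0`, hence also `1`.
  have hcl : IsClopen {t : unitInterval | L (c t) = (t : ℝ) • v} := by
    refine ⟨isClosed_eq hLc (by fun_prop), isOpen_iff_mem_nhds.2 fun t₀ ht₀ => ?_⟩
    have ht₀' : L (c t₀) = (t₀ : ℝ) • v := ht₀
    have hsv : Continuous fun t : unitInterval => (t : ℝ) • v := by fun_prop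
    have ht₀U : (t₀ : ℝ) • v ∈ U := ht₀' ▸ (hmem t₀).1
    have hev : ∀ᶠ t in 𝓝 t₀, ((t : unitInterval) : ℝ) • v ∈ U := by
      have : (t₀ : ℝ) • v ∈ O := by rw [hUO] at ht₀U; exact ht₀U.1
      filter_upwards [hsv.continuousAt.preimage_mem_nhds (hO.mem_nhds this)] with t ht
      rw [hUO]; exact ⟨ht, hv.smul _⟩
    have ht1 : Filter.Tendsto (fun t : unitInterval => e ((t : ℝ) • v)) (𝓝 t₀) (𝓝 (c t₀)) := by
      have h2 : e ((t₀ : ℝ) • v) = c t₀ := by rw [← ht₀', (hmem t₀).2]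
      rw [← h2]
      exact (hec _ ht₀U).tendsto.comp
        (tendsto_nhdsWithin_iff.2 ⟨hsv.continuousAt, hev⟩)
    have ht2 : Filter.Tendsto (fun t : unitInterval => c t) (𝓝 t₀) (𝓝 (c t₀)) := hc'.continuousAt
    have := eventually_eq_of_proj_eq hproj ht1 ht2 (hev.mono fun t ht => Subtype.ext (by
      rw [hpe _ ht, (hg t t.2).2, geod_smul, mul_one]))
    filter_upwards [this, hev] with t h3 h4
    rw [← h3, hLe _ h4]
  have huniv := hcl.eq_univ ⟨0, by
    change L (c (0 : ℝ)) = ((0 : ℝ)) • v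
    rw [hc0, ← he0, hLe 0 h0, zero_smul]⟩
  have h1 : (1 : unitInterval) ∈ {t : unitInterval | L (c t) = (t : ℝ) • v} := by
    rw [huniv]; trivial
  have h1' : L (c (1 : ℝ)) = (1 : ℝ) • v := h1
  rw [one_smul] at h1'
  have h2 := hmem 1
  have h3 : ((1 : unitInterval) : ℝ) = 1 := rfl
  rw [h3, h1', hc1] at h2
  exact h2

/-- The tangent space has dimension `d + 1 ≥ 2`: a unit timelike and a unit spacelike vector cannot
both be multiples of one vector. -/
lemma exists_tangent_not_parallel (hd : 1 ≤ d) {p : Amb d} (hp : p ∈ Quadric k d) {v : Amb d}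
    (hv : v ≠ 0) : ∃ u, IsTangent k p u ∧ ∀ c : ℝ, u ≠ c • v := by
  obtain ⟨d, rfl⟩ : ∃ d', d = d' + 1 := ⟨d - 1, by omega⟩
  have hf := frame_spec hp
  by_contra hcon
  push Not at hcon
  obtain ⟨a, ha⟩ := hcon _ (hf.1 0)
  obtain ⟨b, hb⟩ := hcon _ (hf.1 1)
  have h00 := hf.2.1 0 0
  have h01 := hf.2.1 0 1
  have h11 := hf.2.1 1 1
  have h10 : (1 : Fin (d + 1 + 1)) ≠ 0 := one_ne_zero
  rw [ha, metric_smul_smul] at h00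
  rw [ha, hb, metric_smul_smul, if_neg h10.symm] at h01
  rw [hb, metric_smul_smul] at h11
  simp only [if_true, h10, if_false] at h00 h11
  have : (a * b * metric k v v) ^ 2 = -1 := by
    linear_combination (b * b * metric k v v) * h00 + h11
  rw [h01] at this; norm_num at this

/-- The exponential map of a normal neighbourhood does not reach the antipode. -/
lemma length_lt_of_mem (hd : 1 ≤ d) (hproj : IsCoveringMap proj) {x : M} {U : Set (Amb d)}
    {e : Amb d → M}
    (hU : ∃ O : Set (Amb d), IsOpen O ∧ U = {v ∈ O | IsTangent k (proj x : Amb d) v})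
    (hstar : ∀ v ∈ U, ∀ t ∈ Set.Icc (0 : ℝ) 1, t • v ∈ U) (hec : ContinuousOn e U)
    (hpe : ∀ v ∈ U, (proj (e v) : Amb d) = geod k (proj x) v 1) (hinj : Set.InjOn e U)
    (hk : 0 < k) {w : Amb d} (hw : w ∈ U) (hm : 0 < metric k w w) :
    √(metric k w w) < Real.pi / √k := by
  by_contra hlen
  rw [not_lt] at hlen
  obtain ⟨O, hO, hUO⟩ := hU
  have hs0 : 0 < √(metric k w w) := Real.sqrt_pos.2 hm
  have hπ : 0 < Real.pi / √k := div_pos Real.pi_pos (Real.sqrt_pos.2 hk)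
  set R := Real.pi / √k with hR
  -- Shrink `w` to length exactly `π / √k`; star-shapedness keeps it in `U`.
  set w₁ := (R / √(metric k w w)) • w with hw₁
  have hw₁U : w₁ ∈ U := hstar w hw _ ⟨by positivity, (div_le_one hs0).2 hlen⟩
  have hw₁m : metric k w₁ w₁ = R ^ 2 := by
    rw [hw₁, metric_smul_self, div_pow, Real.sq_sqrt hm.le]; field_simp
  have hw₁t : IsTangent k (proj x : Amb d) w₁ := by rw [hUO] at hw₁U; exact hw₁U.2
  have hw₁0 : w₁ ≠ 0 := fun h => by
    rw [h] at hw₁m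
    have : metric k (0 : Amb d) 0 = 0 := by rw [← metricForm_apply]; simp
    rw [this] at hw₁m
    exact absurd hw₁m (by positivity)
  obtain ⟨u, hu, hpar⟩ := exists_tangent_not_parallel hd (proj x).2 hw₁0
  -- A curve of vectors through `w₁`, of constant length `π / √k` near `ε = 0`. There the geodesics
  -- all end over the antipode `-p`, so local injectivity of the covering makes `e` constant along
  -- `γ` near `ε = 0`. Injectivity of `e` then makes `u` parallel to `w₁`, a contradiction.
  let γ : ℝ → Amb d := fun ε => (R / √(metric k (w₁ + ε • u) (w₁ + ε • u))) • (w₁ + ε • u)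
  have hmc : Continuous fun ε : ℝ => metric k (w₁ + ε • u) (w₁ + ε • u) :=
    (continuous_metric k).comp (by fun_prop : Continuous fun ε : ℝ => (w₁ + ε • u, w₁ + ε • u))
  have hpos : ∀ᶠ ε in 𝓝 (0 : ℝ), 0 < metric k (w₁ + ε • u) (w₁ + ε • u) := by
    refine hmc.continuousAt.eventually (lt_mem_nhds ?_)
    simp only [zero_smul, add_zero, hw₁m]; positivity
  have hγ0 : γ 0 = w₁ := by
    simp only [γ, zero_smul, add_zero, hw₁m, Real.sqrt_sq hπ.le, div_self hπ.ne', one_smul]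
  have hγc : Filter.Tendsto γ (𝓝 0) (𝓝 w₁) := by
    rw [← hγ0]
    have h1 : ContinuousAt (fun ε : ℝ => √(metric k (w₁ + ε • u) (w₁ + ε • u))) 0 :=
      (Real.continuous_sqrt.comp hmc).continuousAt
    refine (continuousAt_const.div h1 ?_).smul (by fun_prop)
    exact (Real.sqrt_pos.2 hpos.self_of_nhds).ne'
  have hγU : ∀ᶠ ε in 𝓝 (0 : ℝ), γ ε ∈ U := by
    have : w₁ ∈ O := by rw [hUO] at hw₁U; exact hw₁U.1
    filter_upwards [hγc (hO.mem_nhds this)] with ε hε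
    rw [hUO]; exact ⟨hε, (hw₁t.add (hu.smul _)).smul _⟩
  have hγm : ∀ᶠ ε in 𝓝 (0 : ℝ), metric k (γ ε) (γ ε) = R ^ 2 := by
    filter_upwards [hpos] with ε hε
    simp only [γ]
    rw [metric_smul_self, div_pow, Real.sq_sqrt hε.le]; field_simp
  have h1 : Filter.Tendsto (fun ε => e (γ ε)) (𝓝 0) (𝓝 (e w₁)) :=
    (hec _ hw₁U).tendsto.comp (tendsto_nhdsWithin_iff.2 ⟨hγc, hγU⟩)
  have h2 := eventually_eq_of_proj_eq hproj h1 tendsto_const_nhds (by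
    filter_upwards [hγU, hγm] with ε h3 h4
    refine Subtype.ext ?_
    rw [hpe _ h3, hpe _ hw₁U, geod_antipode hk _ h4, geod_antipode hk _ hw₁m])
  have h3 : ∀ᶠ ε in 𝓝[≠] (0 : ℝ), False := by
    filter_upwards [(h2.and (hγU.and hpos)).filter_mono nhdsWithin_le_nhds,
      self_mem_nhdsWithin] with ε h4 h5
    have h6 := hinj h4.2.1 hw₁U h4.1
    have hε : ε ≠ 0 := h5
    have hc : R / √(metric k (w₁ + ε • u) (w₁ + ε • u)) ≠ 0 :=
      (div_pos hπ (Real.sqrt_pos.2 h4.2.2)).ne'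
    simp only [γ] at h6
    set c := R / √(metric k (w₁ + ε • u) (w₁ + ε • u))
    refine hpar ((1 - c) / (c * ε)) ?_
    have h7 : (c * ε) • u = (1 - c) • w₁ := by
      rw [sub_smul, one_smul, eq_sub_iff_add_eq]
      conv_rhs => rw [← h6]
      module
    have h8 : c * ε ≠ 0 := mul_ne_zero hc hε
    rw [div_eq_inv_mul, mul_smul, ← h7, smul_smul, inv_mul_cancel₀ h8, one_smul]
  exact h3.exists.elim fun _ h => h

/-! ### Geodesics in admissible domains -/

/-- Admissible domains are convex for timelike geodesics shorter than the diameter. -/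
lemma IsAdmissible.geodSeg (hd : 1 ≤ d) (hproj : IsCoveringMap proj) {Ω : Set M}
    (hΩ : IsAdmissible proj Ω) {x : M} (hx : x ∈ Ω) {v : Amb d}
    (hv : IsTangent k (proj x : Amb d) v) {r : ℝ} (hr : r ∈ radii k) (hvr : metric k v v = r ^ 2)
    (hx' : geodEnd hproj x v ∈ Ω) : GeodSeg proj Ω x v (geodEnd hproj x v) := by
  have hm : 0 < metric k v v := by have := radii_pos hr; rw [hvr]; positivity
  rcases hΩ.2 with h | ⟨-, rfl⟩
  · obtain ⟨U, e, L, hU, h0, hstar, hec, he0, hpe, hbij, hLe, hL⟩ := h x hx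
    obtain ⟨w, hw, hwx⟩ := hbij.surjOn hx'
    have hwt : IsTangent k (proj x : Amb d) w := by
      obtain ⟨O, -, hUO⟩ := hU; rw [hUO] at hw; exact hw.2
    -- The vector `w` that the normal neighbourhood assigns to the end point has the same
    -- exponential image as `v`. For `k > 0` uniqueness also needs `w` to be shorter than the
    -- diameter, which the absence of antipodes provides. The segment is then `t ↦ e (t • w)`, which
    -- stays in Ω.
    have hwv : w = v := by
      refine geod_one_inj (proj x).2 hv hwt hr hvr
        (fun hk hm => length_lt_of_mem hd hproj hU hstar hec hpe hbij.injOn hk hw hm) ?_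
      rw [← hpe w hw, hwx, proj_geodEnd hproj ⟨hv, hm⟩]
    subst hwv
    refine ⟨hv, fun t => e (t • w), ?_, ?_, ?_, fun t ht => ⟨?_, ?_⟩⟩
    · exact hec.comp (by fun_prop) fun t ht => hstar w hw t ht
    · simp only [zero_smul, he0]
    · simp only [one_smul, hwx]
    · exact hbij.mapsTo (hstar w hw t ht)
    · rw [hpe _ (hstar w hw t ht), geod_smul, mul_one]
  · exact geodSeg_univ hproj hv hm

/-- This identifies the choice made in `logVec`. In a normal neighbourhood it is the injectivity of
the exponential map; in the whole space with `k ≤ 0` it is `geod_one_inj`, whose length condition is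
then void. -/
lemma IsAdmissible.geodSeg_unique (hproj : IsCoveringMap proj) {Ω : Set M}
    (hΩ : IsAdmissible proj Ω) {x x' : M} (hx : x ∈ Ω) {v w : Amb d} {r : ℝ} (hr : r ∈ radii k)
    (hvr : metric k v v = r ^ 2) (h : GeodSeg proj Ω x v x') (h' : GeodSeg proj Ω x w x') :
    w = v := by
  rcases hΩ.2 with hn | ⟨hk, rfl⟩
  · obtain ⟨U, e, L, hU, h0, hstar, hec, he0, hpe, hbij, hLe, hL⟩ := hn x hx
    have h1 := mem_of_geodSeg hproj hU h0 hec he0 hpe hbij hLe hL h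
    have h2 := mem_of_geodSeg hproj hU h0 hec he0 hpe hbij hLe hL h'
    exact hbij.injOn h2.1 h1.1 (h2.2.trans h1.2.symm)
  · refine geod_one_inj (proj x).2 h.1 h'.1 hr hvr (fun h => absurd h (not_lt.2 hk)) ?_
    obtain ⟨-, c, -, -, h1, h2⟩ := h
    obtain ⟨-, c', -, -, h1', h2'⟩ := h'
    rw [← (h2 1 ⟨zero_le_one, le_rfl⟩).2, ← (h2' 1 ⟨zero_le_one, le_rfl⟩).2, h1, h1']

end

/-! ### The chronological relation and the future hyperboloids. -/

section

variable {k : ℝ} {M : Type*} [TopologicalSpace M]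
variable {S : Type*} [NormedAddCommGroup S] {proj : M → Quadric k d}

/-! ### The chronological relation -/

/-- There is a future-directed timelike geodesic, of length less than the diameter, from `x`
to `x'`. -/
def TimelikeRel (hproj : IsCoveringMap proj) (x x' : M) : Prop :=
  ∃ r ∈ radii k, ∃ v, IsTangent k (proj x : Amb d) v ∧ metric k v v = r ^ 2 ∧
    0 < timeComponent k (proj x) v ∧ geodEnd hproj x v = x'

lemma metric_pos_of_radii {v : Amb d} {r : ℝ} (hr : r ∈ radii k) (hv : metric k v v = r ^ 2) :
    0 < metric k v v := by
  have := radii_pos hr; rw [hv]; positivity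

lemma TimelikeRel.chord_mem {hproj : IsCoveringMap proj} {x x' : M}
    (h : TimelikeRel hproj x x') : chord k (proj x : Amb d) (proj x') ∈ chordRange k := by
  obtain ⟨r, hr, v, hv, hvr, -, rfl⟩ := h
  rw [proj_geodEnd hproj ⟨hv, metric_pos_of_radii hr hvr⟩,
    chord_geod_timelike (proj x).2 hv (radii_pos hr) hvr]
  exact LorentzSpinor.chord_mem hr

/-- The only candidate for the initial velocity is `expInv`, which eliminates the existential
quantifiers. The two remaining conditions are each open and closed as the points vary. -/
lemma timelikeRel_iff {hproj : IsCoveringMap proj} {x x' : M}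
    (h : chord k (proj x : Amb d) (proj x') ∈ chordRange k) :
    TimelikeRel hproj x x' ↔ 0 < timeComponent k (proj x : Amb d) (expInv k (proj x) (proj x')) ∧
      geodEnd hproj x (expInv k (proj x) (proj x')) = x' := by
  constructor
  · rintro ⟨r, hr, v, hv, hvr, ht, rfl⟩
    rw [proj_geodEnd hproj ⟨hv, metric_pos_of_radii hr hvr⟩, expInv_geod (proj x).2 hv hr hvr]
    exact ⟨ht, rfl⟩
  · rintro ⟨h1, h2⟩
    exact ⟨_, rad_mem h, _, expInv_isTangent (proj x).2 (proj x').2,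
      metric_expInv (proj x).2 (proj x').2 h, h1, h2⟩

/-- The initial velocity is a function of the two projections, and it determines the end point
upstairs. So `proj` is injective on the chronological future of a point, which makes `futureField`
independent of its choice. -/
lemma TimelikeRel.eq_of_proj_eq {hproj : IsCoveringMap proj} {x x' x'' : M}
    (h : TimelikeRel hproj x x') (h' : TimelikeRel hproj x x'')
    (hq : (proj x' : Amb d) = proj x'') : x' = x'' := by
  have h1 := ((timelikeRel_iff h.chord_mem).1 h).2
  have h2 := ((timelikeRel_iff h'.chord_mem).1 h').2
  rw [← h1, ← h2, hq]

lemma continuous_chord (k : ℝ) : Continuous fun z : Amb d × Amb d => chord k z.1 z.2 := by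
  unfold chord metric eta; fun_prop

lemma continuous_expInv {X : Type*} [TopologicalSpace X] {p q : X → Amb d} (hp : Continuous p)
    (hq : Continuous q) (h : ∀ z, chord k (p z) (q z) ∈ chordRange k) :
    Continuous fun z => expInv k (p z) (q z) := by
  have hc : Continuous fun z => chord k (p z) (q z) := (continuous_chord k).comp (hp.prodMk hq)
  have hr := (continuous_rad k).comp hc
  unfold expInv tanPart
  refine (hr.div ((continuous_sn k).comp hr) fun z => (sn_pos (rad_mem (h z))).ne').smul
    (hq.sub ((continuous_const.sub (continuous_const.mul hc)).smul hp))

/-- On pairs with chord in the range of timelike separation, the chronological relation is locally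
constant. -/
lemma eventually_timelikeRel_iff (hproj : IsCoveringMap proj) {x₀ x₁ : M}
    (h : chord k (proj x₀ : Amb d) (proj x₁) ∈ chordRange k) :
    ∀ᶠ z in 𝓝 (x₀, x₁), (TimelikeRel hproj z.1 z.2 ↔ TimelikeRel hproj x₀ x₁) := by
  have hpc : Continuous fun x : M => (proj x : Amb d) :=
    continuous_subtype_val.comp hproj.continuous
  let D : Set (M × M) := {z | chord k (proj z.1 : Amb d) (proj z.2) ∈ chordRange k}
  have hD : IsOpen D := (isOpen_chordRange k).preimage
    ((continuous_chord k).comp ((hpc.comp continuous_fst).prodMk (hpc.comp continuous_snd)))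
  have hc1 : Continuous fun z : D => z.1.1 := continuous_fst.comp continuous_subtype_val
  have hc2 : Continuous fun z : D => z.1.2 := continuous_snd.comp continuous_subtype_val
  have hE : Continuous fun z : D => expInv k (proj z.1.1 : Amb d) (proj z.1.2) :=
    continuous_expInv (hpc.comp hc1) (hpc.comp hc2) fun z => z.2
  have hEt : ∀ z : D, IsTangent k (proj z.1.1 : Amb d) (expInv k (proj z.1.1) (proj z.1.2)) ∧
      0 < metric k (expInv k (proj z.1.1 : Amb d) (proj z.1.2))
        (expInv k (proj z.1.1 : Amb d) (proj z.1.2)) := fun z =>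
    ⟨expInv_isTangent (proj z.1.1).2 (proj z.1.2).2, metric_pos_of_radii (rad_mem z.2)
      (metric_expInv (proj z.1.1).2 (proj z.1.2).2 z.2)⟩
  have hend := continuous_geodEnd hproj hc1 hE hEt
  have hover : proj ∘ (fun z : D => geodEnd hproj z.1.1 (expInv k (proj z.1.1) (proj z.1.2)))
      = proj ∘ fun z : D => z.1.2 := funext fun z => Subtype.ext (by
    rw [Function.comp_apply, proj_geodEnd hproj (hEt z),
      geod_expInv (proj z.1.1).2 (proj z.1.2).2 z.2]; rfl)
  have htc : Continuous fun z : D =>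
      timeComponent k (proj z.1.1 : Amb d) (expInv k (proj z.1.1) (proj z.1.2)) :=
    (continuous_timeComponent k).comp ((hpc.comp hc1).prodMk hE)
  have hcl1 : IsClopen {z : D |
      0 < timeComponent k (proj z.1.1 : Amb d) (expInv k (proj z.1.1) (proj z.1.2))} := by
    refine ⟨?_, isOpen_lt continuous_const htc⟩
    have : {z : D |
        0 < timeComponent k (proj z.1.1 : Amb d) (expInv k (proj z.1.1) (proj z.1.2))} =
        {z : D | 0 ≤ timeComponent k (proj z.1.1 : Amb d)
          (expInv k (proj z.1.1) (proj z.1.2))} :=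
      Set.ext fun z => ⟨fun hz => le_of_lt (Set.mem_ofPred.1 hz),
        fun hz => lt_of_le_of_ne (Set.mem_ofPred.1 hz)
          (timeComponent_ne_zero (proj z.1.1).2 (hEt z).1 (hEt z).2).symm⟩
    rw [this]; exact isClosed_le continuous_const htc
  -- The two sides are continuous maps with the same projection, so their coincidence set is closed
  -- because the covering is separated and open because it is locally injective.
  have hcl2 : IsClopen {z : D |
      geodEnd hproj z.1.1 (expInv k (proj z.1.1) (proj z.1.2)) = z.1.2} :=
    ⟨hproj.isSeparatedMap.isClosed_eqLocus hend hc2 hover,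
      hproj.isLocalHomeomorph.isLocallyInjective.isOpen_eqLocus hend hc2 hover⟩
  have hcl : IsClopen {z : D | TimelikeRel hproj z.1.1 z.1.2} := by
    convert hcl1.inter hcl2 using 1
    ext z
    exact timelikeRel_iff z.2
  have key : ∀ᶠ z : D in 𝓝 ⟨(x₀, x₁), h⟩,
      (TimelikeRel hproj z.1.1 z.1.2 ↔ TimelikeRel hproj x₀ x₁) := by
    by_cases h0 : TimelikeRel hproj x₀ x₁
    · filter_upwards [hcl.isOpen.mem_nhds (show (⟨(x₀, x₁), h⟩ : D) ∈ _ from h0)] with z hz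
      exact iff_of_true hz h0
    · filter_upwards [hcl.compl.isOpen.mem_nhds (show (⟨(x₀, x₁), h⟩ : D) ∈ _ from h0)] with z hz
      exact iff_of_false hz h0
  rw [← hD.isOpenEmbedding_subtypeVal.map_nhds_eq ⟨(x₀, x₁), h⟩]
  exact key

open Classical in
/-- The spinor field `ψ` on the chronological future of `x`, as a function of the projection. -/
def futureField (hproj : IsCoveringMap proj) (ψ : M → S) (x : M) (q : Amb d) : S :=
  if h : ∃ x', TimelikeRel hproj x x' ∧ (proj x' : Amb d) = q then ψ h.choose else 0

lemma futureField_eq (hproj : IsCoveringMap proj) (ψ : M → S) {x x' : M}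
    (h : TimelikeRel hproj x x') : futureField hproj ψ x (proj x') = ψ x' := by
  have hex : ∃ x'', TimelikeRel hproj x x'' ∧ (proj x'' : Amb d) = proj x' := ⟨x', h, rfl⟩
  rw [futureField, dif_pos hex]
  congr 1
  exact hex.choose_spec.1.eq_of_proj_eq h hex.choose_spec.2

lemma exists_of_futureField_ne_zero {hproj : IsCoveringMap proj} {ψ : M → S} {x : M} {q : Amb d}
    (h : futureField hproj ψ x q ≠ 0) :
    ∃ x' ∈ tsupport ψ, TimelikeRel hproj x x' ∧ (proj x' : Amb d) = q := by
  unfold futureField at h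
  split_ifs at h with hex
  · exact ⟨_, subset_tsupport _ h, hex.choose_spec⟩
  · exact absurd rfl h

variable [NormedSpace ℂ S]

/-- For `x` near `x₀`, the future field of `x` agrees with that of `x₀` on the support of a radial
kernel. -/
lemma eventually_kernel_futureField (C : CliffordModule d S) (hproj : IsCoveringMap proj)
    {ψ : M → S} (hψc : HasCompactSupport ψ) {A B : ℝ → ℂ} (hA : tsupport A ⊆ chordRange k)
    (hB : tsupport B ⊆ chordRange k) (x₀ : M) :
    ∀ᶠ x in 𝓝 x₀, ∀ q, kernelOp C k A B (proj x) q (futureField hproj ψ x q)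
      = kernelOp C k A B (proj x) q (futureField hproj ψ x₀ q) := by
  have hpc : Continuous fun x : M => (proj x : Amb d) :=
    continuous_subtype_val.comp hproj.continuous
  have hchord : Continuous fun z : M × M => chord k (proj z.1 : Amb d) (proj z.2) :=
    (continuous_chord k).comp ((hpc.comp continuous_fst).prodMk (hpc.comp continuous_snd))
  -- Compactness of the support reduces the claim to a neighbourhood of each `(x₀, x₁)`. If the
  -- chord lies in `chordRange`, the relation is locally constant; if not, nearby chords avoid the
  -- closed supports of the coefficients and nothing is claimed.
  have hloc : ∀ᶠ x in 𝓝 x₀, ∀ x' ∈ tsupport ψ,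
      chord k (proj x : Amb d) (proj x') ∈ tsupport A ∪ tsupport B →
      (TimelikeRel hproj x x' ↔ TimelikeRel hproj x₀ x') := by
    refine hψc.isCompact.eventually_forall_of_forall_eventually fun x₁ _ => ?_
    by_cases h : chord k (proj x₀ : Amb d) (proj x₁) ∈ chordRange k
    · have h1 := eventually_timelikeRel_iff hproj h
      have h2 : ∀ᶠ z : M × M in 𝓝 (x₀, x₁),
          (TimelikeRel hproj x₀ z.2 ↔ TimelikeRel hproj x₀ x₁) :=
        ((continuous_const.prodMk continuous_snd).tendsto' (x₀, x₁) (x₀, x₁) rfl).eventually h1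
      filter_upwards [h1, h2] with z h3 h4 _
      rw [h3, h4]
    · have hn : chord k (proj x₀ : Amb d) (proj x₁) ∈ (tsupport A ∪ tsupport B)ᶜ := fun h' =>
        h (h'.elim (fun h' => hA h') fun h' => hB h')
      have hop : IsOpen (tsupport A ∪ tsupport B)ᶜ :=
        ((isClosed_tsupport A).union (isClosed_tsupport B)).isOpen_compl
      have h1 : ∀ᶠ z : M × M in 𝓝 (x₀, x₁),
          chord k (proj z.1 : Amb d) (proj z.2) ∈ (tsupport A ∪ tsupport B)ᶜ :=
        hchord.continuousAt (hop.mem_nhds hn)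
      filter_upwards [h1] with z h2 h3
      exact absurd h3 h2
  filter_upwards [hloc] with x hx q
  by_cases hq : chord k (proj x : Amb d) q ∈ tsupport A ∪ tsupport B
  · congr 1
    by_cases h1 : futureField hproj ψ x q = 0
    · by_cases h2 : futureField hproj ψ x₀ q = 0
      · rw [h1, h2]
      · obtain ⟨x', hx', hr, rfl⟩ := exists_of_futureField_ne_zero h2
        rw [futureField_eq hproj ψ hr, futureField_eq hproj ψ ((hx x' hx' hq).2 hr)]
    · obtain ⟨x', hx', hr, rfl⟩ := exists_of_futureField_ne_zero h1
      rw [futureField_eq hproj ψ hr, futureField_eq hproj ψ ((hx x' hx' hq).1 hr)]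
  · have hA0 : A (chord k (proj x : Amb d) q) = 0 :=
      image_eq_zero_of_notMem_tsupport fun h => hq (Or.inl h)
    have hB0 : B (chord k (proj x : Amb d) q) = 0 :=
      image_eq_zero_of_notMem_tsupport fun h => hq (Or.inr h)
    simp [kernelOp, hA0, hB0]

/-! ### The future hyperboloids in polar coordinates -/

lemma causalCurve_of_geodSeg {Ω : Set M} {x x' : M} {v : Amb d} (hm : 0 < metric k v v)
    (ht : 0 < timeComponent k (proj x : Amb d) v) (h : GeodSeg proj Ω x v x') :
    CausalCurve proj Ω x x' := by
  obtain ⟨hv, c, hc, h0, h1, hg⟩ := h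
  have hgd : ContDiff ℝ 1 (geod k (proj x : Amb d) v) := by
    rw [contDiff_one_iff_deriv]
    refine ⟨fun t => (geod_hasDerivAt k _ v t).differentiableAt, ?_⟩
    rw [show deriv (geod k (proj x : Amb d) v) = geodVel k (proj x) v from
      funext fun t => (geod_hasDerivAt k _ v t).deriv]
    exact continuous_iff_continuousAt.2 fun t => (geodVel_hasDerivAt k _ v t).continuousAt
  refine ⟨c, hc, h0, h1, fun t ht => (hg t ht).1,
    hgd.contDiffOn.congr fun t ht => (hg t ht).2, fun t htt => ?_⟩
  have e : derivWithin (fun t => (proj (c t) : Amb d)) (Set.Icc 0 1) t = geodVel k (proj x) v t := by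
    rw [derivWithin_congr (fun s hs => (hg s hs).2) (hg t htt).2]
    exact (geod_hasDerivAt k _ v t).hasDerivWithinAt.derivWithin
      (uniqueDiffOn_Icc zero_lt_one t htt)
  rw [e, (hg t htt).2]
  exact ⟨geodVel_isTangent (proj x).2 hv t, by rw [metric_geodVel (proj x).2 hv]; exact hm.le,
    timeComponent_geodVel_pos (proj x).2 hv hm ht t⟩

lemma unitFuture_timelike (p : Quadric k d) {r : ℝ} (hr : 0 < r) (y : EuclideanSpace ℝ (Fin d)) :
    IsTangent k (p : Amb d) (r • unitFuture k p y) ∧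
      0 < metric k (r • unitFuture k (p : Amb d) y) (r • unitFuture k (p : Amb d) y) :=
  ⟨(unitFuture_isTangent p.2 y).smul r, by
    rw [metric_smul_self, metric_unitFuture p.2]; positivity⟩

lemma metric_smul_unitFuture (p : Quadric k d) (r : ℝ) (y : EuclideanSpace ℝ (Fin d)) :
    metric k (r • unitFuture k (p : Amb d) y) (r • unitFuture k (p : Amb d) y) = r ^ 2 := by
  rw [metric_smul_self, metric_unitFuture p.2, mul_one]

lemma timeComponent_smul_unitFuture_pos (p : Quadric k d) {r : ℝ} (hr : 0 < r)
    (y : EuclideanSpace ℝ (Fin d)) :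
    0 < timeComponent k (p : Amb d) (r • unitFuture k p y) := by
  rw [timeComponent_smul]; exact mul_pos hr (timeComponent_unitFuture_pos p.2 y)

lemma timelikeRel_geodEnd (hproj : IsCoveringMap proj) (x : M) {r : ℝ} (hr : r ∈ radii k)
    (y : EuclideanSpace ℝ (Fin d)) :
    TimelikeRel hproj x (geodEnd hproj x (r • unitFuture k (proj x : Amb d) y)) :=
  ⟨r, hr, _, (unitFuture_timelike (proj x) (radii_pos hr) y).1, metric_smul_unitFuture (proj x) r y,
    timeComponent_smul_unitFuture_pos (proj x) (radii_pos hr) y, rfl⟩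

lemma IsAdmissible.logVec_eq {hproj : IsCoveringMap proj} {Ω : Set M}
    (hΩ : IsAdmissible proj Ω) {x x' : M} (hx : x ∈ Ω) {r : ℝ} (hr : r ∈ radii k)
    {y : EuclideanSpace ℝ (Fin d)}
    (h : GeodSeg proj Ω x (r • unitFuture k (proj x : Amb d) y) x') :
    logVec proj Ω x x' = r • unitFuture k (proj x : Amb d) y := by
  have hex : ∃ v, IsFutureCausal k (proj x : Amb d) v ∧ GeodSeg proj Ω x v x' :=
    ⟨_, ⟨h.1, (unitFuture_timelike (proj x) (radii_pos hr) y).2.le,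
      timeComponent_smul_unitFuture_pos (proj x) (radii_pos hr) y⟩, h⟩
  rw [logVec, dif_pos hex]
  exact hΩ.geodSeg_unique hproj hx hr (metric_smul_unitFuture (proj x) r y) h hex.choose_spec.2

lemma IsAdmissible.rho_eq {hproj : IsCoveringMap proj} {Ω : Set M}
    (hΩ : IsAdmissible proj Ω) {x x' : M} (hx : x ∈ Ω) {r : ℝ} (hr : r ∈ radii k)
    {y : EuclideanSpace ℝ (Fin d)}
    (h : GeodSeg proj Ω x (r • unitFuture k (proj x : Amb d) y) x') :
    rho proj Ω x x' = r := by
  rw [rho, hΩ.logVec_eq (hproj := hproj) hx hr h, metric_smul_unitFuture,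
    Real.sqrt_sq (radii_pos hr).le]

lemma IsAdmissible.kern_eq (C : CliffordModule d S) {hproj : IsCoveringMap proj} {Ω : Set M}
    (hΩ : IsAdmissible proj Ω) (ψ : M → S) {x x' : M} (hx : x ∈ Ω) {r : ℝ} (hr : r ∈ radii k)
    {y : EuclideanSpace ℝ (Fin d)}
    (h : GeodSeg proj Ω x (r • unitFuture k (proj x : Amb d) y) x') :
    kern C proj Ω ψ x x' = lamOp C k (proj x) (unitFuture k (proj x : Amb d) y) r (ψ x') := by
  rw [kern, Lam, hΩ.logVec_eq (hproj := hproj) hx hr h, transport_eq C (proj x).2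
    (unitFuture_isTangent (proj x).2 y) (metric_unitFuture (proj x).2 y)]

lemma IsAdmissible.kernHat_eq (C : CliffordModule d S) {hproj : IsCoveringMap proj} {Ω : Set M}
    (hΩ : IsAdmissible proj Ω) (ψ : M → S) {x x' : M} (hx : x ∈ Ω) {r : ℝ} (hr : r ∈ radii k)
    {y : EuclideanSpace ℝ (Fin d)}
    (h : GeodSeg proj Ω x (r • unitFuture k (proj x : Amb d) y) x') :
    kernHat C proj Ω ψ x x' = cliff C k (proj x) (unitFuture k (proj x : Amb d) y)
      (lamOp C k (proj x) (unitFuture k (proj x : Amb d) y) r (ψ x')) := by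
  have e : nu proj Ω x x' = unitFuture k (proj x : Amb d) y := by
    rw [nu, hΩ.rho_eq (hproj := hproj) hx hr h, hΩ.logVec_eq (hproj := hproj) hx hr h, smul_smul,
      inv_mul_cancel₀ (radii_pos hr).ne', one_smul]
  rw [kernHat, e, ← hΩ.kern_eq C (hproj := hproj) ψ hx hr h]; rfl

/-- A timelike geodesic of M of length less than the diameter that ends in Ω lies in Ω, by
convexity, and is itself a causal curve. So membership in the causal future of Ω adds no condition
beyond the position of the end point. -/
lemma IsAdmissible.mem_hypDomain_iff (hd : 1 ≤ d) (hproj : IsCoveringMap proj) {Ω : Set M}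
    (hΩ : IsAdmissible proj Ω) {x : M} (hx : x ∈ Ω) {r : ℝ} (hr : r ∈ radii k)
    (y : EuclideanSpace ℝ (Fin d)) :
    y ∈ hypDomain proj Ω x r ↔ geodEnd hproj x (r • unitFuture k (proj x : Amb d) y) ∈ Ω := by
  have hu := unitFuture_timelike (proj x) (radii_pos hr) y
  constructor
  · rintro ⟨x', hx', h⟩
    rw [h.geodLift_eq hproj hu.2]
    exact hx'.1.1
  · intro h
    have hg := hΩ.geodSeg hd hproj hx hu.1 hr (metric_smul_unitFuture (proj x) r y) h
    refine ⟨_, ⟨⟨h, ?_⟩, hΩ.rho_eq (hproj := hproj) hx hr hg⟩, hg⟩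
    exact Relation.ReflTransGen.single (causalCurve_of_geodSeg hu.2
      (timeComponent_smul_unitFuture_pos (proj x) (radii_pos hr) y) hg)

lemma endPt_eq_geodEnd (hproj : IsCoveringMap proj) {Ω : Set M} {x : M} {r : ℝ} (hr : 0 < r)
    {y : EuclideanSpace ℝ (Fin d)} (hy : y ∈ hypDomain proj Ω x r) :
    endPt proj Ω x (r • unitFuture k (proj x : Amb d) y)
      = geodEnd hproj x (r • unitFuture k (proj x : Amb d) y) := by
  obtain ⟨x', -, h⟩ := hy
  have hex : ∃ x', GeodSeg proj Ω x (r • unitFuture k (proj x : Amb d) y) x' := ⟨x', h⟩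
  rw [endPt, dif_pos hex]
  exact (hex.choose_spec.geodLift_eq hproj (unitFuture_timelike (proj x) hr y).2).symm

end

/-! ### Polar coordinates and integration over the thickened pseudosphere. -/

section

/-! ### Polar coordinates in the ambient space -/

/-- Polar coordinates `(s, r, y) ↦ s exp_p (r u(y))`. -/
def polarMap (k : ℝ) (p : Amb d) (z : Amb d) : Amb d :=
  z.1 • (cs k z.2.1 • p + sn k z.2.1 • unitFuture k p z.2.2)

/-- The domain of the polar coordinates. -/
def polarDom (k : ℝ) (d : ℕ) : Set (Amb d) := Set.Ioo 1 2 ×ˢ (radii k ×ˢ Set.univ)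

lemma isOpen_polarDom (k : ℝ) (d : ℕ) : IsOpen (polarDom k d) :=
  isOpen_Ioo.prod ((isOpen_radii k).prod isOpen_univ)

lemma exp_mem {k : ℝ} {p : Amb d} (hp : p ∈ Quadric k d) (r : ℝ) (y : EuclideanSpace ℝ (Fin d)) :
    cs k r • p + sn k r • unitFuture k p y ∈ Quadric k d := by
  rw [← geod_unit p (metric_unitFuture hp y)]
  exact geod_mem hp ((unitFuture_isTangent hp y).smul r) 1

lemma frameVec_injective {k : ℝ} {p : Amb d} (hp : p ∈ Quadric k d) :
    Function.Injective (frameVec k p) := by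
  rw [← LinearMap.ker_eq_bot, LinearMap.ker_eq_bot']
  intro X hX
  refine (etaForm_nondegenerate d).1 X fun Y => ?_
  rw [etaForm_apply, ← metric_frameVec hp, hX, ← metricForm_apply, map_zero, LinearMap.zero_apply]

lemma exp_injective {k : ℝ} {p : Amb d} (hp : p ∈ Quadric k d) {r r' : ℝ} (hr : r ∈ radii k)
    (hr' : r' ∈ radii k) {y y' : EuclideanSpace ℝ (Fin d)}
    (h : cs k r • p + sn k r • unitFuture k p y = cs k r' • p + sn k r' • unitFuture k p y') :
    r = r' ∧ y = y' := by
  have e : ∀ {r} {y : EuclideanSpace ℝ (Fin d)}, r ∈ radii k →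
      expInv k p (cs k r • p + sn k r • unitFuture k p y) = r • unitFuture k p y := fun {r y} hr => by
    rw [← geod_unit p (metric_unitFuture hp y)]
    exact expInv_geod hp ((unitFuture_isTangent hp y).smul r) hr
      (by rw [metric_smul_self, metric_unitFuture hp, mul_one])
  have h1 : r • unitFuture k p y = r' • unitFuture k p y' := by rw [← e hr, ← e hr', h]
  have h2 : r ^ 2 = r' ^ 2 := by
    have := congrArg (fun v => metric k v v) h1
    simpa [metric_smul_self, metric_unitFuture hp] using this
  have h3 : r = r' := by
    have := radii_pos hr
    have := radii_pos hr'
    nlinarith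
  subst h3
  refine ⟨rfl, ?_⟩
  have h4 := smul_right_injective _ (radii_pos hr).ne' h1
  rw [unitFuture_eq, unitFuture_eq] at h4
  exact congrArg Prod.snd (frameVec_injective hp h4)

lemma ambForm_polarMap {k : ℝ} {p : Amb d} (hp : p ∈ Quadric k d) (z : Amb d) :
    ambForm d k (polarMap k p z) (polarMap k p z) = z.1 ^ 2 := by
  rw [polarMap]
  simp only [map_smul, LinearMap.smul_apply, ambForm_self (exp_mem hp _ _), smul_eq_mul]; ring

lemma polarMap_injOn {k : ℝ} {p : Amb d} (hp : p ∈ Quadric k d) :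
    Set.InjOn (polarMap k p) (polarDom k d) := by
  rintro ⟨s, r, y⟩ ⟨hs, hr, -⟩ ⟨s', r', y'⟩ ⟨hs', hr', -⟩ h
  have h1 := congrArg (fun z => ambForm d k z z) h
  simp only [ambForm_polarMap hp] at h1
  have hs0 : 1 < s := hs.1
  have hs0' : 1 < s' := hs'.1
  have h2 : s = s' := by nlinarith
  subst h2
  have h3 := smul_right_injective _ (by linarith : s ≠ 0) h
  obtain ⟨rfl, rfl⟩ := exp_injective hp hr hr' h3
  rfl

/-! #### The Jacobian of the polar coordinates -/

/-- `(s, r, y) ↦ (s cs r, s sn r, y)` -/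
def polarPlane (k : ℝ) (z : Amb d) : Amb d := (z.1 * cs k z.2.1, (z.1 * sn k z.2.1, z.2.2))

/-- `(a, b, y) ↦ (a, b, b y)` -/
def scaleMap (z : Amb d) : Amb d := (z.1, (z.2.1, z.2.1 • z.2.2))

/-- `(a, b, Y) ↦ (a, √(b² + |Y|²), Y)` -/
def hyperbolaMap (z : Amb d) : Amb d := (z.1, (√(z.2.1 ^ 2 + ‖z.2.2‖ ^ 2), z.2.2))

lemma exists_hasFDerivAt_polarPlane (k : ℝ) (z : Amb d) :
    ∃ L : Amb d →L[ℝ] Amb d, HasFDerivAt (polarPlane k) L z ∧ L.det = z.1 := by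
  have hs := hasFDerivAt_fst (𝕜 := ℝ) (p := z)
  have hr : HasFDerivAt (fun z : Amb d => z.2.1) _ z :=
    (hasFDerivAt_fst (𝕜 := ℝ) (p := z.2)).comp z hasFDerivAt_snd
  have hy : HasFDerivAt (fun z : Amb d => z.2.2) _ z :=
    (hasFDerivAt_snd (𝕜 := ℝ) (p := z.2)).comp z hasFDerivAt_snd
  have hc := hs.mul ((cs_hasDerivAt k z.2.1).comp_hasFDerivAt z hr)
  have hn := hs.mul ((sn_hasDerivAt k z.2.1).comp_hasFDerivAt z hr)
  refine ⟨_, hc.prodMk (hn.prodMk hy), ?_⟩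
  let m : Matrix (Fin 2) (Fin 2) ℝ :=
    !![cs k z.2.1, z.1 * (-k * sn k z.2.1); sn k z.2.1, z.1 * cs k z.2.1]
  let f : ℝ × ℝ →ₗ[ℝ] ℝ × ℝ :=
    Matrix.toLin (Module.Basis.finTwoProd ℝ) (Module.Basis.finTwoProd ℝ) m
  let e := LinearEquiv.prodAssoc ℝ ℝ ℝ (EuclideanSpace ℝ (Fin d))
  -- After reassociating the product, the derivative is a plane map times the identity in `y`; the
  -- plane map has determinant `s (cs² + k sn²) = s`.
  have key : e.toLinearMap ∘ₗ (f.prodMap LinearMap.id) ∘ₗ e.symm.toLinearMap =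
      (((z.1 • (-k * sn k z.2.1) • (ContinuousLinearMap.fst ℝ ℝ (EuclideanSpace ℝ (Fin d))).comp
        (ContinuousLinearMap.snd ℝ ℝ (Mink d)) + cs k z.2.1 • ContinuousLinearMap.fst ℝ ℝ (Mink d))).prod
      ((z.1 • cs k z.2.1 • (ContinuousLinearMap.fst ℝ ℝ (EuclideanSpace ℝ (Fin d))).comp
        (ContinuousLinearMap.snd ℝ ℝ (Mink d)) + sn k z.2.1 • ContinuousLinearMap.fst ℝ ℝ (Mink d)).prod
        ((ContinuousLinearMap.snd ℝ ℝ (EuclideanSpace ℝ (Fin d))).comp (ContinuousLinearMap.snd ℝ ℝ (Mink d)))) :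
        Amb d →L[ℝ] Amb d).toLinearMap := by
    refine LinearMap.ext fun w => ?_
    obtain ⟨a, b, y⟩ := w
    change ((f (a, b)).1, ((f (a, b)).2, y)) = _
    refine Prod.ext ?_ (Prod.ext ?_ ?_)
    · simp [f, m, Matrix.toLin_finTwoProd_apply]; ring
    · simp [f, m, Matrix.toLin_finTwoProd_apply]; ring
    · simp
  have hdet : LinearMap.det f = z.1 := by
    simp only [f, LinearMap.det_toLin, m, Matrix.det_fin_two_of]
    linear_combination z.1 * cs_sq_add k z.2.1
  change LinearMap.det _ = _
  refine Eq.trans ?_ hdet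
  rw [← mul_one (LinearMap.det f), ← LinearMap.det_id (A := ℝ) (M := EuclideanSpace ℝ (Fin d)), ← LinearMap.det_prodMap,
    ← LinearMap.det_conj _ e]
  congr 1
  exact key.symm

lemma exists_hasFDerivAt_scaleMap (z : Amb d) :
    ∃ L : Amb d →L[ℝ] Amb d, HasFDerivAt scaleMap L z ∧ L.det = z.2.1 ^ d := by
  have hb : HasFDerivAt (fun z : Amb d => z.2.1) _ z :=
    (hasFDerivAt_fst (𝕜 := ℝ) (p := z.2)).comp z hasFDerivAt_snd
  have hy : HasFDerivAt (fun z : Amb d => z.2.2) _ z :=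
    (hasFDerivAt_snd (𝕜 := ℝ) (p := z.2)).comp z hasFDerivAt_snd
  refine ⟨_, (hasFDerivAt_fst (𝕜 := ℝ) (p := z)).prodMk (hb.prodMk (hb.smul hy)), ?_⟩
  change LinearMap.det _ = _
  let g : Mink d →ₗ[ℝ] Mink d := LinearMap.prod (LinearMap.fst ℝ ℝ (EuclideanSpace ℝ (Fin d)))
    (z.2.1 • LinearMap.snd ℝ ℝ (EuclideanSpace ℝ (Fin d)) + (LinearMap.fst ℝ ℝ (EuclideanSpace ℝ (Fin d))).smulRight z.2.2)
  rw [det_lower_triangular LinearMap.id 0 g (fun w => by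
    refine Prod.ext ?_ (Prod.ext ?_ ?_) <;> simp [g]),
    det_lower_triangular (L := g) LinearMap.id (LinearMap.toSpanSingleton ℝ _ z.2.2)
      (z.2.1 • LinearMap.id) (fun w => by
        refine Prod.ext ?_ ?_
        · simp [g]
        · simp [g, add_comm])]
  simp

lemma exists_hasFDerivAt_hyperbolaMap {z : Amb d} (hz : 0 < z.2.1) :
    ∃ L : Amb d →L[ℝ] Amb d, HasFDerivAt hyperbolaMap L z ∧
      L.det = z.2.1 / √(z.2.1 ^ 2 + ‖z.2.2‖ ^ 2) := by
  have hb : HasFDerivAt (fun z : Amb d => z.2.1) _ z :=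
    (hasFDerivAt_fst (𝕜 := ℝ) (p := z.2)).comp z hasFDerivAt_snd
  have hy : HasFDerivAt (fun z : Amb d => z.2.2) _ z :=
    (hasFDerivAt_snd (𝕜 := ℝ) (p := z.2)).comp z hasFDerivAt_snd
  have hpos : 0 < z.2.1 ^ 2 + ‖z.2.2‖ ^ 2 := by positivity
  have hq := ((hb.pow 2).add hy.norm_sq).sqrt hpos.ne'
  refine ⟨_, (hasFDerivAt_fst (𝕜 := ℝ) (p := z)).prodMk (hq.prodMk hy), ?_⟩
  change LinearMap.det _ = _
  set R := √(z.2.1 ^ 2 + ‖z.2.2‖ ^ 2) with hR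
  have hR0 : 0 < R := Real.sqrt_pos.2 hpos
  let h : EuclideanSpace ℝ (Fin d) →ₗ[ℝ] ℝ := R⁻¹ • (innerSL ℝ z.2.2).toLinearMap
  let g : Mink d →ₗ[ℝ] Mink d := LinearMap.prod
    ((z.2.1 / R) • LinearMap.fst ℝ ℝ (EuclideanSpace ℝ (Fin d)) + h ∘ₗ LinearMap.snd ℝ ℝ (EuclideanSpace ℝ (Fin d)))
    (LinearMap.snd ℝ ℝ (EuclideanSpace ℝ (Fin d)))
  rw [det_lower_triangular LinearMap.id 0 g (fun w => by
    refine Prod.ext ?_ (Prod.ext ?_ ?_)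
    · simp
    · simp [g, h, ← hR]; field_simp
    · simp [g]),
    det_upper_triangular (L := g) ((z.2.1 / R) • LinearMap.id) h LinearMap.id (fun w => by
        refine Prod.ext ?_ ?_ <;> simp [g])]
  simp

lemma sqrt_sq_add_norm_smul_sq {b : ℝ} (hb : 0 ≤ b) (y : EuclideanSpace ℝ (Fin d)) :
    √(b ^ 2 + ‖b • y‖ ^ 2) = b * √(1 + ‖y‖ ^ 2) := by
  rw [norm_smul, Real.norm_of_nonneg hb,
    show b ^ 2 + (b * ‖y‖) ^ 2 = b ^ 2 * (1 + ‖y‖ ^ 2) by ring, Real.sqrt_mul (sq_nonneg _),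
    Real.sqrt_sq hb]

/-- The factorisation from which the Jacobian is read off: the three elementary maps contribute `s`,
`(s sn r)^d` and `1 / √(1 + |y|²)`, and the linear frame map contributes `±1`. -/
lemma polarMap_eq (k : ℝ) (p : Amb d) {z : Amb d} (hz : 0 ≤ z.1 * sn k z.2.1) :
    polarMap k p z = frameMap k p (hyperbolaMap (scaleMap (polarPlane k z))) := by
  have h := sqrt_sq_add_norm_smul_sq hz z.2.2
  rw [frameMap_apply, polarMap, unitFuture_eq, smul_add, smul_smul, smul_smul, ← map_smul]
  simp only [hyperbolaMap, scaleMap, polarPlane, h]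
  rfl

lemma exists_hasFDerivAt_polarMap {k : ℝ} {p : Amb d} (hp : p ∈ Quadric k d) {z : Amb d}
    (hz : z ∈ polarDom k d) :
    ∃ L : Amb d →L[ℝ] Amb d, HasFDerivAt (polarMap k p) L z ∧
      |L.det| = z.1 ^ (d + 1) * (sn k z.2.1 ^ d / √(1 + ‖z.2.2‖ ^ 2)) := by
  have hpos : ∀ w ∈ polarDom k d, 0 < w.1 * sn k w.2.1 := fun w hw =>
    mul_pos (by linarith [hw.1.1]) (sn_pos hw.2.1)
  obtain ⟨L₁, h₁, d₁⟩ := exists_hasFDerivAt_polarPlane k z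
  obtain ⟨L₂, h₂, d₂⟩ := exists_hasFDerivAt_scaleMap (polarPlane k z)
  obtain ⟨L₃, h₃, d₃⟩ := exists_hasFDerivAt_hyperbolaMap (z := scaleMap (polarPlane k z)) (hpos z hz)
  let F : Amb d →L[ℝ] Amb d := (frameMap k p).toContinuousLinearMap
  refine ⟨F ∘L (L₃ ∘L (L₂ ∘L L₁)), ?_, ?_⟩
  · refine (F.hasFDerivAt.comp z (h₃.comp z (h₂.comp z h₁))).congr_of_eventuallyEq ?_
    filter_upwards [(isOpen_polarDom k d).mem_nhds hz] with w hw
    exact polarMap_eq k p (hpos w hw).le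
  · have hdet : (F ∘L (L₃ ∘L (L₂ ∘L L₁))).det = F.det * (L₃.det * (L₂.det * L₁.det)) := by
      simp only [ContinuousLinearMap.det, ContinuousLinearMap.toLinearMap_comp, LinearMap.det_comp]
    have hF : |F.det| = 1 := by
      have h1 : F.det ^ 2 = 1 := det_frameMap_sq hp
      rw [← sq_abs] at h1
      nlinarith [abs_nonneg F.det]
    have hs : 0 < z.1 := by linarith [hz.1.1]
    have hn := sn_pos hz.2.1
    have hz' := hpos z hz
    have e := sqrt_sq_add_norm_smul_sq hz'.le z.2.2
    have hq : 0 < √(1 + ‖z.2.2‖ ^ 2) := Real.sqrt_pos.2 (by positivity)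
    rw [hdet, abs_mul, hF, one_mul, d₁, d₂, d₃]
    simp only [scaleMap, polarPlane]
    rw [e, abs_of_pos (by positivity)]
    field_simp
    ring

/-- The radial projection to the pseudosphere. -/
def hat (k : ℝ) (z : Amb d) : Amb d := (√(ambForm d k z z))⁻¹ • z

/-- The part of the ambient space between two multiples of the pseudosphere. -/
def shell (k : ℝ) (d : ℕ) : Set (Amb d) :=
  {z | √(ambForm d k z z) ∈ Set.Ioo 1 2 ∧ (k = 0 → 0 < z.1)}

lemma continuous_ambForm_self (k : ℝ) : Continuous fun z : Amb d => ambForm d k z z := by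
  simp only [ambForm_apply, eta]; fun_prop

lemma measurable_hat (k : ℝ) : Measurable (hat k : Amb d → Amb d) :=
  (((continuous_ambForm_self k).sqrt.measurable).inv).smul measurable_id

lemma isOpen_shell (k : ℝ) (d : ℕ) : IsOpen (shell k d) := by
  have h : IsOpen ((fun z : Amb d => √(ambForm d k z z)) ⁻¹' Set.Ioo 1 2) :=
    isOpen_Ioo.preimage (continuous_ambForm_self k).sqrt
  by_cases hk : k = 0
  · have e : shell k d = ((fun z : Amb d => √(ambForm d k z z)) ⁻¹' Set.Ioo 1 2) ∩
        {z | 0 < z.1} := by ext z; simp [shell, hk]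
    rw [e]; exact h.inter (isOpen_lt continuous_const continuous_fst)
  · have e : shell k d = ((fun z : Amb d => √(ambForm d k z z)) ⁻¹' Set.Ioo 1 2) := by
      ext z; simp [shell, hk]
    rw [e]; exact h

lemma hat_mem {k : ℝ} {z : Amb d} (hz : z ∈ shell k d) : hat k z ∈ Quadric k d := by
  have h1 : 0 < √(ambForm d k z z) := by linarith [hz.1.1]
  have h2 : √(ambForm d k z z) ^ 2 = ambForm d k z z :=
    Real.sq_sqrt (Real.sqrt_pos.1 h1).le
  refine ⟨?_, fun hk => ?_⟩
  · have h3 : ambForm d k (hat k z) (hat k z) = 1 := by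
      simp only [hat, map_smul, LinearMap.smul_apply, smul_eq_mul]
      field_simp; exact h2.symm
    rw [ambForm_apply] at h3; rw [← h3]; ring
  · have := hz.2 hk
    simp only [hat, Prod.smul_fst, smul_eq_mul]; positivity

lemma hat_polarMap {k : ℝ} {p : Amb d} (hp : p ∈ Quadric k d) {z : Amb d}
    (hz : z ∈ polarDom k d) :
    hat k (polarMap k p z) = cs k z.2.1 • p + sn k z.2.1 • unitFuture k p z.2.2 := by
  have hs : 0 < z.1 := by linarith [hz.1.1]
  rw [hat, ambForm_polarMap hp, Real.sqrt_sq hs.le, polarMap, smul_smul, inv_mul_cancel₀ hs.ne',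
    one_smul]

lemma polarMap_mem_shell {k : ℝ} {p : Amb d} (hp : p ∈ Quadric k d) {z : Amb d}
    (hz : z ∈ polarDom k d) : polarMap k p z ∈ shell k d := by
  have hs : 0 < z.1 := by linarith [hz.1.1]
  refine ⟨?_, fun hk => ?_⟩
  · rw [ambForm_polarMap hp, Real.sqrt_sq hs.le]; exact hz.1
  · have := (exp_mem hp z.2.1 z.2.2).2 hk
    rw [polarMap, Prod.smul_fst, smul_eq_mul]; exact mul_pos hs this

/-- The radial factor that the polar coordinates of the shell contribute. -/
def shellConst (d : ℕ) : ℝ := ∫ s in Set.Ioo (1 : ℝ) 2, s ^ (d + 1)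

lemma shellConst_pos (d : ℕ) : 0 < shellConst d := by
  have h : shellConst d = ∫ s in (1 : ℝ)..2, s ^ (d + 1) := by
    rw [shellConst, intervalIntegral.integral_of_le one_le_two,
      MeasureTheory.integral_Ioc_eq_integral_Ioo]
  rw [h]
  exact intervalIntegral.intervalIntegral_pos_of_pos_on
    ((continuous_pow (d + 1)).intervalIntegrable _ _) (fun s hs => pow_pos (by linarith [hs.1]) _)
    one_lt_two

instance : (MeasureTheory.volume : MeasureTheory.Measure (Mink d)).IsAddHaarMeasure :=
  inferInstanceAs ((MeasureTheory.volume : MeasureTheory.Measure ℝ).prod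
    (MeasureTheory.volume : MeasureTheory.Measure (EuclideanSpace ℝ (Fin d)))).IsAddHaarMeasure

instance : (MeasureTheory.volume : MeasureTheory.Measure (Amb d)).IsAddHaarMeasure :=
  inferInstanceAs ((MeasureTheory.volume : MeasureTheory.Measure ℝ).prod
    (MeasureTheory.volume : MeasureTheory.Measure (Mink d))).IsAddHaarMeasure

/-- Integration over the future of `p` in polar coordinates at `p`. The left side does not depend
on `p`. -/
theorem integral_shell {k : ℝ} {p : Amb d} (hp : p ∈ Quadric k d) {V : Type*}
    [NormedAddCommGroup V] [NormedSpace ℝ V] {g : Amb d → V}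
    (hg : ∀ q ∈ Quadric k d, g q ≠ 0 →
      ∃ r ∈ radii k, ∃ y : EuclideanSpace ℝ (Fin d), q = cs k r • p + sn k r • unitFuture k p y) :
    ∫ z in shell k d, g (hat k z) = shellConst d •
      ∫ w in radii k ×ˢ (Set.univ : Set (EuclideanSpace ℝ (Fin d))), (sn k w.1 ^ d / √(1 + ‖w.2‖ ^ 2)) •
        g (cs k w.1 • p + sn k w.1 • unitFuture k p w.2) := by
  have hmeas : MeasurableSet (polarDom k d) := (isOpen_polarDom k d).measurableSet
  choose! L hL hdet using fun z hz => exists_hasFDerivAt_polarMap hp (z := z) hz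
  -- Every point of the shell where the integrand does not vanish projects into the polar chart at
  -- `p`, and its radial coordinate is the square root of its `ambForm` square.
  have h1 : ∫ z in shell k d, g (hat k z) = ∫ z in polarMap k p '' polarDom k d, g (hat k z) := by
    refine MeasureTheory.setIntegral_eq_of_subset_of_forall_sdiff_eq_zero
      (isOpen_shell k d).measurableSet ?_ fun z hz => ?_
    · rintro _ ⟨z, hz, rfl⟩; exact polarMap_mem_shell hp hz
    · by_contra hne
      obtain ⟨r, hr, y, hq⟩ := hg _ (hat_mem hz.1) hne
      have h1 : 0 < √(ambForm d k z z) := by linarith [hz.1.1.1]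
      refine hz.2 ⟨(√(ambForm d k z z), (r, y)), ⟨hz.1.1, hr, trivial⟩, ?_⟩
      rw [polarMap, ← hq, hat, smul_smul, mul_inv_cancel₀ h1.ne', one_smul]
  rw [h1, MeasureTheory.integral_image_eq_integral_abs_det_fderiv_smul MeasureTheory.volume hmeas
    (fun z hz => (hL z hz).hasFDerivWithinAt) (polarMap_injOn hp)]
  have h2 : ∀ z ∈ polarDom k d, |(L z).det| • g (hat k (polarMap k p z)) =
      z.1 ^ (d + 1) • ((sn k z.2.1 ^ d / √(1 + ‖z.2.2‖ ^ 2)) •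
        g (cs k z.2.1 • p + sn k z.2.1 • unitFuture k p z.2.2)) := fun z hz => by
    rw [hdet z hz, hat_polarMap hp hz, mul_smul]
  rw [MeasureTheory.setIntegral_congr_fun hmeas h2, polarDom, MeasureTheory.Measure.volume_eq_prod,
    ← MeasureTheory.Measure.prod_restrict]
  exact MeasureTheory.integral_prod_smul (fun s : ℝ => s ^ (d + 1)) (fun w : ℝ × EuclideanSpace ℝ (Fin d) =>
    (sn k w.1 ^ d / √(1 + ‖w.2‖ ^ 2)) • g (cs k w.1 • p + sn k w.1 • unitFuture k p w.2))

end

/-! ### Differentiation under the integral sign, and derivatives of kernels and fields. -/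

section

open MeasureTheory

/-! ### Integrals that depend on a parameter -/

section Parameter

variable {E Q α : Type*} [NormedAddCommGroup E] [NormedSpace ℝ E]
  [NormedAddCommGroup Q] [MeasurableSpace α] {μ : Measure α} [IsFiniteMeasure μ]
  {h : α → Q} {K : Set Q}

lemma integrable_comp_of_compact {V : Type*} [NormedAddCommGroup V] (hm : AEStronglyMeasurable h μ)
    (hK : IsCompact K) (hhK : ∀ᵐ a ∂μ, h a ∈ K) {Φ : Q → V} (hΦ : Continuous Φ) :
    Integrable (fun a => Φ (h a)) μ := by
  obtain ⟨c, hc⟩ := hK.exists_bound_of_continuousOn hΦ.continuousOn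
  exact Integrable.of_bound (hΦ.comp_aestronglyMeasurable hm) c (hhK.mono fun a ha => hc _ ha)

variable [NormedSpace ℝ Q]

/-- The partial derivative in the first variable. -/
def partialDeriv {V : Type*} [NormedAddCommGroup V] [NormedSpace ℝ V] (Φ : E × Q → V)
    (z : E × Q) : E →L[ℝ] V :=
  (fderiv ℝ Φ z).comp (ContinuousLinearMap.inl ℝ E Q)

lemma contDiff_partialDeriv {V : Type*} [NormedAddCommGroup V] [NormedSpace ℝ V] {Φ : E × Q → V}
    (hΦ : ContDiff ℝ ∞ Φ) : ContDiff ℝ ∞ (partialDeriv Φ) :=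
  (hΦ.fderiv_right (m := ∞) le_rfl).clm_comp contDiff_const

lemma hasFDerivAt_partialDeriv {V : Type*} [NormedAddCommGroup V] [NormedSpace ℝ V] {Φ : E × Q → V}
    (hΦ : ContDiff ℝ ∞ Φ) (p : E) (q : Q) :
    HasFDerivAt (fun x => Φ (x, q)) (partialDeriv Φ (p, q)) p :=
  ((hΦ.differentiable (by simp)) (p, q)).hasFDerivAt.comp p (hasFDerivAt_prodMk_left p q)

/-- The integration variable enters only through `h`, whose values lie almost everywhere in a
compact set. On a closed unit ball of parameters the derivative is therefore bounded by a constant,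
which is integrable for a finite measure. -/
lemma hasFDerivAt_integral_param [ProperSpace E] {V : Type*} [NormedAddCommGroup V] [NormedSpace ℝ V]
    (hm : AEStronglyMeasurable h μ) (hK : IsCompact K) (hhK : ∀ᵐ a ∂μ, h a ∈ K) {Φ : E × Q → V}
    (hΦ : ContDiff ℝ ∞ Φ) (p : E) :
    HasFDerivAt (fun p => ∫ a, Φ (p, h a) ∂μ) (∫ a, partialDeriv Φ (p, h a) ∂μ) p := by
  have hc := (contDiff_partialDeriv hΦ).continuous
  obtain ⟨c, hcb⟩ := ((isCompact_closedBall p 1).prod hK).exists_bound_of_continuousOn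
    hc.continuousOn
  refine hasFDerivAt_integral_of_dominated_of_fderiv_le (𝕜 := ℝ) (bound := fun _ => c)
    (F := fun p a => Φ (p, h a)) (F' := fun p a => partialDeriv Φ (p, h a))
    (Metric.closedBall_mem_nhds p one_pos) ?_ ?_ ?_ ?_ ?_ ?_
  · exact Filter.Eventually.of_forall fun x =>
      (hΦ.continuous.comp (Continuous.prodMk_right x)).comp_aestronglyMeasurable hm
  · exact integrable_comp_of_compact hm hK hhK (hΦ.continuous.comp (Continuous.prodMk_right p))
  · exact (hc.comp (Continuous.prodMk_right p)).comp_aestronglyMeasurable hm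
  · exact hhK.mono fun a ha x hx => hcb (x, h a) ⟨hx, ha⟩
  · exact integrable_const c
  · exact Filter.Eventually.of_forall fun a x _ => hasFDerivAt_partialDeriv hΦ x (h a)

end Parameter

universe u

lemma contDiff_integral_param {E : Type} [NormedAddCommGroup E] [NormedSpace ℝ E] [ProperSpace E]
    {Q α : Type*} [NormedAddCommGroup Q] [NormedSpace ℝ Q] [MeasurableSpace α] {μ : Measure α}
    [IsFiniteMeasure μ] {h : α → Q} {K : Set Q} (hm : AEStronglyMeasurable h μ) (hK : IsCompact K)
    (hhK : ∀ᵐ a ∂μ, h a ∈ K) {V : Type u} [NormedAddCommGroup V] [NormedSpace ℝ V]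
    {Φ : E × Q → V} (hΦ : ContDiff ℝ ∞ Φ) :
    ContDiff ℝ ∞ fun p => ∫ a, Φ (p, h a) ∂μ := by
  rw [contDiff_infty]
  intro n
  -- The derivative is an integral of the same type with values in `E →L[ℝ] V`, so the target must
  -- vary; taking `E` in `Type` keeps it in the same universe.
  induction n generalizing V with
  | zero =>
    exact contDiff_zero.2 (continuous_iff_continuousAt.2 fun p =>
      (hasFDerivAt_integral_param hm hK hhK hΦ p).continuousAt)
  | succ n ih =>
    exact contDiff_succ_iff_hasFDerivAt.2 ⟨_, ih (contDiff_partialDeriv hΦ),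
      hasFDerivAt_integral_param hm hK hhK hΦ⟩

/-! ### Derivatives of radial kernels -/

variable {S : Type*} [NormedAddCommGroup S] [NormedSpace ℂ S]

lemma contDiff_chord (k : ℝ) : ContDiff ℝ ∞ fun z : Amb d × Amb d => chord k z.1 z.2 := by
  unfold chord metric eta
  have h : ContDiff ℝ ∞ fun z : Amb d × Amb d => (z.2 - z.1).2.2 := by fun_prop
  have := h.inner ℝ h
  fun_prop

lemma contDiff_cliff (C : CliffordModule d S) (k : ℝ) :
    ContDiff ℝ ∞ fun z : Amb d × Amb d => cliff C k z.1 z.2 := by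
  have h1 : ContDiff ℝ ∞ fun z : Amb d × Amb d => C.gamma z.1.2 :=
    C.gamma.contDiff.comp (contDiff_snd.comp contDiff_fst)
  have h2 : ContDiff ℝ ∞ fun z : Amb d × Amb d => C.gamma z.2.2 :=
    C.gamma.contDiff.comp (contDiff_snd.comp contDiff_snd)
  have c1 : ContDiff ℝ ∞ fun z : Amb d × Amb d => (z.1.1 : ℂ) :=
    Complex.ofRealCLM.contDiff.comp (contDiff_fst.comp contDiff_fst)
  have c2 : ContDiff ℝ ∞ fun z : Amb d × Amb d => (z.2.1 : ℂ) :=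
    Complex.ofRealCLM.contDiff.comp (contDiff_fst.comp contDiff_snd)
  exact ((c1.smul h2).sub (c2.smul h1)).add
    (((h2.mul h1).sub (h1.mul h2)).const_smul (Complex.I * sqrtC k / 2))

lemma contDiff_kernelOp (C : CliffordModule d S) (k : ℝ) {A B : ℝ → ℂ} (hA : ContDiff ℝ ∞ A)
    (hB : ContDiff ℝ ∞ B) :
    ContDiff ℝ ∞ fun z : Amb d × (Amb d × S) => kernelOp C k A B z.1 z.2.1 z.2.2 := by
  have hpq : ContDiff ℝ ∞ fun z : Amb d × (Amb d × S) => (z.1, z.2.1) :=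
    contDiff_fst.prodMk (contDiff_fst.comp contDiff_snd)
  have hc := (contDiff_chord (d := d) k).comp hpq
  have hs : ContDiff ℝ ∞ fun z : Amb d × (Amb d × S) => z.2.2 := contDiff_snd.comp contDiff_snd
  have h1 : ContDiff ℝ ∞ fun z : Amb d × (Amb d × S) => cliff C k z.1 z.2.1 z.2.2 :=
    (((ContinuousLinearMap.restrictScalarsL ℂ S S ℝ ℝ).contDiff.comp
      ((contDiff_cliff C k).comp hpq)).clm_apply hs)
  exact ((hA.comp hc).smul hs).add ((hB.comp hc).smul h1)

/-- The derivative of the radial kernel in the direction `v`. -/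
lemma hasDerivAt_kernelOp (C : CliffordModule d S) (k : ℝ) {A B : ℝ → ℂ} (hA : ContDiff ℝ ∞ A)
    (hB : ContDiff ℝ ∞ B) (p q v : Amb d) (s : S) :
    HasDerivAt (fun t : ℝ => kernelOp C k A B (p + t • v) q s)
      (((deriv A (chord k p q) * (-2 * metric k (q - p) v : ℝ)) • (1 : S →L[ℂ] S)
        + ((deriv B (chord k p q) * (-2 * metric k (q - p) v : ℝ)) • cliff C k p q
          + B (chord k p q) • cliff C k v q)) s) 0 := by
  have e : ∀ t : ℝ, chord k (p + t • v) q
      = chord k p q + t * (-2 * metric k (q - p) v) + t ^ 2 * metric k v v := fun t => by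
    have : q - (p + t • v) = (q - p) - t • v := by abel
    rw [chord, this, chord]
    simp only [← metricForm_apply, map_sub, map_smul, LinearMap.sub_apply, LinearMap.smul_apply,
      smul_eq_mul]
    rw [metricForm_apply k v q, metricForm_apply k v p, metric_comm k v q, metric_comm k v p]
    simp only [← metricForm_apply]; ring
  have hc : HasDerivAt (fun t : ℝ => chord k (p + t • v) q) (-2 * metric k (q - p) v) 0 := by
    have h1 := ((hasDerivAt_id (0 : ℝ)).mul_const (-2 * metric k (q - p) v)).const_add (chord k p q)
    have h2 := ((hasDerivAt_id (0 : ℝ)).pow 2).mul_const (metric k v v)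
    have h3 := h1.add h2
    refine (h3.congr_deriv (by simp)).congr_of_eventuallyEq (Filter.Eventually.of_forall fun t => ?_)
    simp [e t]
  have hc0 : chord k (p + (0 : ℝ) • v) q = chord k p q := by simp
  have hd : ∀ {G : ℝ → ℂ}, ContDiff ℝ ∞ G → HasDerivAt (fun t : ℝ => G (chord k (p + t • v) q))
      (deriv G (chord k p q) * (-2 * metric k (q - p) v : ℝ)) 0 := fun {G} hG => by
    have h1 : HasDerivAt G (deriv G (chord k p q)) (chord k (p + (0 : ℝ) • v) q) := by
      rw [hc0]; exact ((hG.differentiable (by simp)) _).hasDerivAt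
    refine (h1.scomp (0 : ℝ) hc).congr_deriv ?_
    rw [Complex.real_smul, mul_comm]
  have hX : HasDerivAt (fun t : ℝ => cliff C k (p + t • v) q s) (cliff C k v q s) 0 := by
    have e2 : (fun t : ℝ => cliff C k (p + t • v) q s)
        = fun t : ℝ => cliff C k p q s + t • cliff C k v q s := funext fun t => by
      rw [← cliffBilin_apply, map_add, map_smul, LinearMap.add_apply, LinearMap.smul_apply]; rfl
    rw [e2]
    exact (((hasDerivAt_id (0 : ℝ)).smul_const (cliff C k v q s)).const_add _).congr_deriv (by simp)
  have h := ((hd hA).smul_const s).add ((hd hB).smul hX)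
  refine h.congr_deriv ?_
  rw [hc0, zero_smul, add_zero]
  simp only [add_apply, smul_apply, one_apply_eq_self]
  abel

/-! ### The Dirac operator of a function of the projection -/

variable {k : ℝ} {M : Type*} [TopologicalSpace M] {proj : M → Quadric k d}

/-- Two local extensions agree on the pseudosphere near `proj x`, because the covering is a local
homeomorphism. The geodesic with velocity `v` stays in the pseudosphere, so their derivatives in the
tangent direction `v` agree. -/
lemma fieldDeriv_eq (hproj : IsCoveringMap proj) {ψ : M → S} {x : M} {F : Amb d → S}
    (hF : DifferentiableAt ℝ F (proj x)) (hψ : ∀ᶠ z in 𝓝 x, ψ z = F (proj z)) {v : Amb d}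
    (hv : IsTangent k (proj x : Amb d) v) :
    fieldDeriv proj ψ x v = fderiv ℝ F (proj x) v := by
  have hex : ∃ F : Amb d → S, DifferentiableAt ℝ F (proj x) ∧ ∀ᶠ z in 𝓝 x, ψ z = F (proj z) :=
    ⟨F, hF, hψ⟩
  rw [fieldDeriv, dif_pos hex]
  obtain ⟨hG, hG'⟩ := hex.choose_spec
  generalize hex.choose = G at hG hG'
  have h1 : ∀ᶠ q : Quadric k d in 𝓝 (proj x), G q = F q := by
    rw [← hproj.isLocalHomeomorph.map_nhds_eq x, Filter.eventually_map]
    filter_upwards [hψ, hG'] with z h2 h3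
    rw [← h2, ← h3]
  let γ : ℝ → Quadric k d := fun t => ⟨geod k (proj x) v t, geod_mem (proj x).2 hv t⟩
  have hγ : ContinuousAt γ 0 :=
    (continuousAt_codRestrict_iff _).2 (geod_hasDerivAt k (proj x) v 0).continuousAt
  have hγ0 : γ 0 = proj x := Subtype.ext (geod_zero k (proj x) v)
  have h2 : ∀ᶠ t in 𝓝 (0 : ℝ), G (geod k (proj x) v t) = F (geod k (proj x) v t) :=
    hγ.eventually (p := fun q : Quadric k d => G q = F q) (by rw [hγ0]; exact h1)
  have hd : HasDerivAt (geod k (proj x : Amb d) v) v 0 :=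
    (geod_hasDerivAt k (proj x) v 0).congr_deriv (by simp [geodVel, sn_zero, cs_zero])
  have h3 : HasDerivAt (fun t => G (geod k (proj x) v t)) (fderiv ℝ G (proj x) v) 0 := by
    refine HasFDerivAt.comp_hasDerivAt (0 : ℝ) ?_ hd
    rw [geod_zero]; exact hG.hasFDerivAt
  have h4 : HasDerivAt (fun t => F (geod k (proj x) v t)) (fderiv ℝ F (proj x) v) 0 := by
    refine HasFDerivAt.comp_hasDerivAt (0 : ℝ) ?_ hd
    rw [geod_zero]; exact hF.hasFDerivAt
  exact h3.unique (h4.congr_of_eventuallyEq h2)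

lemma dirac_eq (C : CliffordModule d S) (hproj : IsCoveringMap proj) {ψ : M → S} {x : M}
    {F : Amb d → S} (hF : DifferentiableAt ℝ F (proj x)) (hψ : ∀ᶠ z in 𝓝 x, ψ z = F (proj z)) :
    dirac C proj ψ x = ∑ i, (frameSign i : ℂ) • cliff C k (proj x) (frame k (proj x : Amb d) i)
      (fderiv ℝ F (proj x) (frame k (proj x : Amb d) i)
        + spinConn C k (proj x) (frame k (proj x : Amb d) i) (F (proj x))) := by
  rw [dirac]
  refine Finset.sum_congr rfl fun i _ => ?_
  rw [covDeriv, fieldDeriv_eq hproj hF hψ ((frame_spec (proj x).2).1 i), hψ.self_of_nhds,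
    Complex.coe_smul]
  rfl

end

/-! ### Integrals of radial kernels over the shell. -/

section

open MeasureTheory

variable {S : Type*} [NormedAddCommGroup S]
variable {k : ℝ} {M : Type*} [TopologicalSpace M] {proj : M → Quadric k d}

/-! ### Integrals of radial kernels over the shell -/

lemma futureField_mem (hproj : IsCoveringMap proj) (ψ : M → S) (x : M) (q : Amb d) :
    futureField hproj ψ x q ∈ insert 0 (ψ '' tsupport ψ) := by
  by_cases h : futureField hproj ψ x q = 0
  · exact Or.inl h
  · obtain ⟨x', hx', hrel, rfl⟩ := exists_of_futureField_ne_zero h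
    exact Or.inr ⟨x', hx', (futureField_eq hproj ψ hrel).symm⟩

lemma isCompact_proj_tsupport (hproj : IsCoveringMap proj) {ψ : M → S}
    (hψc : HasCompactSupport ψ) : IsCompact ((fun x => (proj x : Amb d)) '' tsupport ψ) :=
  hψc.isCompact.image (continuous_subtype_val.comp hproj.continuous)

lemma isCompact_insert_image {ψ : M → S} (hψ : Continuous ψ) (hψc : HasCompactSupport ψ) :
    IsCompact (insert 0 (ψ '' tsupport ψ)) :=
  (hψc.isCompact.image hψ).insert 0

lemma continuousOn_hat (k : ℝ) : ContinuousOn (hat k : Amb d → Amb d) (shell k d) :=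
  ((continuous_ambForm_self k).sqrt.continuousOn.inv₀ fun z hz => by
    linarith [hz.1.1]).smul continuousOn_id

/-- The part of the shell that lies over `K`. -/
def shellOver (k : ℝ) (K : Set (Amb d)) : Set (Amb d) := shell k d ∩ hat k ⁻¹' K

lemma measurableSet_shellOver {K : Set (Amb d)} (hK : IsCompact K) :
    MeasurableSet (shellOver k K) :=
  (isOpen_shell k d).measurableSet.inter (measurable_hat k hK.isClosed.measurableSet)

lemma volume_shellOver_lt_top {K : Set (Amb d)} (hK : IsCompact K) :
    volume (shellOver k K) < ⊤ := by
  obtain ⟨c, hc⟩ := hK.isBounded.exists_norm_le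
  refine (Bornology.IsBounded.subset (Metric.isBounded_closedBall (x := (0 : Amb d)) (r := 2 * c))
    fun z hz => ?_).measure_lt_top
  have h1 : 0 < √(ambForm d k z z) := by linarith [hz.1.1.1]
  have h2 : z = √(ambForm d k z z) • hat k z := by
    rw [hat, smul_smul, mul_inv_cancel₀ h1.ne', one_smul]
  rw [mem_closedBall_zero_iff, h2, norm_smul, Real.norm_of_nonneg h1.le]
  exact mul_le_mul hz.1.1.2.le (hc _ hz.2) (norm_nonneg _) zero_le_two

lemma ae_hat_futureField_mem (hproj : IsCoveringMap proj) {ψ : M → S}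
    (hψc : HasCompactSupport ψ) (x : M) :
    ∀ᵐ z ∂volume.restrict (shellOver k ((fun x => (proj x : Amb d)) '' tsupport ψ)),
      (hat k z, futureField hproj ψ x (hat k z)) ∈
        ((fun x => (proj x : Amb d)) '' tsupport ψ) ×ˢ (insert 0 (ψ '' tsupport ψ)) := by
  filter_upwards [ae_restrict_mem (measurableSet_shellOver (isCompact_proj_tsupport hproj hψc))]
    with z hz
  exact ⟨hz.2, futureField_mem hproj ψ x _⟩

variable [NormedSpace ℂ S]

/-- The future field as a function on the shell is measurable. -/
lemma aestronglyMeasurable_futureField (hproj : IsCoveringMap proj) {ψ : M → S}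
    (hψ : Continuous ψ) [FiniteDimensional ℂ S] (x : M) :
    AEStronglyMeasurable (fun z => futureField hproj ψ x (hat k z))
      (volume.restrict (shell k d)) := by
  have hc : ContinuousOn (fun z : Amb d => chord k (proj x : Amb d) (hat k z)) (shell k d) :=
    (continuous_chord k).comp_continuousOn (continuousOn_const.prodMk (continuousOn_hat k))
  let D : Set (Amb d) :=
    shell k d ∩ (fun z : Amb d => chord k (proj x : Amb d) (hat k z)) ⁻¹' chordRange k
  have hD : IsOpen D := hc.isOpen_inter_preimage (isOpen_shell k d) (isOpen_chordRange k)
  have hE : Continuous fun z : D => expInv k (proj x : Amb d) (hat k z) :=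
    continuous_expInv continuous_const
      (continuousOn_iff_continuous_domRestrict.1
        ((continuousOn_hat k).mono Set.inter_subset_left)) fun z => z.2.2
  have hEt : ∀ z : D, IsTangent k (proj x : Amb d) (expInv k (proj x) (hat k z)) ∧
      0 < metric k (expInv k (proj x : Amb d) (hat k z)) (expInv k (proj x : Amb d) (hat k z)) :=
    fun z => ⟨expInv_isTangent (proj x).2 (hat_mem z.2.1), metric_pos_of_radii (rad_mem z.2.2)
      (metric_expInv (proj x).2 (hat_mem z.2.1) z.2.2)⟩
  have hend : Continuous fun z : D => ψ (geodEnd hproj x (expInv k (proj x) (hat k z))) :=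
    hψ.comp (continuous_geodEnd hproj continuous_const hE hEt)
  have htc : Continuous fun z : D =>
      timeComponent k (proj x : Amb d) (expInv k (proj x) (hat k z)) :=
    (continuous_timeComponent k).comp (continuous_const.prodMk hE)
  let D' : Set (Amb d) := Subtype.val '' {z : D |
    0 < timeComponent k (proj x : Amb d) (expInv k (proj x) (hat k z))}
  have hD' : IsOpen D' :=
    hD.isOpenEmbedding_subtypeVal.isOpenMap _ (isOpen_lt continuous_const htc)
  have hD'D : D' ⊆ D := Subtype.coe_image_subset _ _
  have hcont : ContinuousOn (fun z => ψ (geodEnd hproj x (expInv k (proj x) (hat k z)))) D' :=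
    (continuousOn_iff_continuous_domRestrict.2 hend).mono hD'D
  -- On the shell the future field is a continuous function on the open set `D'` of points over the
  -- chronological future, and zero elsewhere.
  have hmeas : AEStronglyMeasurable
      (D'.indicator fun z => ψ (geodEnd hproj x (expInv k (proj x) (hat k z))))
      (volume.restrict (shell k d)) := by
    rw [aestronglyMeasurable_indicator_iff hD'.measurableSet,
      Measure.restrict_restrict hD'.measurableSet]
    exact (hcont.aestronglyMeasurable hD'.measurableSet).mono_measure
      (Measure.restrict_mono Set.inter_subset_left le_rfl)
  refine hmeas.congr ?_
  filter_upwards [ae_restrict_mem (isOpen_shell k d).measurableSet] with z hz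
  by_cases hz' : z ∈ D'
  · rw [Set.indicator_of_mem hz']
    obtain ⟨⟨z, hzD⟩, ht, rfl⟩ := hz'
    have hrel : TimelikeRel hproj x (geodEnd hproj x (expInv k (proj x) (hat k z))) :=
      ⟨_, rad_mem hzD.2, _, (hEt ⟨z, hzD⟩).1, metric_expInv (proj x).2 (hat_mem hzD.1) hzD.2,
        ht, rfl⟩
    rw [← futureField_eq hproj ψ hrel, proj_geodEnd hproj (hEt ⟨z, hzD⟩),
      geod_expInv (proj x).2 (hat_mem hzD.1) hzD.2]
  · rw [Set.indicator_of_notMem hz']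
    by_contra hne
    obtain ⟨x', -, hrel, hq⟩ := exists_of_futureField_ne_zero (Ne.symm hne)
    have hch : z ∈ D := ⟨hz, by rw [Set.mem_preimage, ← hq]; exact hrel.chord_mem⟩
    refine hz' ⟨⟨z, hch⟩, ?_, rfl⟩
    have := ((timelikeRel_iff hrel.chord_mem).1 hrel).1
    rw [hq] at this
    exact this

/-- The integral of the radial kernel with coefficients `A`, `B` against the field `ψ` on the
future of `x`. -/
def shellIntegral (C : CliffordModule d S) (hproj : IsCoveringMap proj) (ψ : M → S) (A B : ℝ → ℂ)
    (x : M) (p : Amb d) : S :=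
  ∫ z in shell k d, kernelOp C k A B p (hat k z) (futureField hproj ψ x (hat k z))

/-- The future field vanishes outside the projection of the support of `ψ`. The domain that remains
is bounded, hence of finite measure, and all values of the data lie in a compact set. -/
lemma shellIntegral_eq (C : CliffordModule d S) (hproj : IsCoveringMap proj) (ψ : M → S)
    (A B : ℝ → ℂ) (x : M) (p : Amb d) :
    shellIntegral C hproj ψ A B x p =
      ∫ z in shellOver k ((fun x => (proj x : Amb d)) '' tsupport ψ),
        kernelOp C k A B p (hat k z) (futureField hproj ψ x (hat k z)) := by
  refine setIntegral_eq_of_subset_of_forall_sdiff_eq_zero (isOpen_shell k d).measurableSet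
    Set.inter_subset_left fun z hz => ?_
  by_cases h : futureField hproj ψ x (hat k z) = 0
  · rw [h, map_zero]
  · obtain ⟨x', hx', -, hq⟩ := exists_of_futureField_ne_zero h
    exact absurd ⟨hz.1, x', hx', hq⟩ hz.2

/-- The derivative of the radial kernel in the direction `v`. -/
def kernelDerivOp (C : CliffordModule d S) (k : ℝ) (A B : ℝ → ℂ) (p q v : Amb d) : S →L[ℂ] S :=
  (deriv A (chord k p q) * (-2 * metric k (q - p) v : ℝ)) • (1 : S →L[ℂ] S)
    + ((deriv B (chord k p q) * (-2 * metric k (q - p) v : ℝ)) • cliff C k p q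
      + B (chord k p q) • cliff C k v q)

lemma partialDeriv_kernelOp (C : CliffordModule d S) {A B : ℝ → ℂ} (hA : ContDiff ℝ ∞ A)
    (hB : ContDiff ℝ ∞ B) (p q v : Amb d) (s : S) :
    partialDeriv (fun z : Amb d × (Amb d × S) => kernelOp C k A B z.1 z.2.1 z.2.2) (p, (q, s)) v
      = kernelDerivOp C k A B p q v s := by
  have h1 := hasFDerivAt_partialDeriv (contDiff_kernelOp C k hA hB) p (q, s)
  have hd : HasDerivAt (fun t : ℝ => p + t • v) v 0 :=
    (((hasDerivAt_id (0 : ℝ)).smul_const v).const_add p).congr_deriv (by simp)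
  have h2 : HasDerivAt (fun t : ℝ => kernelOp C k A B (p + t • v) q s)
      (partialDeriv (fun z : Amb d × (Amb d × S) => kernelOp C k A B z.1 z.2.1 z.2.2)
        (p, (q, s)) v) 0 := by
    refine HasFDerivAt.comp_hasDerivAt (0 : ℝ) (l := fun p => kernelOp C k A B p q s) ?_ hd
    rw [zero_smul, add_zero]; exact h1
  exact h2.unique (hasDerivAt_kernelOp C k hA hB p q v s)

section

variable [FiniteDimensional ℂ S]

lemma aestronglyMeasurable_hat_futureField (hproj : IsCoveringMap proj) {ψ : M → S}
    (hψ : Continuous ψ) (x : M) (K : Set (Amb d)) :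
    AEStronglyMeasurable (fun z => (hat k z, futureField hproj ψ x (hat k z)))
      (volume.restrict (shellOver k K)) :=
  (measurable_hat k).aestronglyMeasurable.prodMk
    ((aestronglyMeasurable_futureField hproj hψ x).mono_measure
      (Measure.restrict_mono Set.inter_subset_left le_rfl))

end

variable [FiniteDimensional ℂ S]

lemma contDiff_shellIntegral (C : CliffordModule d S) (hproj : IsCoveringMap proj) {ψ : M → S}
    (hψ : Continuous ψ) (hψc : HasCompactSupport ψ) {A B : ℝ → ℂ} (hA : ContDiff ℝ ∞ A)
    (hB : ContDiff ℝ ∞ B) (x : M) : ContDiff ℝ ∞ (shellIntegral C hproj ψ A B x) := by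
  have hK := isCompact_proj_tsupport hproj hψc
  have : IsFiniteMeasure
      (volume.restrict (shellOver k ((fun x => (proj x : Amb d)) '' tsupport ψ))) :=
    ⟨by rw [Measure.restrict_apply_univ]; exact volume_shellOver_lt_top hK⟩
  rw [funext (shellIntegral_eq C hproj ψ A B x)]
  exact contDiff_integral_param (aestronglyMeasurable_hat_futureField hproj hψ x _)
    (hK.prod (isCompact_insert_image hψ hψc)) (ae_hat_futureField_mem hproj hψc x)
    (contDiff_kernelOp C k hA hB)

/-- The coefficient of `1` in the image of a radial kernel under the Dirac operator. -/
def diracScalar (k : ℝ) (d : ℕ) (A B : ℝ → ℂ) (σ : ℝ) : ℂ :=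
  Complex.I * sqrtC k * (d + 1) / 2 * A σ - 2 * (σ * (1 - k / 4 * σ)) * deriv B σ
    - (d + 1) * (1 - k / 2 * σ) * B σ

/-- The coefficient of the bivector in the image of a radial kernel under the Dirac operator. -/
def diracBivector (k : ℝ) (d : ℕ) (A B : ℝ → ℂ) (σ : ℝ) : ℂ :=
  -2 * deriv A σ + Complex.I * sqrtC k * (1 - d) / 2 * B σ

/-- The Dirac operator acts on integrals of radial kernels through the kernel. -/
theorem dirac_shellIntegral (C : CliffordModule d S) (hproj : IsCoveringMap proj) {ψ : M → S}
    (hψ : Continuous ψ) (hψc : HasCompactSupport ψ) {A B : ℝ → ℂ} (hA : ContDiff ℝ ∞ A)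
    (hB : ContDiff ℝ ∞ B) {x : M} {P : M → S} {c : ℂ}
    (hP : ∀ᶠ z in 𝓝 x, P z = c • shellIntegral C hproj ψ A B x (proj z)) :
    dirac C proj P x =
      c • shellIntegral C hproj ψ (diracScalar k d A B) (diracBivector k d A B) x (proj x) := by
  have hK := isCompact_proj_tsupport hproj hψc
  set p : Amb d := (proj x).1 with hp
  have hpQ : p ∈ Quadric k d := (proj x).2
  set K := (fun x => (proj x : Amb d)) '' tsupport ψ with hKdef
  set θ : Amb d → S := futureField hproj ψ x with hθ
  have : IsFiniteMeasure (volume.restrict (shellOver k K)) :=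
    ⟨by rw [Measure.restrict_apply_univ]; exact volume_shellOver_lt_top hK⟩
  have hm := aestronglyMeasurable_hat_futureField hproj hψ x K
  have hK2 := hK.prod (isCompact_insert_image hψ hψc)
  have hae := ae_hat_futureField_mem hproj hψc x
  have hΦ := contDiff_kernelOp C k hA hB
  have hI1 : Integrable (fun z => kernelOp C k A B p (hat k z) (θ (hat k z)))
      (volume.restrict (shellOver k K)) :=
    integrable_comp_of_compact hm hK2 hae (hΦ.continuous.comp (Continuous.prodMk_right p))
  have hI2 : Integrable (fun z => partialDeriv
      (fun z : Amb d × (Amb d × S) => kernelOp C k A B z.1 z.2.1 z.2.2)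
      (p, (hat k z, futureField hproj ψ x (hat k z)))) (volume.restrict (shellOver k K)) :=
    integrable_comp_of_compact hm hK2 hae
    ((contDiff_partialDeriv hΦ).continuous.comp (Continuous.prodMk_right p))
  have hF : shellIntegral C hproj ψ A B x p
      = ∫ z in shellOver k K, kernelOp C k A B p (hat k z) (θ (hat k z)) :=
    shellIntegral_eq C hproj ψ A B x p
  have hI3 : ∀ v, Integrable (fun z => kernelDerivOp C k A B p (hat k z) v (θ (hat k z)))
      (volume.restrict (shellOver k K)) := fun v => by
    refine ((ContinuousLinearMap.apply ℝ S v).integrable_comp hI2).congr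
      (Filter.Eventually.of_forall fun z => ?_)
    exact partialDeriv_kernelOp C hA hB p (hat k z) v (θ (hat k z))
  have hDF : ∀ v, fderiv ℝ (shellIntegral C hproj ψ A B x) p v
      = ∫ z in shellOver k K, kernelDerivOp C k A B p (hat k z) v (θ (hat k z)) := fun v => by
    rw [funext (shellIntegral_eq C hproj ψ A B x),
      (hasFDerivAt_integral_param hm hK2 hae hΦ p).fderiv, ContinuousLinearMap.integral_apply hI2]
    exact integral_congr_ae (Filter.Eventually.of_forall fun z =>
      partialDeriv_kernelOp C hA hB p (hat k z) v (θ (hat k z)))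
  have hcomplete : CompleteSpace S := FiniteDimensional.complete ℂ S
  have hdiff : DifferentiableAt ℝ (shellIntegral C hproj ψ A B x) (proj x) :=
    (contDiff_shellIntegral C hproj hψ hψc hA hB x).differentiable (by simp) _
  -- The extension of `P` has its future field frozen at the fixed point `x`, so differentiation
  -- meets only the first argument of the kernel.
  rw [dirac_eq C hproj (F := fun p => c • shellIntegral C hproj ψ A B x p)
    (hdiff.const_smul c) hP, fderiv_fun_const_smul hdiff c,
    shellIntegral_eq C hproj ψ (diracScalar k d A B)]
  simp only [smul_apply, map_smul, ← smul_add]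
  simp only [smul_comm _ c, ← Finset.smul_sum]
  congr 1
  simp only [← hp, ← hKdef, hF, hDF]
  have hI4 : ∀ i, Integrable (fun z => (frameSign i : ℂ) • cliff C k p (frame k p i)
      (kernelDerivOp C k A B p (hat k z) (frame k p i) (θ (hat k z))
        + spinConn C k p (frame k p i) (kernelOp C k A B p (hat k z) (θ (hat k z)))))
      (volume.restrict (shellOver k K)) := fun i =>
    ((cliff C k p (frame k p i)).integrable_comp
      ((hI3 _).add ((spinConn C k p (frame k p i)).integrable_comp hI1))).smul (frameSign i : ℂ)
  have h1 : ∀ i : Fin (d + 1), (frameSign i : ℂ) • cliff C k p (frame k p i)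
      ((∫ z in shellOver k K, kernelDerivOp C k A B p (hat k z) (frame k p i) (θ (hat k z)))
        + spinConn C k p (frame k p i)
          (∫ z in shellOver k K, kernelOp C k A B p (hat k z) (θ (hat k z))))
      = ∫ z in shellOver k K, (frameSign i : ℂ) • cliff C k p (frame k p i)
      (kernelDerivOp C k A B p (hat k z) (frame k p i) (θ (hat k z))
        + spinConn C k p (frame k p i) (kernelOp C k A B p (hat k z) (θ (hat k z)))) := fun i => by
    have hI5 := (spinConn C k p (frame k p i)).integrable_comp hI1
    have h2 : Integrable (fun z => kernelDerivOp C k A B p (hat k z) (frame k p i) (θ (hat k z))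
        + spinConn C k p (frame k p i) (kernelOp C k A B p (hat k z) (θ (hat k z))))
        (volume.restrict (shellOver k K)) := (hI3 _).add hI5
    rw [integral_smul, ContinuousLinearMap.integral_comp_comm _ h2, integral_add (hI3 _) hI5,
      ContinuousLinearMap.integral_comp_comm _ hI1]
  rw [Finset.sum_congr rfl fun i _ => h1 i, ← integral_finsetSum _ fun i _ => hI4 i]
  refine setIntegral_congr_fun (measurableSet_shellOver (k := k) hK) fun z hz => ?_
  -- Under the integral, the claim is the pointwise identity for kernels.
  have key := DFunLike.congr_fun (sum_dirac_kernel C hpQ (hat_mem hz.1)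
    (A (chord k p (hat k z))) (B (chord k p (hat k z))) (deriv A (chord k p (hat k z)))
    (deriv B (chord k p (hat k z)))) (θ (hat k z))
  refine Eq.trans ?_ key
  rw [sum_apply]
  rfl

end

/-! ### Radial test functions and the first-order radial operators. -/

section

variable {k : ℝ}

/-! ### Radial test functions -/

lemma IsRadialTest.eq_zero {f : ℝ → ℂ} (hf : IsRadialTest k f) {r : ℝ} (hr : r ∉ radii k) :
    f r = 0 :=
  image_eq_zero_of_notMem_tsupport fun h => hr (hf.2.2 h)

lemma IsRadialTest.add {f g : ℝ → ℂ} (hf : IsRadialTest k f) (hg : IsRadialTest k g) :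
    IsRadialTest k fun r => f r + g r :=
  ⟨hf.1.add hg.1, hf.2.1.add hg.2.1, (tsupport_add f g).trans (Set.union_subset hf.2.2 hg.2.2)⟩

/-- The coefficient may be singular at the ends of `radii`: away from the support of `f` the product
vanishes locally. -/
lemma IsRadialTest.mul_left {f h : ℝ → ℂ} (hf : IsRadialTest k f)
    (hh : ∀ r ∈ radii k, ContDiffAt ℝ ∞ h r) : IsRadialTest k fun r => h r * f r := by
  have hsub : tsupport (fun r => h r * f r) ⊆ tsupport f := tsupport_mul_subset_right
  refine ⟨contDiff_iff_contDiffAt.2 fun r => ?_, hf.2.1.mul_left, hsub.trans hf.2.2⟩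
  by_cases hr : r ∈ tsupport f
  · exact (hh r (hf.2.2 hr)).mul hf.1.contDiffAt
  · refine contDiffAt_const (c := (0 : ℂ)) |>.congr_of_eventuallyEq ?_
    filter_upwards [(isClosed_tsupport f).isOpen_compl.mem_nhds hr] with t ht
    rw [image_eq_zero_of_notMem_tsupport ht, mul_zero]

lemma IsRadialTest.neg_deriv {f : ℝ → ℂ} (hf : IsRadialTest k f) :
    IsRadialTest k fun r => -deriv f r :=
  ⟨((contDiff_infty_iff_deriv.1 hf.1).2).neg, hf.2.1.deriv.neg,
    (show tsupport (fun r => -deriv f r) ⊆ tsupport f from by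
      refine closure_minimal (fun r hr => ?_) (isClosed_tsupport f)
      exact support_deriv_subset (by simpa using hr)).trans hf.2.2⟩

/-- Although `rad` is smooth only on `chordRange`, it is continuous everywhere. At any other point
its value is off the support of `f`, so the composite vanishes nearby. -/
lemma IsRadialTest.contDiff_comp_rad {f : ℝ → ℂ} (hf : IsRadialTest k f) :
    ContDiff ℝ ∞ fun σ => f (rad k σ) := by
  refine contDiff_iff_contDiffAt.2 fun σ => ?_
  by_cases hσ : σ ∈ chordRange k
  · exact hf.1.contDiffAt.comp σ (contDiffAt_rad hσ)
  · refine contDiffAt_const (c := (0 : ℂ)) |>.congr_of_eventuallyEq ?_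
    have h : rad k σ ∉ tsupport f := fun h => hσ (chordRange_of_rad_mem (hf.2.2 h))
    filter_upwards [(continuous_rad k).continuousAt
      ((isClosed_tsupport f).isOpen_compl.mem_nhds h)] with t ht
    exact image_eq_zero_of_notMem_tsupport ht

lemma IsRadialTest.tsupport_comp_rad {f : ℝ → ℂ} (hf : IsRadialTest k f) :
    tsupport (fun σ => f (rad k σ)) ⊆ chordRange k := fun σ hσ => by
  refine chordRange_of_rad_mem (hf.2.2 ?_)
  exact closure_minimal (t := rad k ⁻¹' tsupport f) (fun τ hτ => subset_tsupport f hτ)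
    ((isClosed_tsupport f).preimage (continuous_rad k)) hσ

/-! ### The first-order radial operators -/

lemma hasDerivAt_cs_half (k r : ℝ) :
    HasDerivAt (fun r => cs k (r / 2)) (-(k / 2) * sn k (r / 2)) r := by
  have h := (cs_hasDerivAt k (r / 2)).comp r ((hasDerivAt_id r).div_const 2)
  exact h.congr_deriv (by ring)

lemma hasDerivAt_sn_half (k r : ℝ) :
    HasDerivAt (fun r => sn k (r / 2)) (cs k (r / 2) / 2) r := by
  have h := (sn_hasDerivAt k (r / 2)).comp r ((hasDerivAt_id r).div_const 2)
  exact h.congr_deriv (by ring)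

lemma contDiff_cs_half (k : ℝ) : ContDiff ℝ ∞ fun r => cs k (r / 2) :=
  (contDiff_cs k).comp (contDiff_id.div_const 2)

lemma contDiff_sn_half (k : ℝ) : ContDiff ℝ ∞ fun r => sn k (r / 2) :=
  (contDiff_sn k).comp (contDiff_id.div_const 2)

lemma contDiffAt_ofReal {g : ℝ → ℝ} {r : ℝ} (hg : ContDiffAt ℝ ∞ g r) :
    ContDiffAt ℝ ∞ (fun r => (g r : ℂ)) r :=
  Complex.ofRealCLM.contDiff.contDiffAt.comp r hg

lemma contDiffAt_cs_div_sn {r : ℝ} (hr : r ∈ radii k) :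
    ContDiffAt ℝ ∞ (fun r => cs k (r / 2) / sn k (r / 2)) r :=
  (contDiff_cs_half k).contDiffAt.div (contDiff_sn_half k).contDiffAt (sn_half_pos hr).ne'

lemma contDiffAt_sn_div_cs {r : ℝ} (hr : r ∈ radii k) :
    ContDiffAt ℝ ∞ (fun r => sn k (r / 2) / cs k (r / 2)) r :=
  (contDiff_sn_half k).contDiffAt.div (contDiff_cs_half k).contDiffAt (cs_half_pos hr).ne.symm

/-- The Dirac operator on the radial coefficient of `ν Λ`; the result is the coefficient of `Λ`. -/
def diracOdd (k : ℝ) (d : ℕ) (f : ℝ → ℂ) (r : ℝ) : ℂ :=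
  -deriv f r + ((-(d / 2) * (cs k (r / 2) / sn k (r / 2)) : ℝ) : ℂ) * f r

/-- The Dirac operator on the radial coefficient of `Λ`; the result is the coefficient of `ν Λ`. -/
def diracEven (k : ℝ) (d : ℕ) (f : ℝ → ℂ) (r : ℝ) : ℂ :=
  -deriv f r + ((d / 2 * k * (sn k (r / 2) / cs k (r / 2)) : ℝ) : ℂ) * f r

lemma IsRadialTest.diracOdd (d : ℕ) {f : ℝ → ℂ} (hf : IsRadialTest k f) :
    IsRadialTest k (diracOdd k d f) :=
  hf.neg_deriv.add (hf.mul_left fun _ hr =>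
    contDiffAt_ofReal (contDiffAt_const.mul (contDiffAt_cs_div_sn hr)))

lemma IsRadialTest.diracEven (d : ℕ) {f : ℝ → ℂ} (hf : IsRadialTest k f) :
    IsRadialTest k (diracEven k d f) :=
  hf.neg_deriv.add (hf.mul_left fun _ hr =>
    contDiffAt_ofReal (contDiffAt_const.mul (contDiffAt_sn_div_cs hr)))

lemma IsRadialTest.hasDerivAt {f : ℝ → ℂ} (hf : IsRadialTest k f) (r : ℝ) :
    HasDerivAt f (deriv f r) r :=
  ((hf.1.differentiable (by simp)) r).hasDerivAt

lemma IsRadialTest.hasDerivAt_deriv {f : ℝ → ℂ} (hf : IsRadialTest k f) (r : ℝ) :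
    HasDerivAt (deriv f) (deriv (deriv f) r) r :=
  (((contDiff_infty_iff_deriv.1 hf.1).2.differentiable (by simp)) r).hasDerivAt

lemma IsRadialTest.deriv_eq_zero {f : ℝ → ℂ} (hf : IsRadialTest k f) {r : ℝ} (hr : r ∉ radii k) :
    deriv f r = 0 := by
  simpa using hf.neg_deriv.eq_zero hr

lemma IsRadialTest.deriv_deriv_eq_zero {f : ℝ → ℂ} (hf : IsRadialTest k f) {r : ℝ}
    (hr : r ∉ radii k) : deriv (deriv f) r = 0 := by
  have h := hf.neg_deriv.neg_deriv.eq_zero hr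
  have e : (fun r => -deriv f r) = -deriv f := rfl
  rwa [e, deriv.neg, neg_neg] at h

/-- With `a = (d/2) k sn/cs` and `b = -(d/2) cs/sn` at `r / 2`, the composite is `f'' - (a + b) f' +
(a b - a') f`. The double-angle formulas give `-(a + b) = d cs r / sn r`; moreover `a b = -k d² /
4`, and `a'` is the squared secant term. -/
lemma diracOdd_diracEven {f : ℝ → ℂ} (hf : IsRadialTest k f) (d : ℕ) :
    diracOdd k d (diracEven k d f) = radialT k d f := by
  funext r
  by_cases hr : r ∈ radii k
  · have hc := cs_half_pos hr
    have hs := sn_half_pos hr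
    have h1 : HasDerivAt (fun r => d / 2 * k * (sn k (r / 2) / cs k (r / 2)))
        (d / 2 * k * (1 / (2 * cs k (r / 2) ^ 2))) r := by
      refine (((hasDerivAt_sn_half k r).div (hasDerivAt_cs_half k r) hc.ne').const_mul
        (d / 2 * k)).congr_deriv ?_
      congr 1
      have := cs_sq_add k (r / 2)
      field_simp
      linear_combination this
    have h2 : deriv (diracEven k d f) r = -deriv (deriv f) r
        + (((d / 2 * k * (1 / (2 * cs k (r / 2) ^ 2)) : ℝ) : ℂ) * f r
          + ((d / 2 * k * (sn k (r / 2) / cs k (r / 2)) : ℝ) : ℂ) * deriv f r) :=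
      ((hf.hasDerivAt_deriv r).neg.add (h1.ofReal_comp.mul (hf.hasDerivAt r))).deriv
    rw [diracOdd, h2, diracEven, radialT, cs_eq_half k r, sn_eq_half k r]
    generalize cs k (r / 2) = c at *
    generalize sn k (r / 2) = s at *
    have hc' : (c : ℂ) ≠ 0 := by exact_mod_cast hc.ne'
    have hs' : (s : ℂ) ≠ 0 := by exact_mod_cast hs.ne'
    push_cast
    field_simp
    ring
  -- Outside `radii` the test function and its derivatives vanish, so the values of the singular
  -- coefficients there are irrelevant.
  · rw [(hf.diracEven d).diracOdd d |>.eq_zero hr, radialT, hf.eq_zero hr, hf.deriv_eq_zero hr,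
      hf.deriv_deriv_eq_zero hr]
    ring

/-- In the notation of `diracOdd_diracEven`, the composite in the other order has `a b - b'` in
place of `a b - a'`. This exchanges the squared secant for the squared cosecant and leaves the other
terms alone. -/
lemma diracEven_diracOdd {f : ℝ → ℂ} (hf : IsRadialTest k f) (d : ℕ) :
    diracEven k d (diracOdd k d f) = radialTHat k d f := by
  funext r
  by_cases hr : r ∈ radii k
  · have hc := cs_half_pos hr
    have hs := sn_half_pos hr
    have h1 : HasDerivAt (fun r => -(d / 2) * (cs k (r / 2) / sn k (r / 2)))
        (d / 2 * (1 / (2 * sn k (r / 2) ^ 2))) r := by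
      refine (((hasDerivAt_cs_half k r).div (hasDerivAt_sn_half k r) hs.ne').const_mul
        (-(d / 2 : ℝ))).congr_deriv ?_
      have := cs_sq_add k (r / 2)
      field_simp
      linear_combination (d : ℝ) * this
    have h2 : deriv (diracOdd k d f) r = -deriv (deriv f) r
        + (((d / 2 * (1 / (2 * sn k (r / 2) ^ 2)) : ℝ) : ℂ) * f r
          + ((-(d / 2) * (cs k (r / 2) / sn k (r / 2)) : ℝ) : ℂ) * deriv f r) :=
      ((hf.hasDerivAt_deriv r).neg.add (h1.ofReal_comp.mul (hf.hasDerivAt r))).deriv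
    rw [diracEven, h2, diracOdd, radialTHat, cs_eq_half k r, sn_eq_half k r]
    generalize cs k (r / 2) = c at *
    generalize sn k (r / 2) = s at *
    have hc' : (c : ℂ) ≠ 0 := by exact_mod_cast hc.ne'
    have hs' : (s : ℂ) ≠ 0 := by exact_mod_cast hs.ne'
    push_cast
    field_simp
    ring
  · rw [(hf.diracOdd d).diracEven d |>.eq_zero hr, radialTHat, hf.eq_zero hr, hf.deriv_eq_zero hr,
      hf.deriv_deriv_eq_zero hr]
    ring

/-! ### The radial kernel of a pair of test functions -/

/-- The scalar coefficient of the kernel `(f + f̂ ν) Λ`, as a function of the distance. -/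
def scalarCoef (k : ℝ) (f fhat : ℝ → ℂ) (r : ℝ) : ℂ :=
  (cs k (r / 2) : ℂ) * f r + (Complex.I * sqrtC k * (sn k (r / 2) : ℂ)) * fhat r

/-- The bivector coefficient of the kernel `(f + f̂ ν) Λ`, as a function of the distance. -/
def bivectorCoef (k : ℝ) (f fhat : ℝ → ℂ) (r : ℝ) : ℂ :=
  (Complex.I * sqrtC k * ((cs k (r / 2))⁻¹ / 2 : ℝ)) * f r + ((sn k (r / 2))⁻¹ / 2 : ℝ) * fhat r

lemma IsRadialTest.scalarCoef {f fhat : ℝ → ℂ} (hf : IsRadialTest k f)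
    (hfhat : IsRadialTest k fhat) : IsRadialTest k (scalarCoef k f fhat) :=
  (hf.mul_left fun _ _ => contDiffAt_ofReal (contDiff_cs_half k).contDiffAt).add
    (hfhat.mul_left fun _ _ =>
      contDiffAt_const.mul (contDiffAt_ofReal (contDiff_sn_half k).contDiffAt))

lemma IsRadialTest.bivectorCoef {f fhat : ℝ → ℂ} (hf : IsRadialTest k f)
    (hfhat : IsRadialTest k fhat) : IsRadialTest k (bivectorCoef k f fhat) :=
  (hf.mul_left fun _ hr => contDiffAt_const.mul (contDiffAt_ofReal
      (((contDiff_cs_half k).contDiffAt.inv (cs_half_pos hr).ne').div_const 2))).add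
    (hfhat.mul_left fun _ hr => contDiffAt_ofReal
      (((contDiff_sn_half k).contDiffAt.inv (sn_half_pos hr).ne').div_const 2))

lemma IsRadialTest.deriv_comp_rad {f : ℝ → ℂ} (hf : IsRadialTest k f) {σ : ℝ}
    (hσ : σ ∈ chordRange k) :
    deriv (fun σ => f (rad k σ)) σ = deriv f (rad k σ) * ((2 * sn k (rad k σ))⁻¹ : ℝ) := by
  refine ((hf.hasDerivAt (rad k σ)).scomp σ (hasDerivAt_rad hσ)).deriv.trans ?_
  rw [Complex.real_smul, mul_comm]

lemma IsRadialTest.deriv_comp_rad_eq_zero {f : ℝ → ℂ} (hf : IsRadialTest k f) {σ : ℝ}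
    (hσ : σ ∉ chordRange k) : deriv (fun σ => f (rad k σ)) σ = 0 := by
  by_contra h
  exact hσ (hf.tsupport_comp_rad (support_deriv_subset h))

lemma deriv_scalarCoef {f fhat : ℝ → ℂ} (hf : IsRadialTest k f) (hfhat : IsRadialTest k fhat)
    (r : ℝ) :
    deriv (scalarCoef k f fhat) r =
      (((-(k / 2) * sn k (r / 2) : ℝ) : ℂ) * f r + (cs k (r / 2) : ℂ) * deriv f r)
        + ((Complex.I * sqrtC k * ((cs k (r / 2) / 2 : ℝ) : ℂ)) * fhat r
          + (Complex.I * sqrtC k * (sn k (r / 2) : ℂ)) * deriv fhat r) :=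
  (((hasDerivAt_cs_half k r).ofReal_comp.mul (hf.hasDerivAt r)).add
    (((hasDerivAt_sn_half k r).ofReal_comp.const_mul _).mul (hfhat.hasDerivAt r))).deriv

lemma deriv_bivectorCoef {f fhat : ℝ → ℂ} (hf : IsRadialTest k f) (hfhat : IsRadialTest k fhat)
    {r : ℝ} (hr : r ∈ radii k) :
    deriv (bivectorCoef k f fhat) r =
      ((Complex.I * sqrtC k *
          ((-(-(k / 2) * sn k (r / 2)) / cs k (r / 2) ^ 2 / 2 : ℝ) : ℂ)) * f r
        + (Complex.I * sqrtC k * ((cs k (r / 2))⁻¹ / 2 : ℝ)) * deriv f r)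
      + (((-(cs k (r / 2) / 2) / sn k (r / 2) ^ 2 / 2 : ℝ) : ℂ) * fhat r
        + ((sn k (r / 2))⁻¹ / 2 : ℝ) * deriv fhat r) :=
  ((((((hasDerivAt_cs_half k r).inv (cs_half_pos hr).ne').div_const 2).ofReal_comp.const_mul
      _).mul (hf.hasDerivAt r)).add
    ((((hasDerivAt_sn_half k r).inv (sn_half_pos hr).ne').div_const 2).ofReal_comp.mul
      (hfhat.hasDerivAt r))).deriv

/-- Change of variable from chord to radius: `1 - k σ / 2 = cs r`, `σ (1 - k σ / 4) = sn² r`, and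
differentiation in `σ` is differentiation in `r` divided by `2 sn r`. The `f̂` part of the kernel
thereby feeds the new coefficient of `Λ`, and the `f` part that of `ν Λ`. -/
lemma diracScalar_coef {f fhat : ℝ → ℂ} (hf : IsRadialTest k f) (hfhat : IsRadialTest k fhat)
    (d : ℕ) :
    diracScalar k d (fun σ => scalarCoef k f fhat (rad k σ))
        (fun σ => bivectorCoef k f fhat (rad k σ))
      = fun σ => scalarCoef k (diracOdd k d fhat) (diracEven k d f) (rad k σ) := by
  funext σ
  have hA := hf.scalarCoef hfhat
  have hB := hf.bivectorCoef hfhat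
  by_cases hσ : σ ∈ chordRange k
  · have hr := rad_mem hσ
    have hc := cs_half_pos hr
    have hs := sn_half_pos hr
    have hκ := I_sqrtC_sq k
    have h1 := cs_eq_one_sub k (rad k σ)
    have h2 := sn_sq_eq k (rad k σ)
    rw [chord_rad hσ] at h1 h2
    have h3 : (1 - k / 2 * σ : ℂ) = (cs k (rad k σ) : ℝ) := by rw [h1]; push_cast; ring
    have h4 : (σ * (1 - k / 4 * σ) : ℂ) = ((sn k (rad k σ) ^ 2 : ℝ) : ℂ) := by
      rw [h2]; push_cast; ring
    rw [diracScalar, h3, h4, hB.deriv_comp_rad hσ, deriv_bivectorCoef hf hfhat hr, scalarCoef,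
      bivectorCoef, scalarCoef, diracOdd, diracEven, cs_eq_half k (rad k σ), sn_eq_half k (rad k σ)]
    generalize cs k (rad k σ / 2) = c at *
    generalize sn k (rad k σ / 2) = s at *
    generalize Complex.I * sqrtC k = w at *
    have hc' : (c : ℂ) ≠ 0 := by exact_mod_cast hc.ne'
    have hs' : (s : ℂ) ≠ 0 := by exact_mod_cast hs.ne'
    push_cast
    field_simp
    generalize f (rad k σ) = F at *
    generalize fhat (rad k σ) = G at *
    generalize deriv f (rad k σ) = F' at *
    generalize deriv fhat (rad k σ) = G' at *
    -- After the denominators are cleared, the only relation still needed is `(iκ)² = -k`.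
    linear_combination ((d + 1) * c * s ^ 2 * G) * hκ
  · have hr : rad k σ ∉ radii k := fun h => hσ (chordRange_of_rad_mem h)
    rw [diracScalar, hB.deriv_comp_rad_eq_zero hσ, hA.eq_zero hr, hB.eq_zero hr,
      ((hfhat.diracOdd d).scalarCoef (hf.diracEven d)).eq_zero hr]
    ring

lemma diracBivector_coef {f fhat : ℝ → ℂ} (hf : IsRadialTest k f) (hfhat : IsRadialTest k fhat)
    (d : ℕ) :
    diracBivector k d (fun σ => scalarCoef k f fhat (rad k σ))
        (fun σ => bivectorCoef k f fhat (rad k σ))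
      = fun σ => bivectorCoef k (diracOdd k d fhat) (diracEven k d f) (rad k σ) := by
  funext σ
  have hA := hf.scalarCoef hfhat
  have hB := hf.bivectorCoef hfhat
  by_cases hσ : σ ∈ chordRange k
  · have hr := rad_mem hσ
    have hc := cs_half_pos hr
    have hs := sn_half_pos hr
    have hκ := I_sqrtC_sq k
    rw [diracBivector, hA.deriv_comp_rad hσ, deriv_scalarCoef hf hfhat,
      bivectorCoef, bivectorCoef, diracOdd, diracEven, sn_eq_half k (rad k σ)]
    generalize cs k (rad k σ / 2) = c at *
    generalize sn k (rad k σ / 2) = s at *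
    generalize Complex.I * sqrtC k = w at *
    have hc' : (c : ℂ) ≠ 0 := by exact_mod_cast hc.ne'
    have hs' : (s : ℂ) ≠ 0 := by exact_mod_cast hs.ne'
    push_cast
    field_simp
    generalize f (rad k σ) = F at *
    generalize fhat (rad k σ) = G at *
    generalize deriv f (rad k σ) = F' at *
    generalize deriv fhat (rad k σ) = G' at *
    linear_combination (s * F * (1 - d)) * hκ
  · have hr : rad k σ ∉ radii k := fun h => hσ (chordRange_of_rad_mem h)
    rw [diracBivector, hA.deriv_comp_rad_eq_zero hσ, hB.eq_zero hr,
      ((hfhat.diracOdd d).bivectorCoef (hf.diracEven d)).eq_zero hr]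
    ring

end

/-! ### The area density, and superpositions as shell integrals. -/

section

open MeasureTheory

variable {k : ℝ} {M : Type*} [TopologicalSpace M] {proj : M → Quadric k d}
variable {S : Type*} [NormedAddCommGroup S]

/-! ### The area density of the hyperboloids -/

lemma fderiv_unitFuture (k : ℝ) (p : Amb d) (y v : EuclideanSpace ℝ (Fin d)) :
    fderiv ℝ (unitFuture k p) y v
      = frameVec k p (inner ℝ y v / √(1 + ‖y‖ ^ 2), v) := by
  have hpos : (0 : ℝ) < 1 + ‖y‖ ^ 2 := by positivity
  have h1 := (((hasFDerivAt_id (𝕜 := ℝ) y).norm_sq).const_add 1).sqrt hpos.ne'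
  have h2 := (frameVec k p).toContinuousLinearMap.hasFDerivAt.comp y
    (h1.prodMk (hasFDerivAt_id (𝕜 := ℝ) y))
  have h3 : HasFDerivAt (unitFuture k p) _ y := h2
  rw [h3.fderiv]
  simp only [ContinuousLinearMap.comp_apply, ContinuousLinearMap.prod_apply]
  change frameVec k p _ = _
  congr 1
  refine Prod.ext ?_ rfl
  simp
  field_simp

/-- The matrix determinant lemma for a rank-one perturbation of the identity. -/
lemma det_outer_sub_one (w : Fin d → ℝ) (a : ℝ) :
    Matrix.det (Matrix.of fun i j : Fin d => a * (w i * w j - if i = j then 1 else 0))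
      = (-a) ^ d * (1 - ∑ i, w i ^ 2) := by
  have h : (Matrix.of fun i j : Fin d => a * (w i * w j - if i = j then 1 else 0))
      = (-a) • (1 + Matrix.replicateCol Unit (fun i => -w i) * Matrix.replicateRow Unit w) := by
    ext i j
    simp [Matrix.one_apply, Matrix.mul_apply]
    ring
  rw [h, Matrix.det_smul, Fintype.card_fin, Matrix.det_one_add_replicateCol_mul_replicateRow]
  congr 1
  simp [dotProduct, sq, sub_eq_add_neg]

/-- The Gram matrix is `sn² r` times `w wᵀ - 1` with `w = y / √(1 + |y|²)`, and `1 - |w|² = 1 / (1 +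
|y|²)`. The result is the angular factor of the Jacobian of `polarMap`, so hypersurface and shell
integrals match. -/
lemma areaDensity_eq {p : Amb d} (hp : p ∈ Quadric k d) {r : ℝ} (hr : r ∈ radii k)
    (y : EuclideanSpace ℝ (Fin d)) :
    areaDensity k (fun z => geod k p (r • unitFuture k p z) 1) y
      = sn k r ^ d / √(1 + ‖y‖ ^ 2) := by
  have hs := sn_pos hr
  have hpos : (0 : ℝ) < 1 + ‖y‖ ^ 2 := by positivity
  have hΦ : (fun z => geod k p (r • unitFuture k p z) 1)
      = fun z => cs k r • p + sn k r • unitFuture k p z :=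
    funext fun z => geod_unit p (metric_unitFuture hp z) r
  have hdiff : DifferentiableAt ℝ (unitFuture k p) y :=
    (contDiff_unitFuture k p).differentiable (by simp) y
  have hD : ∀ v, fderiv ℝ (fun z => cs k r • p + sn k r • unitFuture k p z) y v
      = sn k r • frameVec k p (inner ℝ y v / √(1 + ‖y‖ ^ 2), v) := fun v => by
    rw [fderiv_const_add, fderiv_fun_const_smul hdiff, smul_apply, fderiv_unitFuture]
  have hm : ∀ i j : Fin d,
      metric k (fderiv ℝ (fun z => cs k r • p + sn k r • unitFuture k p z) y
          (EuclideanSpace.single i 1))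
        (fderiv ℝ (fun z => cs k r • p + sn k r • unitFuture k p z) y
          (EuclideanSpace.single j 1))
      = sn k r ^ 2 * (y i / √(1 + ‖y‖ ^ 2) * (y j / √(1 + ‖y‖ ^ 2)) - if i = j then 1 else 0) :=
    fun i j => by
    rw [hD, hD, metric_smul_smul, metric_frameVec hp, eta]
    simp only [EuclideanSpace.inner_single_right, PiLp.single_apply]
    simp [sq, eq_comm (a := j)]
  have hw : 1 - ∑ i, (y i / √(1 + ‖y‖ ^ 2)) ^ 2 = 1 / (1 + ‖y‖ ^ 2) := by
    simp only [div_pow, Real.sq_sqrt hpos.le, ← Finset.sum_div]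
    rw [← EuclideanSpace.real_norm_sq_eq]
    field_simp; ring
  rw [areaDensity, hΦ]
  simp only [hm]
  rw [det_outer_sub_one, hw, abs_mul, abs_pow, abs_neg, abs_of_pos (by positivity : 0 < sn k r ^ 2),
    abs_of_pos (by positivity : 0 < 1 / (1 + ‖y‖ ^ 2)), Real.sqrt_mul (by positivity), ← pow_mul,
    mul_comm 2 d, pow_mul, Real.sqrt_sq (by positivity), Real.sqrt_div zero_le_one, Real.sqrt_one,
    mul_one_div]

/-! ### Superpositions in polar coordinates -/

variable [NormedSpace ℂ S]

/-- With `U² = 1`, expand `(f + f̂ U)(cs + iκ sn U)` at the half angle and substitute `p ∧ q = sn r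
U` with `sn r = 2 sn(r/2) cs(r/2)`. Division by this factor produces the reciprocals in
`bivectorCoef`. -/
lemma kernelOp_coef (C : CliffordModule d S) {p u : Amb d} (hp : p ∈ Quadric k d)
    (hu : IsTangent k p u) (hu1 : metric k u u = 1) (f fhat : ℝ → ℂ) {r : ℝ} (hr : r ∈ radii k) :
    kernelOp C k (fun σ => scalarCoef k f fhat (rad k σ)) (fun σ => bivectorCoef k f fhat (rad k σ))
        p (cs k r • p + sn k r • u)
      = f r • lamOp C k p u r + fhat r • (cliff C k p u * lamOp C k p u r) := by
  have hc : (cs k (r / 2) : ℂ) ≠ 0 := by exact_mod_cast (cs_half_pos hr).ne'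
  have hs : (sn k (r / 2) : ℂ) ≠ 0 := by exact_mod_cast (sn_half_pos hr).ne'
  have hX : cliff C k p u * cliff C k p u = (1 : S →L[ℂ] S) := by
    rw [cliff_sq C hp hu, hu1, Complex.ofReal_one, one_smul]
  have hq : cliff C k p (cs k r • p + sn k r • u)
      = ((2 * sn k (r / 2) * cs k (r / 2) : ℝ) : ℂ) • cliff C k p u := by
    rw [cliff_add_right, cliff_smul_right, cliff_smul_right, cliff_self, smul_zero, zero_add,
      Complex.coe_smul, sn_eq_half k r]
  rw [kernelOp, chord_geod hp hu hu1, rad_chord hr, hq, lamOp, mul_add, mul_smul_comm,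
    mul_smul_comm, hX, mul_one, scalarCoef, bivectorCoef]
  generalize cs k (r / 2) = c at *
  generalize sn k (r / 2) = s at *
  push_cast
  match_scalars
  · ring
  · field_simp

/-- The radial superposition of the test functions `f`, `f̂`, as a function of the polar
coordinates at `x`. -/
def polarIntegrand (C : CliffordModule d S) (hproj : IsCoveringMap proj) (ψ : M → S)
    (f fhat : ℝ → ℂ) (x : M) (w : ℝ × EuclideanSpace ℝ (Fin d)) : S :=
  (sn k w.1 ^ d / √(1 + ‖w.2‖ ^ 2)) •
    (f w.1 • lamOp C k (proj x) (unitFuture k (proj x : Amb d) w.2) w.1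
        (ψ (geodEnd hproj x (w.1 • unitFuture k (proj x : Amb d) w.2)))
      + fhat w.1 • cliff C k (proj x) (unitFuture k (proj x : Amb d) w.2)
        (lamOp C k (proj x) (unitFuture k (proj x : Amb d) w.2) w.1
          (ψ (geodEnd hproj x (w.1 • unitFuture k (proj x : Amb d) w.2)))))

lemma polarIntegrand_eq (C : CliffordModule d S) (hproj : IsCoveringMap proj) (ψ : M → S)
    (f fhat : ℝ → ℂ) (x : M) {w : ℝ × EuclideanSpace ℝ (Fin d)} (hw : w.1 ∈ radii k) :
    polarIntegrand C hproj ψ f fhat x w = (sn k w.1 ^ d / √(1 + ‖w.2‖ ^ 2)) •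
      kernelOp C k (fun σ => scalarCoef k f fhat (rad k σ))
        (fun σ => bivectorCoef k f fhat (rad k σ)) (proj x)
        (cs k w.1 • (proj x : Amb d) + sn k w.1 • unitFuture k (proj x : Amb d) w.2)
        (futureField hproj ψ x
          (cs k w.1 • (proj x : Amb d) + sn k w.1 • unitFuture k (proj x : Amb d) w.2)) := by
  have hu := unitFuture_timelike (proj x) (radii_pos hw) w.2
  have hm := metric_unitFuture (proj x).2 w.2
  have hq : (proj (geodEnd hproj x (w.1 • unitFuture k (proj x : Amb d) w.2)) : Amb d)
      = cs k w.1 • (proj x : Amb d) + sn k w.1 • unitFuture k (proj x : Amb d) w.2 := by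
    rw [proj_geodEnd hproj hu, geod_unit _ hm]
  rw [kernelOp_coef C (proj x).2 (unitFuture_isTangent (proj x).2 w.2) hm f fhat hw, ← hq,
    futureField_eq hproj ψ (timelikeRel_geodEnd hproj x hw w.2)]
  rfl

/-- The superposition as an integral over the shell. -/
lemma integral_polarIntegrand (C : CliffordModule d S) (hproj : IsCoveringMap proj) (ψ : M → S)
    (f fhat : ℝ → ℂ) (x : M) :
    ∫ w in radii k ×ˢ Set.univ, polarIntegrand C hproj ψ f fhat x w
      = (((shellConst d)⁻¹ : ℝ) : ℂ) • shellIntegral C hproj ψ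
        (fun σ => scalarCoef k f fhat (rad k σ)) (fun σ => bivectorCoef k f fhat (rad k σ))
        x (proj x) := by
  rw [shellIntegral, integral_shell (proj x).2
    (g := fun q => kernelOp C k (fun σ => scalarCoef k f fhat (rad k σ))
      (fun σ => bivectorCoef k f fhat (rad k σ)) (proj x) q (futureField hproj ψ x q)) ?_,
    Complex.coe_smul, smul_smul, inv_mul_cancel₀ (shellConst_pos d).ne', one_smul]
  · exact setIntegral_congr_fun ((isOpen_radii k).measurableSet.prod MeasurableSet.univ)
      fun w hw => polarIntegrand_eq C hproj ψ f fhat x hw.1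
  · intro q _ hne
    -- A nonzero integrand places `q` over the chronological future of `x`, which the polar chart
    -- covers.
    have h1 : futureField hproj ψ x q ≠ 0 := fun h => hne (by simp only [h, map_zero])
    obtain ⟨x', -, ⟨r, hr, v, hv, hvr, ht, rfl⟩, rfl⟩ := exists_of_futureField_ne_zero h1
    obtain ⟨y, rfl⟩ := exists_unitFuture (proj x).2 hv (radii_pos hr) hvr ht
    refine ⟨r, hr, y, ?_⟩
    rw [proj_geodEnd hproj (unitFuture_timelike (proj x) (radii_pos hr) y),
      geod_unit _ (metric_unitFuture (proj x).2 y)]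

end

/-! ### Convergence, and spherical means in polar coordinates. -/

section

open MeasureTheory

variable {k : ℝ} {M : Type*} [TopologicalSpace M] {proj : M → Quadric k d}
variable {S : Type*} [NormedAddCommGroup S] [NormedSpace ℂ S]

/-! ### Convergence of the polar integrals -/

lemma isRadialTest_zero (k : ℝ) : IsRadialTest k fun _ => 0 := by
  have h : tsupport (fun _ : ℝ => (0 : ℂ)) = ∅ := by
    rw [tsupport_eq_empty_iff]; rfl
  exact ⟨contDiff_const, by rw [HasCompactSupport, h]; exact isCompact_empty,
    by rw [h]; exact Set.empty_subset _⟩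

/-- A cut-off with value `1` at `r` exhibits a single spherical mean as a slice of a compactly
supported `polarIntegrand`, and so provides its convergence. -/
lemma exists_isRadialTest {r : ℝ} (hr : r ∈ radii k) : ∃ f, IsRadialTest k f ∧ f r = 1 := by
  obtain ⟨g, h1, h2, h3, -, h5⟩ := exists_contDiff_tsupport_subset (n := ⊤)
    ((isOpen_radii k).mem_nhds hr)
  refine ⟨fun t => (g t : ℂ), ⟨Complex.ofRealCLM.contDiff.comp h3,
    h2.comp_left Complex.ofReal_zero, ?_⟩, by simp only [h5, Complex.ofReal_one]⟩
  refine (closure_mono fun t ht => ?_).trans h1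
  exact fun h => ht (by simp only [h, Complex.ofReal_zero])

lemma continuousOn_polar_geodEnd (hproj : IsCoveringMap proj) (x : M) :
    ContinuousOn (fun w : ℝ × EuclideanSpace ℝ (Fin d) =>
      geodEnd hproj x (w.1 • unitFuture k (proj x : Amb d) w.2)) (radii k ×ˢ Set.univ) := by
  rw [continuousOn_iff_continuous_domRestrict]
  have hu := (contDiff_unitFuture k (proj x : Amb d)).continuous
  exact continuous_geodEnd hproj continuous_const
    ((continuous_fst.comp continuous_subtype_val).smul
      (hu.comp (continuous_snd.comp continuous_subtype_val)))
    fun w => unitFuture_timelike (proj x) (radii_pos w.2.1) w.1.2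

lemma continuous_lamOp (C : CliffordModule d S) (k : ℝ) (p : Amb d) :
    Continuous fun w : ℝ × EuclideanSpace ℝ (Fin d) => lamOp C k p (unitFuture k p w.2) w.1 := by
  have hX : Continuous fun w : ℝ × EuclideanSpace ℝ (Fin d) => cliff C k p (unitFuture k p w.2) :=
    (contDiff_cliff C k).continuous.comp (continuous_const.prodMk
      ((contDiff_unitFuture k p).continuous.comp continuous_snd))
  have hc := (continuous_cs k).comp
    ((continuous_fst (X := ℝ) (Y := EuclideanSpace ℝ (Fin d))).div_const 2)
  have hs := (continuous_sn k).comp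
    ((continuous_fst (X := ℝ) (Y := EuclideanSpace ℝ (Fin d))).div_const 2)
  exact ((Complex.continuous_ofReal.comp hc).smul continuous_const).add
    ((continuous_const.mul (Complex.continuous_ofReal.comp hs)).smul hX)

lemma polarIntegrand_eq_zero (C : CliffordModule d S) (hproj : IsCoveringMap proj) (ψ : M → S)
    {f fhat : ℝ → ℂ} (x : M) {w : ℝ × EuclideanSpace ℝ (Fin d)} (hf : f w.1 = 0)
    (hfhat : fhat w.1 = 0) : polarIntegrand C hproj ψ f fhat x w = 0 := by
  simp only [polarIntegrand, hf, hfhat, zero_smul, add_zero, smul_zero]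

lemma continuous_polarIntegrand (C : CliffordModule d S) (hproj : IsCoveringMap proj) {ψ : M → S}
    (hψ : Continuous ψ) {f fhat : ℝ → ℂ} (hf : IsRadialTest k f) (hfhat : IsRadialTest k fhat)
    (x : M) : Continuous (polarIntegrand C hproj ψ f fhat x) := by
  refine continuous_iff_continuousAt.2 fun w => ?_
  by_cases hw : w.1 ∈ radii k
  · have hU : IsOpen (radii k ×ˢ (Set.univ : Set (EuclideanSpace ℝ (Fin d)))) :=
      (isOpen_radii k).prod isOpen_univ
    have hN : ContinuousAt (fun w : ℝ × EuclideanSpace ℝ (Fin d) =>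
        ψ (geodEnd hproj x (w.1 • unitFuture k (proj x : Amb d) w.2))) w :=
      hψ.continuousAt.comp ((continuousOn_polar_geodEnd hproj x).continuousAt
        (hU.mem_nhds ⟨hw, trivial⟩))
    have hL := ((continuous_lamOp C k (proj x)).continuousAt (x := w)).clm_apply hN
    have hX : Continuous fun w : ℝ × EuclideanSpace ℝ (Fin d) =>
        cliff C k (proj x) (unitFuture k (proj x : Amb d) w.2) :=
      (contDiff_cliff C k).continuous.comp (continuous_const.prodMk
        ((contDiff_unitFuture k (proj x : Amb d)).continuous.comp continuous_snd))
    have hden : Continuous fun w : ℝ × EuclideanSpace ℝ (Fin d) =>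
        sn k w.1 ^ d / √(1 + ‖w.2‖ ^ 2) := by
      refine (((continuous_sn k).comp continuous_fst).pow d).div (by fun_prop) fun w => ?_
      exact (Real.sqrt_pos.2 (by positivity)).ne'
    exact hden.continuousAt.smul
      (((hf.1.continuous.comp continuous_fst).continuousAt.smul hL).add
        ((hfhat.1.continuous.comp continuous_fst).continuousAt.smul
          (hX.continuousAt.clm_apply hL)))
  · have h1 : w.1 ∉ tsupport f ∪ tsupport fhat := fun h =>
      hw (h.elim (fun h => hf.2.2 h) fun h => hfhat.2.2 h)
    refine continuousAt_const (y := (0 : S)) |>.congr ?_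
    have hop : IsOpen (tsupport f ∪ tsupport fhat)ᶜ :=
      ((isClosed_tsupport f).union (isClosed_tsupport fhat)).isOpen_compl
    filter_upwards [continuous_fst.continuousAt (hop.mem_nhds h1)] with z hz
    rw [Set.mem_preimage, Set.compl_union] at hz
    exact (polarIntegrand_eq_zero C hproj ψ x (image_eq_zero_of_notMem_tsupport hz.1)
      (image_eq_zero_of_notMem_tsupport hz.2)).symm

/-- An injective linear map in finite dimension is antilipschitz. This bounds the parameter on the
noncompact hyperboloid by the ambient position. -/
lemma exists_norm_le_of_unitFuture {p : Amb d} (hp : p ∈ Quadric k d) :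
    ∃ c : ℝ, 0 ≤ c ∧ ∀ y : EuclideanSpace ℝ (Fin d), ‖y‖ ≤ c * ‖unitFuture k p y‖ := by
  obtain ⟨c, -, hc⟩ := (frameVec k p).exists_antilipschitzWith
    (LinearMap.ker_eq_bot.2 (frameVec_injective hp))
  refine ⟨c, c.2, fun y => ?_⟩
  have h := hc.le_mul_dist (√(1 + ‖y‖ ^ 2), y) 0
  rw [map_zero, dist_zero_right, dist_zero_right, ← unitFuture_eq] at h
  exact (le_max_right _ _).trans h

/-- On the support, `r` lies in a compact part of `radii` and the end point `q` in the compact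
projection of the support of `ψ`. Hence `u(y) = (q - cs r p) / sn r` is bounded, and so is `y`. -/
lemma hasCompactSupport_polarIntegrand (C : CliffordModule d S) (hproj : IsCoveringMap proj)
    {ψ : M → S} (hψc : HasCompactSupport ψ) {f fhat : ℝ → ℂ} (hf : IsRadialTest k f)
    (hfhat : IsRadialTest k fhat) (x : M) :
    HasCompactSupport (polarIntegrand C hproj ψ f fhat x) := by
  have hT : IsCompact (tsupport f ∪ tsupport fhat) := hf.2.1.isCompact.union hfhat.2.1.isCompact
  have hTr : tsupport f ∪ tsupport fhat ⊆ radii k := Set.union_subset hf.2.2 hfhat.2.2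
  have hK := isCompact_proj_tsupport hproj hψc
  have hcont : ContinuousOn
      (fun z : ℝ × Amb d => (sn k z.1)⁻¹ • (z.2 - cs k z.1 • (proj x : Amb d)))
      ((tsupport f ∪ tsupport fhat) ×ˢ ((fun x => (proj x : Amb d)) '' tsupport ψ)) := by
    refine (((continuous_sn k).comp continuous_fst).continuousOn.inv₀ fun z hz =>
      (sn_pos (hTr hz.1)).ne').smul (Continuous.continuousOn ?_)
    exact continuous_snd.sub (((continuous_cs k).comp continuous_fst).smul continuous_const)
  obtain ⟨c, hc⟩ := (hT.prod hK).exists_bound_of_continuousOn hcont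
  obtain ⟨L, hL0, hL⟩ := exists_norm_le_of_unitFuture (proj x).2
  refine HasCompactSupport.intro (hT.prod (isCompact_closedBall (0 : EuclideanSpace ℝ (Fin d))
    (L * c))) fun w hw => ?_
  by_cases h1 : w.1 ∈ tsupport f ∪ tsupport fhat
  · have hr := hTr h1
    have hN : ψ (geodEnd hproj x (w.1 • unitFuture k (proj x : Amb d) w.2)) = 0 := by
      by_contra hne
      refine hw ⟨h1, mem_closedBall_zero_iff.2 ((hL w.2).trans (mul_le_mul_of_nonneg_left ?_ hL0))⟩
      have hq : (proj (geodEnd hproj x (w.1 • unitFuture k (proj x : Amb d) w.2)) : Amb d)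
          = cs k w.1 • (proj x : Amb d) + sn k w.1 • unitFuture k (proj x : Amb d) w.2 := by
        rw [proj_geodEnd hproj (unitFuture_timelike (proj x) (radii_pos hr) w.2),
          geod_unit _ (metric_unitFuture (proj x).2 w.2)]
      have h2 : ‖(sn k w.1)⁻¹ • ((proj (geodEnd hproj x (w.1 • unitFuture k (proj x : Amb d) w.2)) :
          Amb d) - cs k w.1 • (proj x : Amb d))‖ ≤ c := hc (w.1, _) ⟨h1, _, subset_tsupport ψ hne, rfl⟩
      rwa [hq, add_sub_cancel_left, smul_smul, inv_mul_cancel₀ (sn_pos hr).ne', one_smul] at h2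
    simp only [polarIntegrand, hN, map_zero, smul_zero, add_zero]
  · exact polarIntegrand_eq_zero C hproj ψ x
      (image_eq_zero_of_notMem_tsupport fun h => h1 (Or.inl h))
      (image_eq_zero_of_notMem_tsupport fun h => h1 (Or.inr h))

lemma integrable_polarIntegrand (C : CliffordModule d S) (hproj : IsCoveringMap proj) {ψ : M → S}
    (hψ : Continuous ψ) (hψc : HasCompactSupport ψ) {f fhat : ℝ → ℂ} (hf : IsRadialTest k f)
    (hfhat : IsRadialTest k fhat) (x : M) : Integrable (polarIntegrand C hproj ψ f fhat x) :=
  (continuous_polarIntegrand C hproj hψ hf hfhat x).integrable_of_hasCompactSupport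
    (hasCompactSupport_polarIntegrand C hproj hψc hf hfhat x)

lemma integrable_polarIntegrand_slice (C : CliffordModule d S) (hproj : IsCoveringMap proj)
    {ψ : M → S} (hψ : Continuous ψ) (hψc : HasCompactSupport ψ) {f fhat : ℝ → ℂ}
    (hf : IsRadialTest k f) (hfhat : IsRadialTest k fhat) (x : M) (r : ℝ) :
    Integrable fun y => polarIntegrand C hproj ψ f fhat x (r, y) := by
  refine Continuous.integrable_of_hasCompactSupport
    ((continuous_polarIntegrand C hproj hψ hf hfhat x).comp (Continuous.prodMk_right r)) ?_
  refine HasCompactSupport.intro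
    ((hasCompactSupport_polarIntegrand C hproj hψc hf hfhat x).isCompact.image continuous_snd)
    fun y hy => ?_
  exact image_eq_zero_of_notMem_tsupport fun h => hy ⟨_, h, rfl⟩

/-! ### Spherical means in polar coordinates -/

lemma IsAdmissible.isOpen_hypDomain (hd : 1 ≤ d) (hproj : IsCoveringMap proj) {Ω : Set M}
    (hΩ : IsAdmissible proj Ω) {x : M} (hx : x ∈ Ω) {r : ℝ} (hr : r ∈ radii k) :
    IsOpen (hypDomain proj Ω x r) := by
  have h : Continuous fun y => geodEnd hproj x (r • unitFuture k (proj x : Amb d) y) :=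
    continuous_geodEnd hproj continuous_const
      ((contDiff_unitFuture k (proj x : Amb d)).continuous.const_smul r)
      fun y => unitFuture_timelike (proj x) (radii_pos hr) y
  rw [show hypDomain proj Ω x r =
    (fun y => geodEnd hproj x (r • unitFuture k (proj x : Amb d) y)) ⁻¹' Ω from
    Set.ext fun y => hΩ.mem_hypDomain_iff hd hproj hx hr y]
  exact hΩ.1.preimage h

/-- The step shared by both kinds of means: the hypersurface integral over the part of the
hyperboloid in Ω becomes an integral over all `y`, because `H` vanishes where the geodesic of M ends
outside Ω. -/
lemma IsAdmissible.hypIntegral_eq (hd : 1 ≤ d) (hproj : IsCoveringMap proj) {Ω : Set M}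
    (hΩ : IsAdmissible proj Ω) {x : M} (hx : x ∈ Ω) {r : ℝ} (hr : r ∈ radii k) {G : M → S}
    {H : EuclideanSpace ℝ (Fin d) → S} (hH : Integrable H)
    (h1 : ∀ y, geodEnd hproj x (r • unitFuture k (proj x : Amb d) y) ∉ Ω → H y = 0)
    (h2 : ∀ y, GeodSeg proj Ω x (r • unitFuture k (proj x : Amb d) y)
        (geodEnd hproj x (r • unitFuture k (proj x : Amb d) y)) →
      (sn k r ^ d / √(1 + ‖y‖ ^ 2)) •
        G (geodEnd hproj x (r • unitFuture k (proj x : Amb d) y)) = H y) :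
    HypIntegrable proj Ω x r G ∧ hypIntegral proj Ω x r G = ∫ y, H y := by
  have hm := (hΩ.isOpen_hypDomain hd hproj hx hr).measurableSet
  have key : ∀ y ∈ hypDomain proj Ω x r, hypIntegrand proj Ω x r G y = H y := fun y hy => by
    have hend := (hΩ.mem_hypDomain_iff hd hproj hx hr y).1 hy
    rw [hypIntegrand, areaDensity_eq (proj x).2 hr, endPt_eq_geodEnd hproj (radii_pos hr) hy]
    exact h2 y (hΩ.geodSeg hd hproj hx (unitFuture_timelike (proj x) (radii_pos hr) y).1 hr
      (metric_smul_unitFuture (proj x) r y) hend)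
  refine ⟨(integrableOn_congr_fun key hm).2 hH.integrableOn, ?_⟩
  rw [hypIntegral, setIntegral_congr_fun hm key]
  exact setIntegral_eq_integral_of_forall_compl_eq_zero fun y hy =>
    h1 y fun h => hy ((hΩ.mem_hypDomain_iff hd hproj hx hr y).2 h)

section

variable {C : CliffordModule d S} {Ω : Set M} {ψ : M → S}

lemma IsAdmissible.hypIntegral_kern (hd : 1 ≤ d) (hproj : IsCoveringMap proj)
    (hΩ : IsAdmissible proj Ω) (hψ : Continuous ψ) (hψc : HasCompactSupport ψ)
    (hψΩ : tsupport ψ ⊆ Ω) {x : M} (hx : x ∈ Ω) {r : ℝ} (hr : r ∈ radii k) {e : ℝ → ℂ}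
    (he : IsRadialTest k e) (her : e r = 1) :
    HypIntegrable proj Ω x r (kern C proj Ω ψ x) ∧
      hypIntegral proj Ω x r (kern C proj Ω ψ x)
        = ∫ y, polarIntegrand C hproj ψ e (fun _ => 0) x (r, y) := by
  refine hΩ.hypIntegral_eq hd hproj hx hr
    (integrable_polarIntegrand_slice C hproj hψ hψc he (isRadialTest_zero k) x r)
    (fun y hy => ?_) fun y hy => ?_
  · have hN := image_eq_zero_of_notMem_tsupport fun h => hy (hψΩ h)
    simp only [polarIntegrand, hN, map_zero, smul_zero, add_zero]
  · rw [hΩ.kern_eq C (hproj := hproj) ψ hx hr hy]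
    simp only [polarIntegrand, her, one_smul, zero_smul, add_zero]

lemma IsAdmissible.hypIntegral_kernHat (hd : 1 ≤ d) (hproj : IsCoveringMap proj)
    (hΩ : IsAdmissible proj Ω) (hψ : Continuous ψ) (hψc : HasCompactSupport ψ)
    (hψΩ : tsupport ψ ⊆ Ω) {x : M} (hx : x ∈ Ω) {r : ℝ} (hr : r ∈ radii k) {e : ℝ → ℂ}
    (he : IsRadialTest k e) (her : e r = 1) :
    HypIntegrable proj Ω x r (kernHat C proj Ω ψ x) ∧
      hypIntegral proj Ω x r (kernHat C proj Ω ψ x)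
        = ∫ y, polarIntegrand C hproj ψ (fun _ => 0) e x (r, y) := by
  refine hΩ.hypIntegral_eq hd hproj hx hr
    (integrable_polarIntegrand_slice C hproj hψ hψc (isRadialTest_zero k) he x r)
    (fun y hy => ?_) fun y hy => ?_
  · have hN := image_eq_zero_of_notMem_tsupport fun h => hy (hψΩ h)
    simp only [polarIntegrand, hN, map_zero, smul_zero, add_zero]
  · rw [hΩ.kernHat_eq C (hproj := hproj) ψ hx hr hy]
    simp only [polarIntegrand, her, one_smul, zero_smul, zero_add]

lemma radialDensity_pos {r : ℝ} (hr : r ∈ radii k) (d : ℕ) : 0 < radialDensity k d r := by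
  have h := Real.Gamma_pos_of_pos (show 0 < ((d : ℝ) + 1) / 2 by positivity)
  have := sn_pos hr
  have := Real.pi_pos
  unfold radialDensity; positivity

lemma IsAdmissible.superIntegrand_eq (hd : 1 ≤ d) (hproj : IsCoveringMap proj)
    (hΩ : IsAdmissible proj Ω) (hψ : Continuous ψ) (hψc : HasCompactSupport ψ)
    (hψΩ : tsupport ψ ⊆ Ω) {x : M} (hx : x ∈ Ω) {f fhat : ℝ → ℂ} (hf : IsRadialTest k f)
    (hfhat : IsRadialTest k fhat) (r : ℝ) :
    superIntegrand C proj Ω f fhat ψ x r = ∫ y, polarIntegrand C hproj ψ f fhat x (r, y) := by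
  by_cases hr : r ∈ radii k
  · obtain ⟨e, he, her⟩ := exists_isRadialTest hr
    have h0 := isRadialTest_zero k
    have hm := (radialDensity_pos hr d).ne'
    -- At fixed radius the integrand is linear in the two numbers `f r` and `fhat r`; the
    -- normalisation of the means then cancels against `radialDensity`.
    have hp : ∀ y, polarIntegrand C hproj ψ f fhat x (r, y)
        = f r • polarIntegrand C hproj ψ e (fun _ => 0) x (r, y)
          + fhat r • polarIntegrand C hproj ψ (fun _ => 0) e x (r, y) := fun y => by
      simp only [polarIntegrand, her, one_smul, zero_smul, add_zero, zero_add]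
      rw [smul_add, smul_comm (f r), smul_comm (fhat r)]
    rw [superIntegrand, sphMean, sphMeanHat,
      (hΩ.hypIntegral_kern hd hproj hψ hψc hψΩ hx hr he her).2,
      (hΩ.hypIntegral_kernHat hd hproj hψ hψc hψΩ hx hr he her).2, smul_add,
      smul_comm (radialDensity k d r) (f r), smul_comm (radialDensity k d r) (fhat r), smul_inv_smul₀ hm,
      smul_inv_smul₀ hm, integral_congr_ae (Filter.Eventually.of_forall hp), ← integral_smul, ← integral_smul]
    exact (integral_add
      ((integrable_polarIntegrand_slice C hproj hψ hψc he h0 x r).smul (f r))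
      ((integrable_polarIntegrand_slice C hproj hψ hψc h0 he x r).smul (fhat r))).symm
  · have h1 := hf.eq_zero hr
    have h2 := hfhat.eq_zero hr
    rw [superIntegrand, h1, h2, zero_smul, zero_smul, add_zero, smul_zero]
    exact (integral_eq_zero_of_ae (Filter.Eventually.of_forall fun y =>
      polarIntegrand_eq_zero C hproj ψ x h1 h2)).symm

lemma IsAdmissible.integrableOn_superIntegrand (hd : 1 ≤ d) (hproj : IsCoveringMap proj)
    (hΩ : IsAdmissible proj Ω) (hψ : Continuous ψ) (hψc : HasCompactSupport ψ)
    (hψΩ : tsupport ψ ⊆ Ω) {x : M} (hx : x ∈ Ω) {f fhat : ℝ → ℂ} (hf : IsRadialTest k f)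
    (hfhat : IsRadialTest k fhat) :
    IntegrableOn (superIntegrand C proj Ω f fhat ψ x) (Set.Ioi 0) := by
  rw [funext (hΩ.superIntegrand_eq (C := C) hd hproj hψ hψc hψΩ hx hf hfhat)]
  exact (integrable_polarIntegrand C hproj hψ hψc hf hfhat x).integral_prod_left.integrableOn

lemma IsAdmissible.superposition_eq (hd : 1 ≤ d) (hproj : IsCoveringMap proj)
    (hΩ : IsAdmissible proj Ω) (hψ : Continuous ψ) (hψc : HasCompactSupport ψ)
    (hψΩ : tsupport ψ ⊆ Ω) {x : M} (hx : x ∈ Ω) {f fhat : ℝ → ℂ} (hf : IsRadialTest k f)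
    (hfhat : IsRadialTest k fhat) :
    superposition C proj Ω f fhat ψ x
      = (((shellConst d)⁻¹ : ℝ) : ℂ) • shellIntegral C hproj ψ
        (fun σ => scalarCoef k f fhat (rad k σ)) (fun σ => bivectorCoef k f fhat (rad k σ))
        x (proj x) := by
  have hI := integrable_polarIntegrand C hproj hψ hψc hf hfhat x
  rw [← integral_polarIntegrand, superposition,
    funext (hΩ.superIntegrand_eq (C := C) hd hproj hψ hψc hψΩ hx hf hfhat)]
  have h1 : ∀ r ∉ Set.Ioi (0 : ℝ), ∫ y, polarIntegrand C hproj ψ f fhat x (r, y) = 0 :=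
    fun r hr => integral_eq_zero_of_ae (Filter.Eventually.of_forall fun y =>
      polarIntegrand_eq_zero C hproj ψ x (hf.eq_zero fun h => hr h.1)
        (hfhat.eq_zero fun h => hr h.1))
  have h2 : ∀ w ∉ radii k ×ˢ (Set.univ : Set (EuclideanSpace ℝ (Fin d))),
      polarIntegrand C hproj ψ f fhat x w = 0 := fun w hw => by
    have h : w.1 ∉ radii k := fun h => hw ⟨h, trivial⟩
    exact polarIntegrand_eq_zero C hproj ψ x (hf.eq_zero h) (hfhat.eq_zero h)
  rw [setIntegral_eq_integral_of_forall_compl_eq_zero h1,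
    setIntegral_eq_integral_of_forall_compl_eq_zero h2]
  exact (integral_prod _ hI).symm

/-- Near `x₀`, the superposition is a smooth function of the projection. -/
lemma IsAdmissible.eventually_superposition_eq (hd : 1 ≤ d) (hproj : IsCoveringMap proj)
    (hΩ : IsAdmissible proj Ω) (hψ : Continuous ψ) (hψc : HasCompactSupport ψ)
    (hψΩ : tsupport ψ ⊆ Ω) {x : M} (hx : x ∈ Ω) {f fhat : ℝ → ℂ} (hf : IsRadialTest k f)
    (hfhat : IsRadialTest k fhat) :
    ∀ᶠ z in 𝓝 x, superposition C proj Ω f fhat ψ z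
      = (((shellConst d)⁻¹ : ℝ) : ℂ) • shellIntegral C hproj ψ
        (fun σ => scalarCoef k f fhat (rad k σ)) (fun σ => bivectorCoef k f fhat (rad k σ))
        x (proj z) := by
  filter_upwards [hΩ.1.mem_nhds hx, eventually_kernel_futureField C hproj hψc
    (hf.scalarCoef hfhat).tsupport_comp_rad (hf.bivectorCoef hfhat).tsupport_comp_rad x]
    with z hz hzq
  rw [hΩ.superposition_eq hd hproj hψ hψc hψΩ hz hf hfhat, shellIntegral, shellIntegral]
  simp only [hzq]

variable [FiniteDimensional ℂ S]

lemma IsAdmissible.smoothAt_superposition (hd : 1 ≤ d) (hproj : IsCoveringMap proj)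
    (hΩ : IsAdmissible proj Ω) (hψ : Continuous ψ) (hψc : HasCompactSupport ψ)
    (hψΩ : tsupport ψ ⊆ Ω) {x : M} (hx : x ∈ Ω) {f fhat : ℝ → ℂ} (hf : IsRadialTest k f)
    (hfhat : IsRadialTest k fhat) : SmoothAt proj (superposition C proj Ω f fhat ψ) x :=
  ⟨_, ((contDiff_shellIntegral C hproj hψ hψc (hf.scalarCoef hfhat).contDiff_comp_rad
    (hf.bivectorCoef hfhat).contDiff_comp_rad x).const_smul _).contDiffAt,
    hΩ.eventually_superposition_eq hd hproj hψ hψc hψΩ hx hf hfhat⟩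

/-- The Dirac operator acts on superpositions through first-order radial operators, which exchange
the two kinds of spherical means. -/
theorem IsAdmissible.dirac_superposition (hd : 1 ≤ d) (hproj : IsCoveringMap proj)
    (hΩ : IsAdmissible proj Ω) (hψ : Continuous ψ) (hψc : HasCompactSupport ψ)
    (hψΩ : tsupport ψ ⊆ Ω) {x : M} (hx : x ∈ Ω) {f fhat : ℝ → ℂ} (hf : IsRadialTest k f)
    (hfhat : IsRadialTest k fhat) {P : M → S}
    (hP : ∀ᶠ z in 𝓝 x, P z = superposition C proj Ω f fhat ψ z) :
    dirac C proj P x = superposition C proj Ω (diracOdd k d fhat) (diracEven k d f) ψ x := by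
  have hP' := hP.and (hΩ.eventually_superposition_eq (C := C) hd hproj hψ hψc hψΩ hx hf hfhat)
  rw [dirac_shellIntegral C hproj hψ hψc (hf.scalarCoef hfhat).contDiff_comp_rad
    (hf.bivectorCoef hfhat).contDiff_comp_rad (hP'.mono fun z hz => hz.1.trans hz.2),
    diracScalar_coef hf hfhat, diracBivector_coef hf hfhat,
    hΩ.superposition_eq hd hproj hψ hψc hψΩ hx (hfhat.diracOdd d) (hf.diracEven d)]

end

end

end

end LorentzSpinor

/-! ### The lemma. -/

open LorentzSpinor in
theorem lemma2p4 (d : ℕ) (hd : 1 ≤ d) (k : ℝ)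
    {M : Type*} [TopologicalSpace M] [SimplyConnectedSpace M]
    (proj : M → Quadric k d) (hproj : IsCoveringMap proj)
    {S : Type*} [NormedAddCommGroup S] [NormedSpace ℂ S] [FiniteDimensional ℂ S]
    (C : CliffordModule d S)
    (Ω : Set M) (hΩ : IsAdmissible proj Ω)
    (ψ : M → S) (hψ : ∀ x, SmoothAt proj ψ x) (hψc : HasCompactSupport ψ) (hψΩ : tsupport ψ ⊆ Ω)
    (f fhat : ℝ → ℂ) (hf : IsRadialTest k f) (hfhat : IsRadialTest k fhat) :
    (∀ x ∈ Ω, ∀ r ∈ radii k, HypIntegrable proj Ω x r (kern C proj Ω ψ x) ∧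
      HypIntegrable proj Ω x r (kernHat C proj Ω ψ x)) ∧
    (∀ x ∈ Ω,
      MeasureTheory.IntegrableOn (superIntegrand C proj Ω f fhat ψ x) (Set.Ioi 0) ∧
      MeasureTheory.IntegrableOn
        (superIntegrand C proj Ω (radialT k d f) (radialTHat k d fhat) ψ x) (Set.Ioi 0)) ∧
    (∀ x ∈ Ω, SmoothAt proj (superposition C proj Ω f fhat ψ) x) ∧
    ∀ x ∈ Ω, dirac C proj (dirac C proj (superposition C proj Ω f fhat ψ)) x
      = superposition C proj Ω (radialT k d f) (radialTHat k d fhat) ψ x := by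
  have hc : Continuous ψ :=
    continuous_iff_continuousAt.2 fun x => (hψ x).continuousAt hproj.continuous
  have hT : IsRadialTest k (radialT k d f) := by
    rw [← diracOdd_diracEven hf]; exact (hf.diracEven d).diracOdd d
  have hTHat : IsRadialTest k (radialTHat k d fhat) := by
    rw [← diracEven_diracOdd hfhat]; exact (hfhat.diracOdd d).diracEven d
  refine ⟨fun x hx r hr => ?_, fun x hx =>
    ⟨hΩ.integrableOn_superIntegrand hd hproj hc hψc hψΩ hx hf hfhat,
      hΩ.integrableOn_superIntegrand hd hproj hc hψc hψΩ hx hT hTHat⟩,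
    fun x hx => hΩ.smoothAt_superposition hd hproj hc hψc hψΩ hx hf hfhat, fun x hx => ?_⟩
  · obtain ⟨e, he, her⟩ := exists_isRadialTest hr
    exact ⟨(hΩ.hypIntegral_kern hd hproj hc hψc hψΩ hx hr he her).1,
      (hΩ.hypIntegral_kernHat hd hproj hc hψc hψΩ hx hr he her).1⟩
  · rw [← diracOdd_diracEven hf, ← diracEven_diracOdd hfhat]
    -- The first Dirac operator yields a superposition at every point of the open set Ω, hence near
    -- `x`, and the pair of radial functions has been exchanged. The second application exchanges it
    -- back.
    refine hΩ.dirac_superposition hd hproj hc hψc hψΩ hx (hfhat.diracOdd d) (hf.diracEven d) ?_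
    filter_upwards [hΩ.1.mem_nhds hx] with z hz
    exact hΩ.dirac_superposition hd hproj hc hψc hψΩ hz hf hfhat
      (Filter.Eventually.of_forall fun _ => rfl)
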